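/- **Theorem 6.1 (smoothness).** Let $n\ge 2$, let $E\in \mathrm{GL}_n(\mathbb C)$, and let $\mathcal B(E)$ be the $\mathbb C$-algebra presented by generators $u_{ij}$ ($1\le i,j\le n$) and the relations $E^{-1}u^tEu=I_n=uE^{-1}u^tE$, where $u=(u_{ij})$. 1. $\mathcal B(E)$ is smooth of dimension $3$: the $\mathcal B(E)$-bimodule $\mathcal B(E)$ has a resolution $0\to P_3\to P_2\to P_1\to P_0\to \mathcal B(E)\to 0$ by finitely generated projective $\mathcal B(E)$-bimodules (that is, modules over $\mathcal B(E)\otimes\mathcal B(E)^{\mathrm{op}}$), and it has no such resolution of length smaller than $3$. 2. For every $\mathcal B(E)$-bimodule $M$ and every $k\ge 4$, the Hochschild homology and cohomology spaces vanish: $H_k(\mathcal B(E),M)=0=H^k(\mathcal B(E),M)$. 3. Let $\Phi,\Phi^{-1}:\mathcal B(E)\to\mathbb C$ be the characters (algebra maps) with $\Phi(u)=E^{-1}E^t$ and $\Phi^{-1}(u)=(E^{-1}E^t)^{-1}$, and let ${}_{\Phi}\mathbb C_{\Phi^{-1}}$ be the space $\mathbb C$ with the bimodule structure $a\cdot x\cdot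 b=\Phi(a)\,x\,\Phi^{-1}(b)$. Then $H_3(\mathcal B(E),{}_{\Phi}\mathbb C_{\Phi^{-1}})\cong\mathbb C$. -/

import Mathlib

open CategoryTheory TensorProduct MulOpposite

namespace Hochschild

section Complexes

set_option linter.unusedSectionVars false

universe w v u

variable (k : Type w) [CommRing k] (A : Type v) [Ring A] [Algebra k A]

section Terms

variable {k A} {N N' : Type*} [AddCommGroup N] [Module k N] [AddCommGroup N'] [Module k N'] {n : ℕ}

/-- Multiplying two neighbours of a tuple is linear in every entry. -/
lemma contract_update (j : Fin n) (a : Fin (n + 1) → A) (i : Fin (n + 1)) :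
    ∃ (i' : Fin n) (φ : A →ₗ[k] A), ∀ x : A,
      Fin.contractNth j.castSucc (· * ·) (Function.update a i x) =
        Function.update (Fin.contractNth j.castSucc (· * ·) a) i' (φ x) := by
  rcases lt_trichotomy i j.castSucc with h | h | h
  · have h' : (i : ℕ) < j := h
    refine ⟨⟨i, by omega⟩, LinearMap.id, fun x => ?_⟩
    ext l
    simp only [Fin.contractNth, Function.update_apply, Fin.ext_iff, Fin.val_castSucc, Fin.val_succ,
      LinearMap.id_apply]
    grind
  · subst h
    refine ⟨j, LinearMap.mulRight k (a j.succ), fun x => ?_⟩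
    ext l
    simp only [Fin.contractNth, Function.update_apply, Fin.ext_iff, Fin.val_castSucc, Fin.val_succ,
      LinearMap.mulRight_apply]
    have : (l : ℕ) = j → l = j := fun h => Fin.ext h
    grind
  · have h' : (j : ℕ) < i := h
    by_cases h2 : (i : ℕ) = j + 1
    · obtain rfl : i = j.succ := Fin.ext h2
      refine ⟨j, LinearMap.mulLeft k (a j.castSucc), fun x => ?_⟩
      ext l
      simp only [Fin.contractNth, Function.update_apply, Fin.ext_iff, Fin.val_castSucc,
        Fin.val_succ, LinearMap.mulLeft_apply]
      have : (l : ℕ) = j → l = j := fun h => Fin.ext h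
      grind
    · refine ⟨⟨i - 1, by omega⟩, LinearMap.id, fun x => ?_⟩
      ext l
      simp only [Fin.contractNth, Function.update_apply, Fin.ext_iff, Fin.val_castSucc,
        Fin.val_succ, LinearMap.id_apply]
      grind

/-- `(a₁, …, aₙ₊₁) ↦ f (a₁, …, aⱼ aⱼ₊₁, …, aₙ₊₁)`. -/
noncomputable def contract (j : Fin n) (f : MultilinearMap k (fun _ : Fin n => A) N) :
    MultilinearMap k (fun _ : Fin (n + 1) => A) N :=
  MultilinearMap.mk' (fun a => f (Fin.contractNth j.castSucc (· * ·) a))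
    (fun a i x y => by
      obtain ⟨i', φ, h⟩ := contract_update (k := k) j a i
      simp only [h, map_add, MultilinearMap.map_update_add])
    (fun a i c x => by
      obtain ⟨i', φ, h⟩ := contract_update (k := k) j a i
      simp only [h, map_smul, MultilinearMap.map_update_smul])

lemma contract_apply (j : Fin n) (f : MultilinearMap k (fun _ : Fin n => A) N)
    (a : Fin (n + 1) → A) :
    contract j f a = f (Fin.contractNth j.castSucc (· * ·) a) := rfl

/-- `(a₁, …, aₙ₊₁) ↦ L a₁ (f (a₂, …, aₙ₊₁))`. -/
noncomputable def outerLeft (L : A →ₗ[k] N →ₗ[k] N')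
    (f : MultilinearMap k (fun _ : Fin n => A) N) :
    MultilinearMap k (fun _ : Fin (n + 1) => A) N' :=
  LinearMap.uncurryLeft (M := fun _ : Fin (n + 1) => A)
    { toFun := fun a => (L a).compMultilinearMap f
      map_add' := fun a b => by ext; simp
      map_smul' := fun c a => by ext; simp }

/-- `(a₁, …, aₙ₊₁) ↦ R aₙ₊₁ (f (a₁, …, aₙ))`. -/
noncomputable def outerRight (R : A →ₗ[k] N →ₗ[k] N')
    (f : MultilinearMap k (fun _ : Fin n => A) N) :
    MultilinearMap k (fun _ : Fin (n + 1) => A) N' :=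
  MultilinearMap.uncurryRight (M := fun _ : Fin (n + 1) => A) (R.flip.compMultilinearMap f)

lemma outerLeft_apply (L : A →ₗ[k] N →ₗ[k] N') (f : MultilinearMap k (fun _ : Fin n => A) N)
    (a : Fin (n + 1) → A) : outerLeft L f a = L (a 0) (f (Fin.tail a)) := rfl

lemma outerRight_apply (R : A →ₗ[k] N →ₗ[k] N') (f : MultilinearMap k (fun _ : Fin n => A) N)
    (a : Fin (n + 1) → A) : outerRight R f a = R (a (Fin.last n)) (f (Fin.init a)) := rfl

end Terms

section Faces

variable {A} {n : ℕ}

/-- The middle part of the `i`-th face of a tuple (`0 ≤ i ≤ n + 1`): delete `a₀` if `i = 0`,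
delete `aₙ` if `i = n + 1`, and multiply `aᵢ₋₁` with `aᵢ` otherwise. -/
def inner (i : Fin (n + 2)) (a : Fin (n + 1) → A) (l : Fin n) : A :=
  if (l : ℕ) + 1 < i then a l.castSucc
  else if (l : ℕ) + 1 = i then a l.castSucc * a l.succ else a l.succ

/-- The element that the `i`-th face lets act on the left: `a₀` if `i = 0`, else `1`. -/
def lf (i : Fin (n + 2)) (a : Fin (n + 1) → A) : A := if i = 0 then a 0 else 1

/-- The element that the `i`-th face lets act on the right: `aₙ` if `i = n + 1`, else `1`. -/
def rf (i : Fin (n + 2)) (a : Fin (n + 1) → A) : A :=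
  if i = Fin.last (n + 1) then a (Fin.last n) else 1

lemma inner_inner {i j : Fin (n + 2)} (h : i ≤ j) (a : Fin (n + 2) → A) :
    inner i (inner j.succ a) = inner j (inner i.castSucc a) := by
  ext l
  have h' : (i : ℕ) ≤ j := h
  simp only [inner, Fin.val_castSucc, Fin.val_succ, Fin.succ_castSucc]
  grind [mul_assoc]

lemma lf_lf {i j : Fin (n + 2)} (h : i ≤ j) (a : Fin (n + 2) → A) :
    lf j.succ a * lf i (inner j.succ a) = lf i.castSucc a * lf j (inner i.castSucc a) := by
  rcases eq_or_ne i 0 with rfl | hi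
  · rcases eq_or_ne j 0 with rfl | hj
    · simp [lf, inner]
    · have : (j : ℕ) ≠ 0 := fun h => hj (Fin.ext h)
      simp [lf, inner, hj, Fin.succ_ne_zero]
  · have hj : j ≠ 0 := fun e => hi (by subst e; simpa using h)
    simp [lf, hi, hj, Fin.succ_ne_zero]

lemma rf_rf {i j : Fin (n + 2)} (h : i ≤ j) (a : Fin (n + 2) → A) :
    rf i (inner j.succ a) * rf j.succ a = rf j (inner i.castSucc a) * rf i.castSucc a := by
  have hc : i.castSucc ≠ Fin.last (n + 2) := (Fin.castSucc_lt_last i).ne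
  rcases eq_or_ne j (Fin.last _) with rfl | hj
  · rcases eq_or_ne i (Fin.last _) with rfl | hi
    · simp [rf, inner, hc]
    · have : (i : ℕ) ≠ n + 1 := fun h => hi (Fin.ext h)
      have h3 : (i : ℕ) < n + 1 := by omega
      simp [rf, inner, hi, hc]
      grind
  · have hi : i ≠ Fin.last _ := fun e => hj (by subst e; exact le_antisymm (Fin.le_last _) h)
    have hj' : j.succ ≠ Fin.last (n + 2) := fun e => hj (Fin.succ_injective _ (by simpa using e))
    simp [rf, hi, hj, hc, hj']

lemma alternating_sum_eq_zero {V : Type*} [AddCommGroup V] [Module k V] (m : ℕ)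
    (G : Fin (m + 2) → Fin (m + 1) → V)
    (h : ∀ i j : Fin (m + 1), i ≤ j → G j.succ i = G i.castSucc j) :
    ∑ p : Fin (m + 2), (-1 : k) ^ (p : ℕ) • ∑ q : Fin (m + 1), (-1 : k) ^ (q : ℕ) • G p q = 0 := by
  simp only [Finset.smul_sum, smul_smul, ← pow_add]
  rw [← Finset.sum_product', Finset.univ_product_univ]
  let S : Finset (Fin (m + 2) × Fin (m + 1)) := {x | (x.1 : ℕ) ≤ (x.2 : ℕ)}
  rw [← Finset.sum_add_sum_compl S, ← eq_neg_iff_add_eq_zero, ← Finset.sum_neg_distrib]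
  refine Finset.sum_bij
    (fun x hx => (x.2.succ, Fin.castLT x.1 (lt_of_le_of_lt (Finset.mem_filter.mp hx).2 x.2.2)))
    ?_ ?_ ?_ ?_
  · intro x hx
    simp only [S, Finset.mem_filter_univ] at hx
    simp only [S, Finset.mem_compl, Finset.mem_filter_univ, Fin.val_succ, Fin.val_castLT]
    omega
  · rintro ⟨p, q⟩ hx ⟨p', q'⟩ hx' e
    simp only [Prod.mk.injEq, Fin.ext_iff, Fin.val_succ, Fin.val_castLT] at e ⊢
    omega
  · rintro ⟨p, q⟩ hx
    simp only [S, Finset.mem_compl, Finset.mem_filter_univ] at hx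
    refine ⟨(q.castSucc, ⟨p - 1, by omega⟩), ?_, ?_⟩
    · simp only [S, Finset.mem_filter_univ, Fin.val_castSucc]
      omega
    · refine Prod.ext (Fin.ext ?_) (Fin.ext ?_)
      · simp only [Fin.val_succ]
        omega
      · simp only [Fin.val_castLT, Fin.val_castSucc]
  · rintro ⟨p, q⟩ hx
    simp only [S, Finset.mem_filter_univ] at hx
    rw [h _ _ (show Fin.castLT p (lt_of_le_of_lt hx q.2) ≤ q from hx), Fin.castSucc_castLT,
      Fin.val_succ, Fin.val_castLT, ← neg_smul]
    congr 1
    ring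

lemma sum_faces {V : Type*} [AddCommGroup V] [Module k V] (g : Fin (n + 2) → V) :
    ∑ i : Fin (n + 2), (-1 : k) ^ (i : ℕ) • g i =
      g 0 + ∑ j : Fin n, (-1 : k) ^ ((j : ℕ) + 1) • g j.castSucc.succ
        + (-1 : k) ^ (n + 1) • g (Fin.last (n + 1)) := by
  rw [Fin.sum_univ_succ, Fin.sum_univ_castSucc]
  simp [add_assoc]

lemma inner_zero (a : Fin (n + 1) → A) : inner 0 a = Fin.tail a := by
  ext l; simp [inner, Fin.tail]

lemma inner_last (a : Fin (n + 1) → A) : inner (Fin.last _) a = Fin.init a := by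
  ext l; simp [inner, Fin.init]

lemma inner_mid (j : Fin n) (a : Fin (n + 1) → A) :
    inner j.castSucc.succ a = Fin.contractNth j.castSucc (· * ·) a := by
  ext l; simp [inner, Fin.contractNth]

lemma lf_mid (j : Fin n) (a : Fin (n + 1) → A) : lf j.castSucc.succ a = 1 := by
  simp [lf, Fin.succ_ne_zero]

lemma rf_mid (j : Fin n) (a : Fin (n + 1) → A) : rf j.castSucc.succ a = 1 := by
  have : j.castSucc.succ ≠ Fin.last (n + 1) := by
    rw [Fin.succ_castSucc]; exact (Fin.castSucc_lt_last _).ne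
  simp [rf, this]

end Faces

variable (M : Type u) [AddCommGroup M] [Module k M] [Module A M] [Module Aᵐᵒᵖ M]
  [IsScalarTower k A M] [IsScalarTower k Aᵐᵒᵖ M] [SMulCommClass A Aᵐᵒᵖ M]

/-- The left action `a ↦ (x ↦ a · x)` of a bimodule. -/
noncomputable def leftAct : A →ₗ[k] M →ₗ[k] M := (Algebra.lsmul k k M).toLinearMap

/-- The right action `a ↦ (x ↦ x · a)` of a bimodule. -/
noncomputable def rightAct : A →ₗ[k] M →ₗ[k] M :=
  (Algebra.lsmul k k M).toLinearMap ∘ₗ (opLinearEquiv k : A ≃ₗ[k] Aᵐᵒᵖ).toLinearMap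

variable {A M} in
lemma leftAct_apply (a : A) (x : M) : leftAct k A M a x = a • x := rfl

variable {A M} in
lemma rightAct_apply (a : A) (x : M) : rightAct k A M a x = op a • x := rfl

/-- The Hochschild coboundary
`δ : Hom(A^{⊗ n}, M) → Hom(A^{⊗ (n+1)}, M)`, with `Hom(A^{⊗ n}, M)` realised as the module of
`n`-multilinear maps:
`δ f (a₁, …, aₙ₊₁) = a₁ · f (a₂, …, aₙ₊₁) + ∑ⱼ (-1)ʲ f (a₁, …, aⱼ aⱼ₊₁, …, aₙ₊₁)
  + (-1)ⁿ⁺¹ f (a₁, …, aₙ) · aₙ₊₁`. -/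
noncomputable def coboundary (n : ℕ) :
    MultilinearMap k (fun _ : Fin n => A) M →ₗ[k]
      MultilinearMap k (fun _ : Fin (n + 1) => A) M where
  toFun f := outerLeft (leftAct k A M) f
    + ∑ j : Fin n, (-1 : k) ^ ((j : ℕ) + 1) • contract j f
    + (-1 : k) ^ (n + 1) • outerRight (rightAct k A M) f
  map_add' f g := by
    ext a
    simp only [add_apply, sum_apply, smul_apply,
      contract_apply, outerLeft_apply, outerRight_apply, map_add, smul_add,
      Finset.sum_add_distrib]
    abel
  map_smul' c f := by
    ext a
    simp only [add_apply, sum_apply, smul_apply,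
      contract_apply, outerLeft_apply, outerRight_apply, map_smul, smul_add,
      Finset.smul_sum, smul_comm c, RingHom.id_apply]

lemma coboundary_apply (n : ℕ) (f : MultilinearMap k (fun _ : Fin n => A) M)
    (a : Fin (n + 1) → A) :
    coboundary k A M n f a = a 0 • f (Fin.tail a)
      + ∑ j : Fin n, (-1 : k) ^ ((j : ℕ) + 1) • f (Fin.contractNth j.castSucc (· * ·) a)
      + (-1 : k) ^ (n + 1) • op (a (Fin.last n)) • f (Fin.init a) := by
  simp only [coboundary, LinearMap.coe_mk, AddHom.coe_mk, add_apply,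
    sum_apply, smul_apply,
    contract_apply, outerLeft_apply, outerRight_apply, leftAct_apply, rightAct_apply]

lemma coboundary_eq_sum (n : ℕ) (f : MultilinearMap k (fun _ : Fin n => A) M)
    (a : Fin (n + 1) → A) :
    coboundary k A M n f a =
      ∑ i : Fin (n + 2), (-1 : k) ^ (i : ℕ) • (lf i a • op (rf i a) • f (inner i a)) := by
  rw [coboundary_apply, sum_faces k (fun i => lf i a • op (rf i a) • f (inner i a))]
  simp only [inner_zero, inner_last, inner_mid, lf_mid, rf_mid]
  simp [lf, rf, (Fin.last_pos).ne, (Fin.last_pos).ne']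

lemma coboundary_comp (n : ℕ) :
    coboundary k A M (n + 1) ∘ₗ coboundary k A M n = 0 := by
  ext f a
  simp only [LinearMap.comp_apply, LinearMap.zero_apply, zero_apply]
  rw [coboundary_eq_sum]
  have key := alternating_sum_eq_zero k (n + 1) (fun p q =>
    (lf p a * lf q (inner p a)) • op (rf q (inner p a) * rf p a) • f (inner q (inner p a)))
    (fun i j h => by simp only [inner_inner h, lf_lf h, rf_rf h])
  rw [← key]
  refine Finset.sum_congr rfl fun p _ => ?_
  congr 1
  rw [coboundary_eq_sum, Finset.smul_sum, Finset.smul_sum]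
  refine Finset.sum_congr rfl fun q _ => ?_
  rw [smul_comm (op (rf p a)) ((-1 : k) ^ (q : ℕ)), smul_comm (lf p a) ((-1 : k) ^ (q : ℕ)),
    ← smul_comm (lf q (inner p a)) (op (rf p a)), op_mul, mul_smul, mul_smul]

/-- The module `M ⊗ A^{⊗ n}` of Hochschild chains. -/
abbrev Chains (n : ℕ) : Type (max u v w) := M ⊗[k] (PiTensorProduct k (fun _ : Fin n => A))

/-- The Hochschild boundary `b : M ⊗ A^{⊗ (n+1)} → M ⊗ A^{⊗ n}`,
`b (x ⊗ a₁ ⊗ ⋯ ⊗ aₙ₊₁) = x · a₁ ⊗ a₂ ⊗ ⋯ ⊗ aₙ₊₁ + ∑ⱼ (-1)ʲ x ⊗ a₁ ⊗ ⋯ ⊗ aⱼ aⱼ₊₁ ⊗ ⋯ ⊗ aₙ₊₁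
  + (-1)ⁿ⁺¹ aₙ₊₁ · x ⊗ a₁ ⊗ ⋯ ⊗ aₙ`. -/
noncomputable def boundary (n : ℕ) : Chains k A M (n + 1) →ₗ[k] Chains k A M n :=
  TensorProduct.lift
    { toFun := fun x => PiTensorProduct.lift
        (outerLeft (TensorProduct.mk k M _ ∘ₗ (rightAct k A M).flip x) (PiTensorProduct.tprod k)
          + ∑ j : Fin n, (-1 : k) ^ ((j : ℕ) + 1) •
              contract j ((TensorProduct.mk k M _ x).compMultilinearMap (PiTensorProduct.tprod k))
          + (-1 : k) ^ (n + 1) •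
              outerRight (TensorProduct.mk k M _ ∘ₗ (leftAct k A M).flip x)
                (PiTensorProduct.tprod k))
      map_add' := fun x y => by
        rw [← map_add]
        congr 1
        ext a
        simp only [add_apply, sum_apply, smul_apply,
          contract_apply, outerLeft_apply, outerRight_apply, map_add, smul_add,
          LinearMap.comp_apply, LinearMap.add_apply, LinearMap.compMultilinearMap_apply,
          Finset.sum_add_distrib]
        abel
      map_smul' := fun c x => by
        rw [RingHom.id_apply, ← map_smul]
        congr 1
        ext a
        simp only [add_apply, sum_apply, smul_apply,
          contract_apply, outerLeft_apply, outerRight_apply, map_smul, smul_add,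
          LinearMap.comp_apply, LinearMap.smul_apply, LinearMap.compMultilinearMap_apply,
          Finset.smul_sum, smul_comm c] }

lemma boundary_tmul (n : ℕ) (x : M) (a : Fin (n + 1) → A) :
    boundary k A M n (x ⊗ₜ PiTensorProduct.tprod k a) =
      (op (a 0) • x) ⊗ₜ PiTensorProduct.tprod k (Fin.tail a)
      + ∑ j : Fin n, (-1 : k) ^ ((j : ℕ) + 1) •
          (x ⊗ₜ PiTensorProduct.tprod k (Fin.contractNth j.castSucc (· * ·) a))
      + (-1 : k) ^ (n + 1) • ((a (Fin.last n) • x) ⊗ₜ PiTensorProduct.tprod k (Fin.init a)) := by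
  simp only [boundary, TensorProduct.lift.tmul, LinearMap.coe_mk, AddHom.coe_mk,
    PiTensorProduct.lift.tprod, add_apply,
    sum_apply, smul_apply,
    contract_apply, outerLeft_apply, outerRight_apply, LinearMap.comp_apply,
    LinearMap.compMultilinearMap_apply, LinearMap.flip_apply, leftAct_apply, rightAct_apply,
    TensorProduct.mk_apply]

lemma boundary_eq_sum (n : ℕ) (x : M) (a : Fin (n + 1) → A) :
    boundary k A M n (x ⊗ₜ PiTensorProduct.tprod k a) =
      ∑ i : Fin (n + 2), (-1 : k) ^ (i : ℕ) •
        ((rf i a • op (lf i a) • x) ⊗ₜ[k] PiTensorProduct.tprod k (inner i a)) := by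
  rw [boundary_tmul, sum_faces k
    (fun i => (rf i a • op (lf i a) • x) ⊗ₜ[k] PiTensorProduct.tprod k (inner i a))]
  simp only [inner_zero, inner_last, inner_mid, lf_mid, rf_mid]
  simp [lf, rf, (Fin.last_pos).ne, (Fin.last_pos).ne']

lemma boundary_comp (n : ℕ) : boundary k A M n ∘ₗ boundary k A M (n + 1) = 0 := by
  ext x a
  simp only [TensorProduct.AlgebraTensorModule.curry_apply, TensorProduct.curry_apply,
    LinearMap.restrictScalars_self,
    LinearMap.compMultilinearMap_apply, LinearMap.comp_apply,
    LinearMap.zero_apply]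
  rw [boundary_eq_sum]
  have key := alternating_sum_eq_zero k (n + 1) (fun p q =>
    ((rf q (inner p a) * rf p a) • op (lf p a * lf q (inner p a)) • x) ⊗ₜ[k]
      PiTensorProduct.tprod k (inner q (inner p a)))
    (fun i j h => by simp only [inner_inner h, lf_lf h, rf_rf h])
  simp only [map_sum, map_smul, boundary_eq_sum]
  refine Eq.trans ?_ key
  refine Finset.sum_congr rfl fun p _ => ?_
  congr 1
  refine Finset.sum_congr rfl fun q _ => ?_
  rw [← smul_comm (rf p a) (op (lf q (inner p a))), op_mul, mul_smul, mul_smul]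

/-- The Hochschild chain complex `⋯ → M ⊗ A^{⊗ 2} → M ⊗ A → M → 0`. -/
noncomputable def chainComplex : ChainComplex (ModuleCat.{max u v w} k) ℕ :=
  ChainComplex.of (fun n => ModuleCat.of k (Chains k A M n))
    (fun n => ModuleCat.ofHom (boundary k A M n))
    (fun n => by rw [← ModuleCat.ofHom_comp, boundary_comp]; rfl)

/-- The Hochschild cochain complex `0 → M → Hom(A, M) → Hom(A^{⊗ 2}, M) → ⋯`. -/
noncomputable def cochainComplex : CochainComplex (ModuleCat.{max u v} k) ℕ :=
  CochainComplex.of (fun n => ModuleCat.of k (MultilinearMap k (fun _ : Fin n => A) M))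
    (fun n => ModuleCat.ofHom (coboundary k A M n))
    (fun n => by rw [← ModuleCat.ofHom_comp, coboundary_comp]; rfl)

/-- Hochschild homology `H_n(A, M)`. -/
noncomputable def homology (n : ℕ) : ModuleCat.{max u v w} k := (chainComplex k A M).homology n

/-- Hochschild cohomology `H^n(A, M)`. -/
noncomputable def cohomology (n : ℕ) : ModuleCat.{max u v} k := (cochainComplex k A M).homology n

end Complexes
end Hochschild

namespace Hochschild

/-- The one-dimensional `A`-bimodule `_α k_β` attached to two characters `α, β` of `A`:
the space `k` with `a · x · b = α(a) x β(b)`. -/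
def CharBimodule {k A : Type*} [CommRing k] [Ring A] [Algebra k A] (_α _β : A →ₐ[k] k) : Type _ := k

section CharBimodule

variable {k A : Type*} [CommRing k] [Ring A] [Algebra k A] (α β : A →ₐ[k] k)

instance : AddCommGroup (CharBimodule α β) := inferInstanceAs (AddCommGroup k)

instance : Module k (CharBimodule α β) := inferInstanceAs (Module k k)

instance : Module A (CharBimodule α β) := Module.compHom k α.toRingHom

instance : Module Aᵐᵒᵖ (CharBimodule α β) :=
  Module.compHom k (β.toRingHom.fromOpposite fun _ _ => Commute.all _ _)

lemma CharBimodule.smul_def (a : A) (x : CharBimodule α β) :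
    a • x = (show CharBimodule α β from (α a * (show k from x) : k)) := rfl

lemma CharBimodule.op_smul_def (a : A) (x : CharBimodule α β) :
    op a • x = (show CharBimodule α β from (β a * (show k from x) : k)) := rfl

instance : IsScalarTower k A (CharBimodule α β) :=
  ⟨fun c a x => by
    change α (c • a) * (show k from x) = c * (α a * (show k from x))
    rw [map_smul, smul_eq_mul, mul_assoc]⟩

instance : IsScalarTower k Aᵐᵒᵖ (CharBimodule α β) :=
  ⟨fun c a x => by
    change β (c • a.unop) * (show k from x) = c * (β a.unop * (show k from x))
    rw [map_smul, smul_eq_mul, mul_assoc]⟩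

instance : SMulCommClass A Aᵐᵒᵖ (CharBimodule α β) :=
  ⟨fun a b x => by
    change α a * (β b.unop * (show k from x)) = β b.unop * (α a * (show k from x))
    rw [mul_left_comm]⟩

end CharBimodule

end Hochschild

section Smooth

universe u w

variable (k : Type w) [CommRing k] (A : Type u) [Ring A] [Algebra k A]

/-- The enveloping algebra `Aᵉ = A ⊗ Aᵒᵖ`; its left modules are the `A`-bimodules. -/
abbrev Env : Type u := A ⊗[k] Aᵐᵒᵖ

/-- The regular bimodule: `A` as an `Aᵉ`-module, with `(a ⊗ b) · x = a x b`. -/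
noncomputable def regularBimodule : ModuleCat.{u} (Env k A) :=
  letI := instModuleTensorProductMop k A
  ModuleCat.of (Env k A) A

/-- `A` has a resolution `0 → P_d → ⋯ → P_1 → P_0 → A → 0` by finitely generated projective
`A`-bimodules. -/
def HasBimoduleResolutionOfLength (d : ℕ) : Prop :=
  ∃ P : ProjectiveResolution (regularBimodule k A),
    (∀ i, Module.Finite (Env k A) (P.complex.X i)) ∧
      ∀ i, d < i → Limits.IsZero (P.complex.X i)

/-- `A` is smooth of dimension `d`: it has a resolution of length `d` by finitely generated
projective `A`-bimodules, and `d` is the smallest possible length of such a resolution. -/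
def IsSmoothOfDim (d : ℕ) : Prop := IsLeast {m : ℕ | HasBimoduleResolutionOfLength k A m} d

end Smooth

namespace BilinearForm

variable {n : ℕ}

/-- The matrix `u = (u_ij)` of generators of the free algebra. -/
def freeU (n : ℕ) : Matrix (Fin n) (Fin n) (FreeAlgebra ℂ (Fin n × Fin n)) :=
  Matrix.of fun i j => FreeAlgebra.ι ℂ (i, j)

/-- A complex matrix, seen as a matrix of scalars of the `ℂ`-algebra `R`. -/
def scalars (R : Type*) [Semiring R] [Algebra ℂ R] (X : Matrix (Fin n) (Fin n) ℂ) :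
    Matrix (Fin n) (Fin n) R := X.map (algebraMap ℂ R)

open Matrix in
/-- The defining relations `E⁻¹ uᵗ E u = I = u E⁻¹ uᵗ E`, entry by entry. -/
inductive Rel (E : GL (Fin n) ℂ) :
    FreeAlgebra ℂ (Fin n × Fin n) → FreeAlgebra ℂ (Fin n × Fin n) → Prop
  | left (i j : Fin n) :
      Rel E ((scalars _ (E⁻¹).val * (freeU n)ᵀ * scalars _ E.val * freeU n :
          Matrix (Fin n) (Fin n) (FreeAlgebra ℂ (Fin n × Fin n))) i j)
        ((1 : Matrix (Fin n) (Fin n) (FreeAlgebra ℂ (Fin n × Fin n))) i j)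
  | right (i j : Fin n) :
      Rel E ((freeU n * scalars _ (E⁻¹).val * (freeU n)ᵀ * scalars _ E.val :
          Matrix (Fin n) (Fin n) (FreeAlgebra ℂ (Fin n × Fin n))) i j)
        ((1 : Matrix (Fin n) (Fin n) (FreeAlgebra ℂ (Fin n × Fin n))) i j)

/-- The algebra `B(E)` of the bilinear form associated with `E`: generators `u_ij`, and relations
`E⁻¹ uᵗ E u = I = u E⁻¹ uᵗ E`. -/
abbrev Alg (E : GL (Fin n) ℂ) : Type := RingQuot (Rel E)

/-- The matrix `u` of generators of `B(E)`. -/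
noncomputable def u (E : GL (Fin n) ℂ) : Matrix (Fin n) (Fin n) (Alg E) :=
  (freeU n).map (RingQuot.mkAlgHom ℂ (Rel E))

open Matrix in
/-- The character of `B(E)` with `u ↦ X`, for a complex matrix `X` that satisfies the defining
relations. -/
noncomputable def character (E : GL (Fin n) ℂ) (X : Matrix (Fin n) (Fin n) ℂ)
    (h₁ : (E⁻¹).val * Xᵀ * E.val * X = 1) (h₂ : X * (E⁻¹).val * Xᵀ * E.val = 1) :
    Alg E →ₐ[ℂ] ℂ :=
  RingQuot.liftAlgHom ℂ ⟨FreeAlgebra.lift ℂ fun p : Fin n × Fin n => X p.1 p.2, by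
    set f : FreeAlgebra ℂ (Fin n × Fin n) →ₐ[ℂ] ℂ := FreeAlgebra.lift ℂ fun p => X p.1 p.2
    have hu : (freeU n).map f = X := by
      ext i j; simp [freeU, f]
    have hut : ((freeU n)ᵀ).map f = Xᵀ := by
      rw [← hu]; rfl
    have hs : ∀ Y : Matrix (Fin n) (Fin n) ℂ, (scalars _ Y).map f = Y := by
      intro Y; ext i j; simp [scalars]
    have h1 : (1 : Matrix (Fin n) (Fin n) (FreeAlgebra ℂ (Fin n × Fin n))).map f = 1 := by
      ext i j; simp [Matrix.one_apply, apply_ite f]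
    rintro _ _ (⟨i, j⟩ | ⟨i, j⟩)
    · rw [← Matrix.map_apply (f := f), ← Matrix.map_apply (f := f)]
      simp only [Matrix.map_mul, hu, hut, hs, h1, h₁]
    · rw [← Matrix.map_apply (f := f), ← Matrix.map_apply (f := f)]
      simp only [Matrix.map_mul, hu, hut, hs, h1, h₂]⟩

lemma character_u (E : GL (Fin n) ℂ) (X : Matrix (Fin n) (Fin n) ℂ) (h₁ h₂) :
    (u E).map (character E X h₁ h₂) = X := by
  ext i j
  simp [u, character, freeU]

lemma val_inv_mul (E : GL (Fin n) ℂ) (Y : Matrix (Fin n) (Fin n) ℂ) :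
    (E⁻¹).val * (E.val * Y) = Y := by
  rw [← Matrix.mul_assoc, E.inv_mul, Matrix.one_mul]

lemma val_mul_inv (E : GL (Fin n) ℂ) (Y : Matrix (Fin n) (Fin n) ℂ) :
    E.val * ((E⁻¹).val * Y) = Y := by
  rw [← Matrix.mul_assoc, E.mul_inv, Matrix.one_mul]

open Matrix in
lemma transpose_val_inv_mul (E : GL (Fin n) ℂ) (Y : Matrix (Fin n) (Fin n) ℂ) :
    (E⁻¹).valᵀ * (E.valᵀ * Y) = Y := by
  rw [← Matrix.mul_assoc, ← transpose_mul, E.mul_inv, transpose_one, Matrix.one_mul]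

open Matrix in
lemma transpose_val_mul_inv (E : GL (Fin n) ℂ) (Y : Matrix (Fin n) (Fin n) ℂ) :
    E.valᵀ * ((E⁻¹).valᵀ * Y) = Y := by
  rw [← Matrix.mul_assoc, ← transpose_mul, E.inv_mul, transpose_one, Matrix.one_mul]

open Matrix in
/-- The sovereign character `Φ` of `B(E)`: `Φ(u) = E⁻¹ Eᵗ`. -/
noncomputable def sovereign (E : GL (Fin n) ℂ) : Alg E →ₐ[ℂ] ℂ :=
  character E ((E⁻¹).val * E.valᵀ)
    (by
      simp only [transpose_mul, transpose_transpose, Matrix.mul_assoc, val_inv_mul, val_mul_inv]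
      rw [← transpose_mul, E.mul_inv, transpose_one])
    (by
      simp only [transpose_mul, transpose_transpose, Matrix.mul_assoc, val_inv_mul,
        transpose_val_mul_inv]
      exact E.inv_mul)

open Matrix in
/-- The inverse `Φ⁻¹` of the sovereign character for the convolution product of characters. Since
`(α * β)(u) = α(u) β(u)` (because `Δ(u_ij) = ∑ₖ u_ik ⊗ u_kj`), it is the character with
`Φ⁻¹(u) = Φ(u)⁻¹ = (E⁻¹)ᵗ E`. -/
noncomputable def sovereignInv (E : GL (Fin n) ℂ) : Alg E →ₐ[ℂ] ℂ :=
  character E ((E⁻¹).valᵀ * E.val)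
    (by
      simp only [transpose_mul, transpose_transpose, Matrix.mul_assoc, val_inv_mul,
        transpose_val_mul_inv]
      exact E.inv_mul)
    (by
      simp only [transpose_mul, transpose_transpose, Matrix.mul_assoc, val_mul_inv,
        transpose_val_inv_mul]
      exact E.inv_mul)

open Matrix in
/-- `Φ(u)` and `Φ⁻¹(u)` are inverse matrices, that is, `Φ * Φ⁻¹ = ε` on generators. -/
lemma sovereign_mul_sovereignInv (E : GL (Fin n) ℂ) :
    (u E).map (sovereign E) * (u E).map (sovereignInv E) = 1 := by
  rw [sovereign, sovereignInv, character_u, character_u, Matrix.mul_assoc, transpose_val_mul_inv]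
  exact E.inv_mul

end BilinearForm

/-! Filter $A=\mathcal B(E)$ by degree in the generators. The leading parts of the relations are
$u^tEu=0$ and $uE^{-1}u^t=0$. They are satisfied by $u_{ij}=x_i\otimes y_j$ in the Segre product of
two quadratic algebras with one nondegenerate relation each, $\sum E_{kl}x_kx_l$ and $\sum
(E^{-1})_{kl}y_ky_l$. For $n\ge2$ such an algebra has a Koszul complex of length two: its kernel in
the middle is right by construction, and insertion of the relation is injective because there is a
nonzero isotropic vector (`isotropic_mul_injective`). Splittings of these complexes, tensored
together, give operators that contract a Koszul type complex of the Segre product $B$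
(`segreFrame`).

The next point is a PBW theorem. The multiplications $X$ on $B$ are deformed to $U=X+\theta$, with
$\theta$ lowering the filtration, so that $U$ satisfies the inhomogeneous relations
(`Frame.exists_related`). The correction is the fixed point of a recursion made from the contracting
operators; its errors vanish by induction along the filtration, since $U^tGUHU^t$ can be reduced in
two ways (`Frame.defect_mul`). The resulting right $A$-module $B$ is free of rank one
(`exists_regular`), so right multiplication by $u$ on $A$ is $X+\theta$ on $B$.

The resolution is $0\to A^e\to M_n(A^e)\to M_n(A^e)\to A^e\to A\to0$. Its term $P_2$ carries the
first family of relations only: $u$ is invertible, and `convert` expresses the second family by the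
first. Identify $A^e$ with $B\otimes A$ and filter by the first factor. Operators on the second
factor preserve this filtration, so only $X$ contributes to leading parts; there the contracting
operators solve the equations, and induction on the filtration gives exactness (`env_exact`).

Hochschild (co)homology is defined by standard complexes, so the bar resolution is shown to be a
projective resolution and compared with this one. Vanishing above degree three follows. If the last
differential vanishes on coefficients $M$, then $H_3(A,M)\cong M$
(`Hochschild.nonempty_homology_equiv`); the sovereign twist has this property (`orbit_env₃`). This
$H_3$ is nonzero, so no shorter resolution exists. -/

namespace BilinearForm

/-! ### Quadratic algebras with one nondegenerate relation -/

/-- A one-step piece `P ⊗ V → Q` of the graded right module of a quadratic algebra. -/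
structure Stage (n : ℕ) where
  P : Type
  Q : Type
  [addP : AddCommGroup P]
  [modP : Module ℂ P]
  [addQ : AddCommGroup Q]
  [modQ : Module ℂ Q]
  X : Fin n → P →ₗ[ℂ] Q

attribute [instance] Stage.addP Stage.modP Stage.addQ Stage.modQ

lemma pi_eq_sum_single {n : ℕ} {V : Type*} [AddCommGroup V] [Module ℂ V] (z : Fin n → V) :
    ∑ k, (Pi.single k (z k) : Fin n → V) = z := by
  ext l; simp [Finset.sum_apply, Pi.single_apply]

/-- The next component is the quotient of $Q\otimes V$ by the relation inserted behind $P$. Hence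
the kernel of multiplication is exactly the image of the relation. -/
lemma Stage.exists_next {n : ℕ} (E : Matrix (Fin n) (Fin n) ℂ) (S : Stage n) :
    ∃ (S' : Stage n) (e : S.Q ≃ₗ[ℂ] S'.P), (∀ y, ∃ z : Fin n → S'.P, ∑ k, S'.X k (z k) = y) ∧
      ∀ z : Fin n → S'.P, ∑ k, S'.X k (z k) = 0 ↔
        ∃ s, ∀ l, z l = e (∑ k, E k l • S.X k s) := by
  let i : S.P →ₗ[ℂ] (Fin n → S.Q) := LinearMap.pi fun l => ∑ k, E k l • S.X k
  have hz : ∀ z : Fin n → S.Q,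
      ∑ k, ((LinearMap.range i).mkQ ∘ₗ LinearMap.single ℂ (fun _ => S.Q) k) (z k) =
        (LinearMap.range i).mkQ z := fun z => by
    conv_rhs => rw [← pi_eq_sum_single z, map_sum]
    rfl
  refine ⟨{ P := S.Q, Q := (Fin n → S.Q) ⧸ LinearMap.range i,
            X := fun k => (LinearMap.range i).mkQ ∘ₗ LinearMap.single ℂ (fun _ => S.Q) k },
    LinearEquiv.refl ℂ S.Q, fun y => ?_, fun z => ?_⟩
  · obtain ⟨z, hz'⟩ := Submodule.mkQ_surjective _ y
    exact ⟨z, (hz z).trans hz'⟩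
  · dsimp only at z ⊢
    rw [hz, Submodule.mkQ_apply, Submodule.Quotient.mk_eq_zero, LinearMap.mem_range]
    refine exists_congr fun s => ?_
    rw [funext_iff]
    refine forall_congr' fun l => ?_
    simp [i, eq_comm]

/-- The pieces of the quadratic algebra with the single relation `∑ E_kl x_k x_l`. -/
noncomputable def stage {n : ℕ} (E : Matrix (Fin n) (Fin n) ℂ) : ℕ → Stage n
  | 0 => { P := ℂ, Q := Fin n → ℂ, X := fun k => LinearMap.single ℂ (fun _ => ℂ) k }
  | m + 1 => (Stage.exists_next E (stage E m)).choose

/-- The homogeneous components of the quadratic algebra. -/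
def component {n : ℕ} (E : Matrix (Fin n) (Fin n) ℂ) (m : ℕ) : Type := (stage E m).P

noncomputable instance {n : ℕ} (E : Matrix (Fin n) (Fin n) ℂ) (m : ℕ) :
    AddCommGroup (component E m) := (stage E m).addP

noncomputable instance {n : ℕ} (E : Matrix (Fin n) (Fin n) ℂ) (m : ℕ) :
    Module ℂ (component E m) := (stage E m).modP

/-- Right multiplication by a generator. -/
noncomputable def componentMul {n : ℕ} (E : Matrix (Fin n) (Fin n) ℂ) (m : ℕ) (k : Fin n) :
    component E m →ₗ[ℂ] component E (m + 1) :=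
  (Stage.exists_next E (stage E m)).choose_spec.choose.toLinearMap ∘ₗ (stage E m).X k

lemma componentMul_zero {n : ℕ} (E : Matrix (Fin n) (Fin n) ℂ) (z : Fin n → component E 0)
    (hz : ∑ k, componentMul E 0 k (z k) = 0) : z = 0 := by
  have h1 : (Stage.exists_next E (stage E 0)).choose_spec.choose
      (∑ k, (stage E 0).X k (z k)) = 0 := by
    rw [map_sum]; exact hz
  have h2 : ∑ k, (stage E 0).X k (z k) = 0 := (LinearEquiv.map_eq_zero_iff _).mp h1
  have h3 : ∀ z : Fin n → ℂ, ∑ k, (Pi.single k (z k) : Fin n → ℂ) = 0 → z = 0 := fun z h => by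
    rwa [pi_eq_sum_single] at h
  exact h3 z h2

/-- Exactness of the Koszul complex in the middle, built into the construction. What remains for
Koszulness is injectivity of the map $s\mapsto(\sum_k E_{kl}X_ks)_l$. -/
lemma componentMul_eq_zero_iff {n : ℕ} (E : Matrix (Fin n) (Fin n) ℂ) (m : ℕ)
    (z : Fin n → component E (m + 1)) :
    ∑ k, componentMul E (m + 1) k (z k) = 0 ↔
      ∃ s, ∀ l, z l = ∑ k, E k l • componentMul E m k s := by
  have h := (Stage.exists_next E (stage E m)).choose_spec.choose_spec.2 z
  have h1 : (Stage.exists_next E (stage E (m + 1))).choose_spec.choose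
      (∑ k, (stage E (m + 1)).X k (z k)) = 0 ↔ ∑ k, (stage E (m + 1)).X k (z k) = 0 :=
    LinearEquiv.map_eq_zero_iff _
  rw [map_sum] at h1
  refine h1.trans (h.trans (exists_congr fun s => forall_congr' fun l => ?_))
  have e : (Stage.exists_next E (stage E m)).choose_spec.choose
      (∑ k, E k l • (stage E m).X k s) = ∑ k, E k l • componentMul E m k s :=
    (map_sum _ _ _).trans (Finset.sum_congr rfl fun k _ => map_smul _ _ _)
  exact ⟨fun h => h.trans e, fun h => h.trans e.symm⟩

lemma componentMul_surjective {n : ℕ} (E : Matrix (Fin n) (Fin n) ℂ) (m : ℕ)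
    (y : component E (m + 1)) : ∃ z : Fin n → component E m, ∑ k, componentMul E m k (z k) = y := by
  have h : ∃ z : Fin n → component E m, ∑ k, (stage E m).X k (z k) =
      (Stage.exists_next E (stage E m)).choose_spec.choose.symm y := by
    match m with
    | 0 => exact ⟨_, pi_eq_sum_single (V := ℂ) _⟩
    | m + 1 => exact (Stage.exists_next E (stage E m)).choose_spec.choose_spec.1 _
  obtain ⟨z, hz⟩ := h
  refine ⟨z, ?_⟩
  have := congrArg (Stage.exists_next E (stage E m)).choose_spec.choose hz
  rw [map_sum] at this
  exact this.trans (LinearEquiv.apply_symm_apply _ _)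

/-- A nonzero isotropic vector of a bilinear form in dimension at least two. -/
lemma exists_isotropic {n : ℕ} (hn : 2 ≤ n) (F : Matrix (Fin n) (Fin n) ℂ) :
    ∃ ξ : Fin n → ℂ, ξ ≠ 0 ∧ ∑ i, ∑ j, ξ i * F i j * ξ j = 0 := by
  let a : Fin n := ⟨0, by omega⟩
  let b : Fin n := ⟨1, by omega⟩
  have hab : a ≠ b := by simp [a, b]
  have key : ∀ s t : ℂ, ∑ i, ∑ j, (Pi.single a s + Pi.single b t : Fin n → ℂ) i * F i j *
      (Pi.single a s + Pi.single b t : Fin n → ℂ) j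
      = F a a * (s * s) + (F a b + F b a) * (s * t) + F b b * (t * t) := by
    intro s t
    simp only [Pi.add_apply, add_mul, mul_add, Finset.sum_add_distrib, Pi.single_apply,
      ite_mul, mul_ite, zero_mul, mul_zero, Finset.sum_ite_eq', Finset.mem_univ, if_true]
    ring
  by_cases h : F a a = 0
  · refine ⟨Pi.single a 1 + Pi.single b 0, fun h0 => ?_, ?_⟩
    · have := congrFun h0 a
      simp at this
    · rw [key, h]; ring
  · obtain ⟨s, hs⟩ := exists_quadratic_eq_zero (a := F a a) (b := F a b + F b a) (c := F b b) h
      (by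
        obtain ⟨s, hs⟩ := IsAlgClosed.exists_pow_nat_eq
          (discrim (F a a) (F a b + F b a) (F b b)) (n := 2) (by norm_num)
        exact ⟨s, by rw [← hs]; ring⟩)
    refine ⟨Pi.single a s + Pi.single b 1, fun h0 => ?_, ?_⟩
    · have := congrFun h0 b
      simp [hab.symm] at this
    · rw [key, ← hs]; ring

section

variable {n : ℕ} {E F : Matrix (Fin n) (Fin n) ℂ}

/-- Right multiplication by a nonzero isotropic vector is injective. -/
lemma isotropic_mul_injective (hEF : E * F = 1) {ξ : Fin n → ℂ} (hξ : ξ ≠ 0)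
    (hiso : ∑ i, ∑ j, ξ i * F i j * ξ j = 0) (m : ℕ) :
    ∀ r : component E m, ∑ k, ξ k • componentMul E m k r = 0 → r = 0 := by
  obtain ⟨l, hl⟩ := Function.ne_iff.mp hξ
  induction m with
  | zero =>
    intro r hr
    have := congrFun (componentMul_zero E (fun k => ξ k • r) (by simpa using hr)) l
    exact (smul_eq_zero.mp this).resolve_left hl
  | succ m ih =>
    intro r hr
    obtain ⟨s, hs⟩ := (componentMul_eq_zero_iff E m (fun k => ξ k • r)).mp (by simpa using hr)
    -- From $\xi_l r=\sum_k E_{kl}X_ks$ one gets $\sum_k\xi_kX_ks=\sum_j(F\xi)_j\xi_j\,r$. This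
    -- vanishes by isotropy, so the induction hypothesis applies to $s$, one degree lower.
    have hs0 : s = 0 := by
      apply ih
      have e1 : ∀ k, ξ k = ∑ j, E k j * ∑ i, F j i * ξ i := fun k => by
        have : (E * F).mulVec ξ k = ξ k := by rw [hEF, Matrix.one_mulVec]
        rw [← this, ← Matrix.mulVec_mulVec]
        rfl
      have e2 : ∀ k, ξ k • componentMul E m k s =
          ∑ j, (∑ i, F j i * ξ i) • (E k j • componentMul E m k s) := fun k => by
        conv_lhs => rw [e1 k]
        rw [Finset.sum_smul]
        refine Finset.sum_congr rfl fun j _ => ?_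
        rw [smul_smul, mul_comm]
      have e3 : ∀ j, ∑ k, (∑ i, F j i * ξ i) • (E k j • componentMul E m k s) =
          (∑ i, ξ j * F j i * ξ i) • r := fun j => by
        rw [← Finset.smul_sum, ← hs, smul_smul, Finset.sum_mul]
        congr 1
        refine Finset.sum_congr rfl fun i _ => ?_
        ring
      rw [Finset.sum_congr rfl fun k _ => e2 k, Finset.sum_comm,
        Finset.sum_congr rfl fun j _ => e3 j, ← Finset.sum_smul, hiso, zero_smul]
    have h5 := hs l
    rw [hs0] at h5
    simp only [map_zero, smul_zero, Finset.sum_const_zero] at h5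
    exact (smul_eq_zero.mp h5).resolve_left hl

/-- Insertion of the quadratic relation, `r ↦ (∑ₖ E_kl X_k r)_l`. -/
noncomputable def componentRel (E : Matrix (Fin n) (Fin n) ℂ) (m : ℕ) :
    component E m →ₗ[ℂ] (Fin n → component E (m + 1)) :=
  LinearMap.pi fun l => ∑ k, E k l • componentMul E m k

lemma componentRel_apply (m : ℕ) (r : component E m) (l : Fin n) :
    componentRel E m r l = ∑ k, E k l • componentMul E m k r := by
  simp [componentRel]

/-- Multiplication, `z ↦ ∑ₖ X_k z_k`. -/
noncomputable def componentProd (E : Matrix (Fin n) (Fin n) ℂ) (m : ℕ) :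
    (Fin n → component E m) →ₗ[ℂ] component E (m + 1) :=
  ∑ k, componentMul E m k ∘ₗ LinearMap.proj k

lemma componentProd_apply (m : ℕ) (z : Fin n → component E m) :
    componentProd E m z = ∑ k, componentMul E m k (z k) := by
  simp [componentProd]

lemma componentProd_single (m : ℕ) (k : Fin n) (r : component E m) :
    componentProd E m (Pi.single k r) = componentMul E m k r := by
  rw [componentProd_apply, Finset.sum_eq_single k]
  · simp
  · intro j _ hj; simp [Pi.single_eq_of_ne hj]
  · simp

/-- Since $E$ is invertible, vanishing of all $\sum_kE_{kl}X_kr$ gives $X_jr=0$ for every $j$. Then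
$r$ is killed by an isotropic vector, and so is zero. Dimension at least two enters only to have
such a vector: for $n=1$ the algebra is $\mathbb C[x]/(x^2)$. -/
lemma componentRel_injective (hn : 2 ≤ n) (hEF : E * F = 1) (m : ℕ) :
    Function.Injective (componentRel E m) := by
  rw [injective_iff_map_eq_zero]
  intro r hr
  obtain ⟨ξ, hξ, hiso⟩ := exists_isotropic hn F
  apply isotropic_mul_injective hEF hξ hiso
  have h1 : ∀ l, ∑ k, E k l • componentMul E m k r = 0 := fun l => by
    rw [← componentRel_apply, hr]; rfl
  refine Finset.sum_eq_zero fun j _ => ?_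
  have : componentMul E m j r = ∑ l, F l j • ∑ k, E k l • componentMul E m k r := by
    simp only [Finset.smul_sum, smul_smul]
    rw [Finset.sum_comm]
    simp only [← Finset.sum_smul]
    have e : ∀ k, ∑ l, F l j * E k l = (1 : Matrix (Fin n) (Fin n) ℂ) k j := fun k => by
      rw [← hEF, Matrix.mul_apply]
      exact Finset.sum_congr rfl fun _ _ => mul_comm _ _
    simp [e, Matrix.one_apply, ite_smul]
  rw [this]
  simp [h1]

lemma ker_componentProd (m : ℕ) :
    LinearMap.ker (componentProd E (m + 1)) = LinearMap.range (componentRel E m) := by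
  ext z
  rw [LinearMap.mem_ker, componentProd_apply, componentMul_eq_zero_iff, LinearMap.mem_range]
  refine exists_congr fun s => ?_
  rw [funext_iff]
  refine forall_congr' fun l => ?_
  rw [componentRel_apply, eq_comm]

end

/-- Splitting of a short exact sequence by a retraction `ρ` and the matching section `σ`. -/
lemma exists_splitting {K P V Q : Type*} [Field K] [AddCommGroup P] [Module K P] [AddCommGroup V]
    [Module K V] [AddCommGroup Q] [Module K Q] (i : P →ₗ[K] V) (p : V →ₗ[K] Q)
    (hi : Function.Injective i) (hp : Function.Surjective p)
    (hip : LinearMap.ker p = LinearMap.range i) :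
    ∃ (ρ : V →ₗ[K] P) (σ : Q →ₗ[K] V), (∀ x, ρ (i x) = x) ∧ (∀ y, p (σ y) = y) ∧
      ∀ z, σ (p z) + i (ρ z) = z := by
  obtain ⟨ρ, hρ⟩ := i.exists_leftInverse_of_injective (LinearMap.ker_eq_bot.mpr hi)
  obtain ⟨σ, hσ⟩ := p.exists_rightInverse_of_surjective (LinearMap.range_eq_top.mpr hp)
  have hρ' : ∀ x, ρ (i x) = x := fun x => LinearMap.congr_fun hρ x
  have hσ' : ∀ x, p (σ x) = x := fun x => LinearMap.congr_fun hσ x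
  have hpi : ∀ x, p (i x) = 0 := fun x => by
    have : i x ∈ LinearMap.ker p := hip ▸ LinearMap.mem_range_self i x
    exact this
  -- An arbitrary section differs from the one complementary to $\rho$ by a map into the image of
  -- $i$; subtracting $i\rho\sigma$ removes this difference.
  refine ⟨ρ, σ - i ∘ₗ ρ ∘ₗ σ, hρ', fun y => by simp [hpi, hσ'], fun z => ?_⟩
  have hz : σ (p z) - z ∈ LinearMap.ker p := by simp [hσ']
  rw [hip] at hz
  obtain ⟨x, hx⟩ := hz
  have : σ (p z) = z + i x := by rw [hx]; abel
  simp [this, hρ']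

/-- The homogeneous components `R m` of the algebra with generators `x_k` and the relation
`∑ E_kl x_k x_l`, with right multiplications `X`, and a contraction `ρ, σ` of its Koszul complex. -/
structure Tower {n : ℕ} (E : Matrix (Fin n) (Fin n) ℂ) where
  R : ℕ → Type
  [add : ∀ m, AddCommGroup (R m)]
  [mod : ∀ m, Module ℂ (R m)]
  unit : R 0 ≃ₗ[ℂ] ℂ
  X : ∀ m, Fin n → R m →ₗ[ℂ] R (m + 1)
  ρ : ∀ m, Fin n → R (m + 1) →ₗ[ℂ] R m
  σ : ∀ m, Fin n → R (m + 1) →ₗ[ℂ] R m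
  rel : ∀ m r, ∑ k, ∑ l, E k l • X (m + 1) l (X m k r) = 0
  ρ_rel : ∀ m r, ∑ k, ∑ l, E k l • ρ m l (X m k r) = r
  X_σ : ∀ m r, ∑ k, X m k (σ m k r) = r
  σ_X_zero : ∀ a b r, σ 0 a (X 0 b r) = if a = b then r else 0
  σ_X : ∀ m a b r, σ (m + 1) a (X (m + 1) b r) + ∑ k, E k a • X m k (ρ m b r) =
    if a = b then r else 0

attribute [instance] Tower.add Tower.mod

/-- The Koszul tower of a nondegenerate form in dimension at least two. -/
theorem exists_tower {n : ℕ} (hn : 2 ≤ n) {E F : Matrix (Fin n) (Fin n) ℂ} (hEF : E * F = 1) :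
    Nonempty (Tower E) := by
  have hp : ∀ m, Function.Surjective (componentProd E m) := fun m y => by
    obtain ⟨z, hz⟩ := componentMul_surjective E m y
    exact ⟨z, (componentProd_apply m z).trans hz⟩
  have hs := fun m => exists_splitting _ _ (componentRel_injective hn hEF m) (hp (m + 1))
    (ker_componentProd m)
  choose ρ σ h1 h2 h3 using hs
  have hp0 : Function.Injective (componentProd E 0) := by
    rw [injective_iff_map_eq_zero]
    intro z hz
    exact componentMul_zero E z ((componentProd_apply 0 z).symm.trans hz)
  -- There is no relation in degree one, so multiplication $R_0\otimes V\to R_1$ is bijective and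
  -- its section is the inverse. This is why `σ_X_zero` has no $\rho$-term.
  let e0 := LinearEquiv.ofBijective _ ⟨hp0, hp 0⟩
  let σ' : ∀ m, component E (m + 1) →ₗ[ℂ] (Fin n → component E m) := fun m =>
    match m with
    | 0 => e0.symm.toLinearMap
    | m + 1 => σ m
  have hσ' : ∀ m y, componentProd E m (σ' m y) = y := fun m y => by
    match m with
    | 0 => exact e0.apply_symm_apply y
    | m + 1 => exact h2 m y
  refine ⟨{ R := component E
            unit := LinearEquiv.refl ℂ ℂ
            X := componentMul E
            ρ := fun m l => ρ m ∘ₗ LinearMap.single ℂ (fun _ => component E (m + 1)) l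
            σ := fun m k => LinearMap.proj k ∘ₗ σ' m
            rel := fun m r => ?_, ρ_rel := fun m r => ?_, X_σ := fun m r => ?_
            σ_X_zero := fun a b r => ?_, σ_X := fun m a b r => ?_ }⟩
  · have : componentProd E (m + 1) (componentRel E m r) = 0 := by
      rw [← LinearMap.mem_ker, ker_componentProd]
      exact LinearMap.mem_range_self _ r
    rw [componentProd_apply] at this
    simp only [componentRel_apply, map_sum, map_smul] at this
    rwa [Finset.sum_comm]
  · conv_rhs => rw [← h1 m r, ← pi_eq_sum_single (componentRel E m r), map_sum]
    rw [Finset.sum_comm]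
    refine Finset.sum_congr rfl fun l _ => ?_
    rw [componentRel_apply]
    simp only [LinearMap.comp_apply, LinearMap.single_apply, ← map_smul, ← map_sum]
    congr 1
    ext j
    by_cases h : j = l
    · subst h; simp [Finset.sum_apply]
    · simp [Finset.sum_apply, Pi.single_eq_of_ne h]
  · exact (componentProd_apply m _).symm.trans (hσ' m r)
  · rw [← componentProd_single]
    change e0.symm (e0 (Pi.single b r)) a = _
    rw [e0.symm_apply_apply, Pi.single_apply]
  · have := congrFun (h3 m (Pi.single b r)) a
    rw [Pi.add_apply, componentRel_apply, Pi.single_apply, componentProd_single] at this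
    exact this

end BilinearForm

/-! ### The Segre product and its contracting operators -/

namespace BilinearForm

/-- A complex matrix, seen as a matrix of operators on `B`. -/
noncomputable abbrev opScalars {n : ℕ} (B : Type*) [AddCommGroup B] [Module ℂ B]
    (G : Matrix (Fin n) (Fin n) ℂ) : Matrix (Fin n) (Fin n) (Module.End ℂ B) := scalars _ G

open Matrix in
/-- A filtered space with right multiplication operators `X` and lowering operators `S₀, S₁, S₂, T`
that contract the Koszul-type complex of the Segre product of two quadratic algebras with one
relation each. -/
structure Frame {n : ℕ} (G H : Matrix (Fin n) (Fin n) ℂ) (B : Type*) [AddCommGroup B]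
    [Module ℂ B] where
  fil : ℕ → Submodule ℂ B
  fil_zero : fil 0 = ⊥
  fil_mono : Monotone fil
  fil_exhaust : ∀ b, ∃ m, b ∈ fil m
  X : Matrix (Fin n) (Fin n) (Module.End ℂ B)
  S₀ : Matrix (Fin n) (Fin n) (Module.End ℂ B)
  S₁ : Matrix (Fin n) (Fin n) (Module.End ℂ B)
  S₂ : Matrix (Fin n) (Fin n) (Module.End ℂ B)
  T : Matrix (Fin n) (Fin n) (Module.End ℂ B)
  ε : Module.End ℂ B
  X_mem : ∀ i j m b, b ∈ fil m → X i j b ∈ fil (m + 1)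
  S₀_mem : ∀ i j m b, b ∈ fil (m + 1) → S₀ i j b ∈ fil m
  S₁_mem : ∀ i j m b, b ∈ fil (m + 1) → S₁ i j b ∈ fil m
  S₂_mem : ∀ i j m b, b ∈ fil (m + 1) → S₂ i j b ∈ fil m
  T_mem : ∀ i j m b, b ∈ fil (m + 1) → T i j b ∈ fil m
  ε_mem : ∀ b, ε b ∈ fil 1
  ε_X : ∀ i j, ε * X i j = 0
  rel_left : Xᵀ * opScalars B G * X = 0
  rel_right : X * opScalars B H * Xᵀ = 0
  X_S₀ : ∑ i, ∑ j, X i j * S₀ i j = 1 - ε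
  S₀_X : ∀ a b c e, S₀ a b * X c e + (if b = e then (opScalars B G * X * S₁ᵀ) a c else 0)
    + (if a = c then (opScalars B H * Xᵀ * S₂) b e else 0)
    - (opScalars B G * X * opScalars B Hᵀ) a b * T c e = if a = c ∧ b = e then 1 else 0
  S₁_rel : S₁ᵀ * opScalars B G * X + opScalars B H * Xᵀ * S₂ = 1
  S₂_rel : S₂ * opScalars B H * Xᵀ + opScalars B G * X * S₁ᵀ = 1
  S₁_X : ∀ a e d l, S₁ a e * X d l = (S₁ᵀ * opScalars B G * X) e l * (T * opScalars B H * Xᵀ) a d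
  S₂_X : ∀ e b k d, S₂ e b * X k d = (S₂ * opScalars B H * Xᵀ) e k * (Tᵀ * opScalars B G * X) b d
  T_rel : ∑ a, ∑ b, T a b * (opScalars B G * X * opScalars B Hᵀ) a b = 1

section Entries

variable {n : ℕ} {B : Type*} [AddCommGroup B] [Module ℂ B]
  (M P : Matrix (Fin n) (Fin n) (Module.End ℂ B)) (G : Matrix (Fin n) (Fin n) ℂ)

lemma mul_apply_apply (i j : Fin n) (b : B) : (M * P) i j b = ∑ k, M i k (P k j b) := by
  simp [Matrix.mul_apply, LinearMap.sum_apply]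

lemma one_apply_apply (i j : Fin n) (b : B) :
    (1 : Matrix (Fin n) (Fin n) (Module.End ℂ B)) i j b = if i = j then b else 0 := by
  rw [Matrix.one_apply]; split_ifs <;> rfl

lemma opScalars_apply_apply (i j : Fin n) (b : B) : opScalars B G i j b = G i j • b := by
  simp [scalars]

end Entries

section Segre

variable {n : ℕ} {G H : Matrix (Fin n) (Fin n) ℂ} (D : Tower (Matrix.transpose G))
  (D' : Tower (Matrix.transpose H))

/-- The Segre product of two towers. -/
abbrev Segre : Type := DirectSum ℕ fun m => D.R m ⊗[ℂ] D'.R m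

namespace Segre

/-- Pure tensors of a given degree. -/
noncomputable def tm (m : ℕ) : D.R m →ₗ[ℂ] D'.R m →ₗ[ℂ] Segre D D' :=
  (TensorProduct.mk ℂ (D.R m) (D'.R m)).compr₂ (DirectSum.lof ℂ ℕ (fun m => D.R m ⊗[ℂ] D'.R m) m)

variable {D D'} in
lemma hom_ext {V : Type*} [AddCommGroup V] [Module ℂ V] {f g : Segre D D' →ₗ[ℂ] V}
    (h : ∀ m r r', f (tm D D' m r r') = g (tm D D' m r r')) : f = g :=
  DirectSum.linearMap_ext ℂ fun m => TensorProduct.ext' fun r r' => h m r r'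

/-- The operator of degree one with components `u m ⊗ u' m`. -/
noncomputable def up (u : ∀ m, D.R m →ₗ[ℂ] D.R (m + 1)) (u' : ∀ m, D'.R m →ₗ[ℂ] D'.R (m + 1)) :
    Module.End ℂ (Segre D D') :=
  DirectSum.toModule ℂ ℕ _ fun m =>
    DirectSum.lof ℂ ℕ (fun m => D.R m ⊗[ℂ] D'.R m) (m + 1) ∘ₗ TensorProduct.map (u m) (u' m)

/-- The components of an operator of degree minus one. -/
noncomputable def downComponent (d : ∀ m, D.R (m + 1) →ₗ[ℂ] D.R m)
    (d' : ∀ m, D'.R (m + 1) →ₗ[ℂ] D'.R m) : ∀ m, D.R m ⊗[ℂ] D'.R m →ₗ[ℂ] Segre D D'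
  | 0 => 0
  | m + 1 => DirectSum.lof ℂ ℕ (fun m => D.R m ⊗[ℂ] D'.R m) m ∘ₗ TensorProduct.map (d m) (d' m)

/-- The operator of degree minus one with components `d m ⊗ d' m`. -/
noncomputable def down (d : ∀ m, D.R (m + 1) →ₗ[ℂ] D.R m) (d' : ∀ m, D'.R (m + 1) →ₗ[ℂ] D'.R m) :
    Module.End ℂ (Segre D D') :=
  DirectSum.toModule ℂ ℕ _ (downComponent D D' d d')

/-- The components of the projection to degree zero. -/
noncomputable def baseComponent : ∀ m, D.R m ⊗[ℂ] D'.R m →ₗ[ℂ] Segre D D'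
  | 0 => DirectSum.lof ℂ ℕ (fun m => D.R m ⊗[ℂ] D'.R m) 0
  | _ + 1 => 0

/-- The projection to degree zero. -/
noncomputable def base : Module.End ℂ (Segre D D') :=
  DirectSum.toModule ℂ ℕ _ (baseComponent D D')

variable {D D'}

@[simp] lemma up_tm (u u') (m : ℕ) (r : D.R m) (r' : D'.R m) :
    up D D' u u' (tm D D' m r r') = tm D D' (m + 1) (u m r) (u' m r') := by
  simp [up, tm]

@[simp] lemma down_tm_zero (d d') (r : D.R 0) (r' : D'.R 0) :
    down D D' d d' (tm D D' 0 r r') = 0 := by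
  simp [down, tm, downComponent]

@[simp] lemma down_tm_succ (d d') (m : ℕ) (r : D.R (m + 1)) (r' : D'.R (m + 1)) :
    down D D' d d' (tm D D' (m + 1) r r') = tm D D' m (d m r) (d' m r') := by
  simp [down, tm, downComponent]

@[simp] lemma base_tm_zero (r : D.R 0) (r' : D'.R 0) :
    base D D' (tm D D' 0 r r') = tm D D' 0 r r' := by
  simp [base, tm, baseComponent]

@[simp] lemma base_tm_succ (m : ℕ) (r : D.R (m + 1)) (r' : D'.R (m + 1)) :
    base D D' (tm D D' (m + 1) r r') = 0 := by
  simp [base, tm, baseComponent]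

variable (D D') in
/-- The elements of degree less than `m`. -/
noncomputable def fil (m : ℕ) : Submodule ℂ (Segre D D') :=
  Submodule.span ℂ {b | ∃ l < m, ∃ r r', b = tm D D' l r r'}

lemma tm_mem_fil {l m : ℕ} (h : l < m) (r : D.R l) (r' : D'.R l) : tm D D' l r r' ∈ fil D D' m :=
  Submodule.subset_span ⟨l, h, r, r', rfl⟩

lemma map_mem_fil {V : Type*} [AddCommGroup V] [Module ℂ V] (f : Segre D D' →ₗ[ℂ] V)
    (W : Submodule ℂ V) {m : ℕ} (h : ∀ l < m, ∀ r r', f (tm D D' l r r') ∈ W) {b}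
    (hb : b ∈ fil D D' m) : f b ∈ W := by
  have : fil D D' m ≤ W.comap f := by
    rw [fil, Submodule.span_le]
    rintro _ ⟨l, hl, r, r', rfl⟩
    exact h l hl r r'
  exact this hb

lemma down_mem (d d') (m : ℕ) (b : Segre D D') (hb : b ∈ fil D D' (m + 1)) :
    down D D' d d' b ∈ fil D D' m := by
  refine map_mem_fil _ _ (fun l hl r r' => ?_) hb
  cases l with
  | zero => simp
  | succ l => rw [down_tm_succ]; exact tm_mem_fil (by omega) _ _

lemma fil_exhaust (b : Segre D D') : ∃ m, b ∈ fil D D' m := by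
  induction b using DirectSum.induction_on with
  | zero => exact ⟨0, zero_mem _⟩
  | of l x =>
    refine ⟨l + 1, ?_⟩
    induction x using TensorProduct.induction_on with
    | zero => rw [map_zero]; exact zero_mem _
    | tmul r r' => exact tm_mem_fil (Nat.lt_succ_self l) r r'
    | add x y hx hy => rw [map_add]; exact add_mem hx hy
  | add x y hx hy =>
    obtain ⟨k, hk⟩ := hx
    obtain ⟨l, hl⟩ := hy
    have mono : Monotone (fil D D') := fun i j h =>
      Submodule.span_mono fun b ⟨l, hl, r⟩ => ⟨l, lt_of_lt_of_le hl h, r⟩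
    exact ⟨max k l, add_mem (mono (le_max_left _ _) hk) (mono (le_max_right _ _) hl)⟩

end Segre

end Segre

section SegreFrame

variable {n : ℕ} {G H : Matrix (Fin n) (Fin n) ℂ} (D : Tower (Matrix.transpose G))
  (D' : Tower (Matrix.transpose H))

open Matrix Segre

/-- This lemma and the next ones compose the tower identities with an arbitrary linear map $f$.
Taking for $f$ a pure tensor with one slot free, they become rewriting rules inside either factor of
the Segre product. -/
lemma Tower.σ_X_zero_left {G : Matrix (Fin n) (Fin n) ℂ} {V : Type*} [AddCommGroup V] [Module ℂ V]
    (D : Tower Gᵀ) (f : D.R 0 →ₗ[ℂ] V) (a b r) :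
    f (D.σ 0 a (D.X 0 b r)) = if a = b then f r else 0 := by
  rw [D.σ_X_zero]; split_ifs <;> simp

lemma Tower.σ_X_left {G : Matrix (Fin n) (Fin n) ℂ} {V : Type*} [AddCommGroup V] [Module ℂ V]
    (D : Tower Gᵀ) {m : ℕ} (f : D.R (m + 1) →ₗ[ℂ] V) (a b r) :
    f (D.σ (m + 1) a (D.X (m + 1) b r)) =
      (if a = b then f r else 0) - ∑ k, G a k • f (D.X m k (D.ρ m b r)) := by
  have := congrArg f (D.σ_X m a b r)
  rw [map_add, map_sum] at this
  rw [eq_sub_iff_add_eq]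
  refine Eq.trans ?_ (this.trans (by split_ifs <;> simp))
  simp [Matrix.transpose_apply]

lemma Tower.rel_left {G : Matrix (Fin n) (Fin n) ℂ} {V : Type*} [AddCommGroup V] [Module ℂ V]
    (D : Tower Gᵀ) {m : ℕ} (f : D.R (m + 2) →ₗ[ℂ] V) (r) :
    ∑ l, ∑ k, G l k • f (D.X (m + 1) l (D.X m k r)) = 0 := by
  rw [Finset.sum_comm]
  have := congrArg f (D.rel m r)
  simpa [map_sum] using this

lemma Tower.ρ_rel_left {G : Matrix (Fin n) (Fin n) ℂ} {V : Type*} [AddCommGroup V] [Module ℂ V]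
    (D : Tower Gᵀ) {m : ℕ} (f : D.R m →ₗ[ℂ] V) (r) :
    ∑ l, ∑ k, G l k • f (D.ρ m l (D.X m k r)) = f r := by
  rw [Finset.sum_comm]
  have := congrArg f (D.ρ_rel m r)
  simpa [map_sum] using this

lemma Tower.X_σ_left {G : Matrix (Fin n) (Fin n) ℂ} {V : Type*} [AddCommGroup V] [Module ℂ V]
    (D : Tower Gᵀ) {m : ℕ} (f : D.R (m + 1) →ₗ[ℂ] V) (r) :
    ∑ k, f (D.X m k (D.σ m k r)) = f r := by
  rw [← map_sum, D.X_σ]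

/-- The frame of a Segre product. -/
noncomputable def segreFrame : Frame G H (Segre D D') where
  fil := fil D D'
  fil_zero := by simp [fil]
  fil_mono := fun i j h => Submodule.span_mono fun b ⟨l, hl, r⟩ => ⟨l, lt_of_lt_of_le hl h, r⟩
  fil_exhaust := fil_exhaust
  X := Matrix.of fun i j => up D D' (fun m => D.X m i) (fun m => D'.X m j)
  S₀ := Matrix.of fun i j => down D D' (fun m => D.σ m i) (fun m => D'.σ m j)
  S₁ := Matrix.of fun i j => down D D' (fun m => D.ρ m i) (fun m => D'.σ m j)
  S₂ := Matrix.of fun i j => down D D' (fun m => D.σ m i) (fun m => D'.ρ m j)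
  T := Matrix.of fun i j => down D D' (fun m => D.ρ m i) (fun m => D'.ρ m j)
  ε := base D D'
  X_mem := fun i j m b hb => map_mem_fil _ _ (fun l hl r r' => by
    rw [Matrix.of_apply, up_tm]; exact tm_mem_fil (by omega) _ _) hb
  S₀_mem := fun i j m b hb => down_mem _ _ m b hb
  S₁_mem := fun i j m b hb => down_mem _ _ m b hb
  S₂_mem := fun i j m b hb => down_mem _ _ m b hb
  T_mem := fun i j m b hb => down_mem _ _ m b hb
  ε_mem := fun b => by
    obtain ⟨m, hm⟩ := fil_exhaust b
    refine map_mem_fil _ _ (fun l hl r r' => ?_) hm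
    cases l with
    | zero => rw [base_tm_zero]; exact tm_mem_fil (by omega) _ _
    | succ l => simp
  ε_X := fun i j => hom_ext fun m r r' => by simp
  rel_left := by
    ext i j : 1
    refine hom_ext fun m r r' => ?_
    have := D.rel_left ((tm D D' (m + 2)).flip (D'.X (m + 1) i (D'.X m j r'))) r
    simpa [Matrix.mul_assoc, mul_apply_apply, opScalars_apply_apply, -map_mul] using this
  rel_right := by
    ext i j : 1
    refine hom_ext fun m r r' => ?_
    have := D'.rel_left (tm D D' (m + 2) (D.X (m + 1) i (D.X m j r))) r'
    simpa [Matrix.mul_assoc, mul_apply_apply, opScalars_apply_apply] using this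
  X_S₀ := by
    refine hom_ext fun m r r' => ?_
    cases m with
    | zero => simp [LinearMap.sum_apply]
    | succ m =>
      simp only [LinearMap.sum_apply, Module.End.mul_apply, Matrix.of_apply, down_tm_succ, up_tm,
        LinearMap.sub_apply, Module.End.one_apply, base_tm_succ, sub_zero]
      simp only [D'.X_σ_left]
      exact D.X_σ_left ((tm D D' (m + 1)).flip r') r
  -- In each factor $\sigma X=1-i\rho$, so $S_0X$ is $(1-i\rho)\otimes(1-i'\rho')$ expanded. The
  -- mixed terms become words in the operators of the Segre product after inserting $\sum
  -- X_k\sigma_k=1$ in the idle factor. In degree zero the lowering operators vanish and only the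
  -- first term survives.
  S₀_X := fun a b c e => by
    refine hom_ext fun m r r' => ?_
    cases m with
    | zero =>
      have h1 := D.σ_X_zero_left ((tm D D' 0).flip (D'.σ 0 b (D'.X 0 e r'))) a c r
      have h2 := D'.σ_X_zero_left (tm D D' 0 r) b e r'
      simp only [LinearMap.flip_apply] at h1
      simp only [Matrix.mul_assoc, LinearMap.sub_apply, LinearMap.add_apply, Module.End.mul_apply,
        Matrix.of_apply, up_tm, down_tm_succ, h1, h2]
      split_ifs <;> simp_all [mul_apply_apply, opScalars_apply_apply]
    | succ m =>
      have h1 := D.σ_X_left ((tm D D' (m + 1)).flip (D'.σ (m + 1) b (D'.X (m + 1) e r'))) a c r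
      have h2 := fun s => D'.σ_X_left (tm D D' (m + 1) s) b e r'
      have h3 := fun s => D.X_σ_left ((tm D D' (m + 1)).flip s) r
      have h4 := fun s => D'.X_σ_left (tm D D' (m + 1) s) r'
      simp only [LinearMap.flip_apply] at h1 h3
      simp only [Matrix.mul_assoc, LinearMap.sub_apply, LinearMap.add_apply, Module.End.mul_apply,
        Matrix.of_apply, up_tm, down_tm_succ, h1, h2]
      split_ifs <;> simp_all [mul_apply_apply, opScalars_apply_apply]
      all_goals
        simp only [Finset.smul_sum, smul_sub, Finset.sum_sub_distrib, smul_comm (H _ _) (G _ _)]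
        abel
  S₁_rel := by
    ext i j : 1
    refine hom_ext fun m r r' => ?_
    have h1 := D.ρ_rel_left ((tm D D' m).flip (D'.σ m i (D'.X m j r'))) r
    simp only [LinearMap.flip_apply] at h1
    simp only [Matrix.mul_assoc, LinearMap.add_apply, Matrix.add_apply, mul_apply_apply,
      opScalars_apply_apply, Matrix.transpose_apply, Matrix.of_apply, up_tm, map_sum, map_smul,
      down_tm_succ, one_apply_apply, h1]
    cases m with
    | zero =>
      rw [D'.σ_X_zero_left (tm D D' 0 r)]
      simp
    | succ m =>
      rw [D'.σ_X_left (tm D D' (m + 1) r)]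
      simp only [down_tm_succ, up_tm]
      have h2 := fun s => D.X_σ_left ((tm D D' (m + 1)).flip s) r
      simp only [LinearMap.flip_apply] at h2
      simp only [← Finset.smul_sum, h2, sub_add_cancel]
  S₂_rel := by
    ext i j : 1
    refine hom_ext fun m r r' => ?_
    have h1 := D'.ρ_rel_left (tm D D' m (D.σ m i (D.X m j r))) r'
    simp only [Matrix.mul_assoc, LinearMap.add_apply, Matrix.add_apply, mul_apply_apply,
      opScalars_apply_apply, Matrix.transpose_apply, Matrix.of_apply, up_tm, map_sum, map_smul,
      down_tm_succ, one_apply_apply, h1]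
    cases m with
    | zero =>
      have h2 := D.σ_X_zero_left ((tm D D' 0).flip r') i j r
      simp only [LinearMap.flip_apply] at h2
      rw [h2]
      simp
    | succ m =>
      have h2 := D.σ_X_left ((tm D D' (m + 1)).flip r') i j r
      simp only [LinearMap.flip_apply] at h2
      rw [h2]
      simp only [down_tm_succ, up_tm, ← Finset.smul_sum, D'.X_σ_left, sub_add_cancel]
  -- Both sides are $\rho_aX_d\otimes\sigma'_eX'_l$. The right side separates the two factors, and
  -- `ρ_rel` makes the idle factor of each term the identity.
  S₁_X := fun a e d l => by
    refine hom_ext fun m r r' => ?_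
    have h1 := fun s => D'.ρ_rel_left (tm D D' m (D.ρ m a (D.X m d r)) ∘ₗ s) r'
    have h2 := fun s s' => D.ρ_rel_left ((tm D D' m).flip s') s
    simp only [LinearMap.flip_apply, LinearMap.comp_apply] at h1 h2
    simp only [Module.End.mul_apply, Matrix.mul_assoc, mul_apply_apply,
      opScalars_apply_apply, Matrix.transpose_apply, Matrix.of_apply, up_tm, map_sum, map_smul,
      down_tm_succ, h2]
    exact (h1 (D'.σ m e ∘ₗ D'.X m l)).symm
  S₂_X := fun e b k d => by
    refine hom_ext fun m r r' => ?_
    have h1 := fun s => D.ρ_rel_left ((tm D D' m).flip (D'.ρ m b (D'.X m d r')) ∘ₗ s) r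
    have h2 := fun s s' => D'.ρ_rel_left (tm D D' m s) s'
    simp only [LinearMap.flip_apply, LinearMap.comp_apply] at h1
    simp only [Module.End.mul_apply, Matrix.mul_assoc, mul_apply_apply,
      opScalars_apply_apply, Matrix.transpose_apply, Matrix.of_apply, up_tm, map_sum, map_smul,
      down_tm_succ, h2]
    exact (h1 (D.σ m e ∘ₗ D.X m k)).symm
  T_rel := by
    refine hom_ext fun m r r' => ?_
    have h1 := D.ρ_rel_left ((tm D D' m).flip r') r
    have h2 := fun s => D'.ρ_rel_left (tm D D' m s) r'
    simp only [LinearMap.flip_apply] at h1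
    simp only [LinearMap.sum_apply, Module.End.mul_apply, Matrix.mul_assoc, mul_apply_apply,
      opScalars_apply_apply, Matrix.transpose_apply, Matrix.of_apply, up_tm, map_sum, map_smul,
      down_tm_succ, Module.End.one_apply, smul_comm (H _ _) (G _ _)]
    rw [← h1]
    refine Finset.sum_congr rfl fun a _ => ?_
    rw [Finset.sum_comm]
    refine Finset.sum_congr rfl fun b _ => ?_
    simp only [← Finset.smul_sum, h2]

end SegreFrame

end BilinearForm

/-! ### Deformation of the Segre product to the inhomogeneous relations -/

namespace BilinearForm

open Matrix

section Scalars

variable {n : ℕ} {B : Type*} [AddCommGroup B] [Module ℂ B]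

lemma opScalars_mul (G H : Matrix (Fin n) (Fin n) ℂ) :
    opScalars B G * opScalars B H = opScalars B (G * H) := by
  simp [opScalars, scalars, Matrix.map_mul]

lemma opScalars_one : opScalars B (1 : Matrix (Fin n) (Fin n) ℂ) = 1 := by
  simp [opScalars, scalars]

lemma opScalars_transpose (G : Matrix (Fin n) (Fin n) ℂ) :
    (opScalars B G)ᵀ = opScalars B Gᵀ := rfl

lemma opScalars_mul_apply (G : Matrix (Fin n) (Fin n) ℂ)
    (X : Matrix (Fin n) (Fin n) (Module.End ℂ B)) (a b : Fin n) :
    (opScalars B G * X) a b = ∑ k, G a k • X k b := by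
  rw [Matrix.mul_apply]
  refine Finset.sum_congr rfl fun k _ => ?_
  ext x
  simp [scalars]

lemma opScalars_mul_mul_apply (G H : Matrix (Fin n) (Fin n) ℂ)
    (X : Matrix (Fin n) (Fin n) (Module.End ℂ B)) (a b : Fin n) :
    (opScalars B G * X * opScalars B H) a b = ∑ k, ∑ l, (G a k * H l b) • X k l := by
  simp only [Matrix.mul_apply, Finset.sum_mul]
  rw [Finset.sum_comm]
  refine Finset.sum_congr rfl fun k _ => Finset.sum_congr rfl fun l _ => ?_
  ext x
  simp [scalars, smul_smul, mul_comm]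

lemma opScalars_mul_mul_transpose (G H : Matrix (Fin n) (Fin n) ℂ)
    (X : Matrix (Fin n) (Fin n) (Module.End ℂ B)) :
    (opScalars B G * X * opScalars B H)ᵀ = opScalars B Hᵀ * Xᵀ * opScalars B Gᵀ := by
  ext a b : 1
  rw [Matrix.transpose_apply, opScalars_mul_mul_apply, opScalars_mul_mul_apply, Finset.sum_comm]
  refine Finset.sum_congr rfl fun k _ => Finset.sum_congr rfl fun l _ => ?_
  rw [mul_comm]; rfl

end Scalars

lemma sum_comm_pairs {n : ℕ} {M : Type*} [AddCommMonoid M] (f : Fin n → Fin n → Fin n → Fin n → M) :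
    ∑ i, ∑ j, ∑ k, ∑ l, f i j k l = ∑ k, ∑ l, ∑ i, ∑ j, f i j k l := by
  have : ∀ g : Fin n → Fin n → M, ∑ i, ∑ j, g i j = ∑ p : Fin n × Fin n, g p.1 p.2 := fun g =>
    (Fintype.sum_prod_type' g).symm
  simp only [this]
  exact Finset.sum_comm

namespace Frame

variable {n : ℕ} {G H : Matrix (Fin n) (Fin n) ℂ} {B : Type*} [AddCommGroup B] [Module ℂ B]

/-- Exchanging the two factors of the Segre product. -/
def swap (Fr : Frame G H B) : Frame H G B where
  fil := Fr.fil
  fil_zero := Fr.fil_zero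
  fil_mono := Fr.fil_mono
  fil_exhaust := Fr.fil_exhaust
  X := Fr.Xᵀ
  S₀ := Fr.S₀ᵀ
  S₁ := Fr.S₂ᵀ
  S₂ := Fr.S₁ᵀ
  T := Fr.Tᵀ
  ε := Fr.ε
  X_mem := fun i j => Fr.X_mem j i
  S₀_mem := fun i j => Fr.S₀_mem j i
  S₁_mem := fun i j => Fr.S₂_mem j i
  S₂_mem := fun i j => Fr.S₁_mem j i
  T_mem := fun i j => Fr.T_mem j i
  ε_mem := Fr.ε_mem
  ε_X := fun i j => Fr.ε_X j i
  rel_left := Fr.rel_right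
  rel_right := Fr.rel_left
  X_S₀ := by rw [← Fr.X_S₀, Finset.sum_comm]; rfl
  S₀_X := fun a b c e => by
    have h := Fr.S₀_X b a e c
    rw [← Matrix.transpose_apply (opScalars B G * Fr.X * opScalars B Hᵀ),
      opScalars_mul_mul_transpose] at h
    rw [add_right_comm] at h
    exact h.trans (if_congr and_comm rfl rfl)
  S₁_rel := Fr.S₂_rel
  S₂_rel := Fr.S₁_rel
  S₁_X := fun a e d l => Fr.S₂_X e a l d
  S₂_X := fun a e d l => Fr.S₁_X e a l d
  T_rel := by
    rw [← Fr.T_rel, Finset.sum_comm]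
    refine Finset.sum_congr rfl fun a _ => Finset.sum_congr rfl fun b _ => ?_
    rw [← Matrix.transpose_apply (opScalars B H * Fr.Xᵀ * opScalars B Gᵀ),
      opScalars_mul_mul_transpose]
    rfl

lemma swap_swap (Fr : Frame G H B) : Fr.swap.swap = Fr := rfl

/-- A matrix of operators that lower the filtration. -/
def Lowers (Fr : Frame G H B) (θ : Matrix (Fin n) (Fin n) (Module.End ℂ B)) : Prop :=
  ∀ i j m b, b ∈ Fr.fil (m + 1) → θ i j b ∈ Fr.fil m

/-- The defect of the first relation that a correction `θ` of `X` has to compensate. -/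
noncomputable def defect (Fr : Frame G H B) (θ : Matrix (Fin n) (Fin n) (Module.End ℂ B)) :
    Matrix (Fin n) (Fin n) (Module.End ℂ B) :=
  opScalars B G - (Fr.X + θ)ᵀ * opScalars B G * θ

/-- The contraction of the defect. -/
noncomputable def trace (Fr : Frame G H B) (θ : Matrix (Fin n) (Fin n) (Module.End ℂ B)) :
    Module.End ℂ B :=
  ∑ i, ∑ j, H i j • Fr.defect θ i j

/-- The recursion for the correction. -/
noncomputable def step (Fr : Frame G H B) (θ : Matrix (Fin n) (Fin n) (Module.End ℂ B)) :
    Matrix (Fin n) (Fin n) (Module.End ℂ B) :=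
  Matrix.of fun a b => (Fr.defect θ * Fr.S₁ᵀ) b a + (Fr.swap.defect θᵀ * Fr.S₂) a b
    - Fr.trace θ * Fr.T a b

variable (Fr : Frame G H B)

lemma mem_of_lowers {θ} (hθ : Fr.Lowers θ) {i j m b} (hb : b ∈ Fr.fil m) : θ i j b ∈ Fr.fil m :=
  hθ i j m b (Fr.fil_mono (Nat.le_succ m) hb)

lemma defect_apply (θ) (i j : Fin n) (b : B) :
    Fr.defect θ i j b = G i j • b - ∑ k, ∑ l, G k l • (Fr.X k i + θ k i) (θ l j b) := by
  rw [defect, Matrix.mul_assoc, Matrix.sub_apply, LinearMap.sub_apply, opScalars_apply_apply,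
    mul_apply_apply]
  simp only [mul_apply_apply, opScalars_apply_apply, map_sum, map_smul]
  rfl

lemma add_mem_fil {θ} (hθ : Fr.Lowers θ) {k i m b} (hb : b ∈ Fr.fil m) :
    (Fr.X k i + θ k i) b ∈ Fr.fil (m + 1) :=
  add_mem (Fr.X_mem _ _ _ _ hb) (Fr.fil_mono (Nat.le_succ m) (Fr.mem_of_lowers hθ hb))

lemma defect_mem {θ} (hθ : Fr.Lowers θ) {i j m b} (hb : b ∈ Fr.fil m) :
    Fr.defect θ i j b ∈ Fr.fil m := by
  rw [defect_apply]
  refine sub_mem (Submodule.smul_mem _ _ hb) (sum_mem fun k _ => sum_mem fun l _ =>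
    Submodule.smul_mem _ _ ?_)
  cases m with
  | zero =>
    rw [Fr.fil_zero, Submodule.mem_bot] at hb ⊢
    simp [hb]
  | succ m => exact Fr.add_mem_fil hθ (hθ _ _ _ _ hb)

lemma lowers_swap {θ} (hθ : Fr.Lowers θ) : Fr.swap.Lowers θᵀ := fun i j => hθ j i

lemma step_apply (θ) (i j : Fin n) (b : B) :
    Fr.step θ i j b = ∑ k, Fr.defect θ j k (Fr.S₁ i k b)
      + ∑ k, Fr.swap.defect θᵀ i k (Fr.S₂ k j b)
      - ∑ k, ∑ l, H k l • Fr.defect θ k l (Fr.T i j b) := by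
  simp only [step, Matrix.of_apply, LinearMap.sub_apply, LinearMap.add_apply, mul_apply_apply,
    Module.End.mul_apply, trace, LinearMap.sum_apply, LinearMap.smul_apply, Matrix.transpose_apply]

lemma lowers_step {θ} (hθ : Fr.Lowers θ) : Fr.Lowers (Fr.step θ) := fun i j m b hb => by
  rw [step_apply]
  refine sub_mem (add_mem (sum_mem fun k _ => ?_) (sum_mem fun k _ => ?_))
    (sum_mem fun k _ => sum_mem fun l _ => Submodule.smul_mem _ _ ?_)
  · exact Fr.defect_mem hθ (Fr.S₁_mem _ _ _ _ hb)
  · exact Fr.swap.defect_mem (Fr.lowers_swap hθ) (Fr.S₂_mem _ _ _ _ hb)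
  · exact Fr.defect_mem hθ (Fr.T_mem _ _ _ _ hb)

/-- Agreement of two matrices of operators on a step of the filtration. -/
def Agree (m : ℕ) (θ θ' : Matrix (Fin n) (Fin n) (Module.End ℂ B)) : Prop :=
  ∀ i j, ∀ b ∈ Fr.fil m, θ i j b = θ' i j b

lemma defect_agree {θ θ'} (hθ : Fr.Lowers θ) {m} (h : Fr.Agree m θ θ') :
    Fr.Agree m (Fr.defect θ) (Fr.defect θ') := fun i j b hb => by
  rw [defect_apply, defect_apply]
  congr 1
  refine Finset.sum_congr rfl fun k _ => Finset.sum_congr rfl fun l _ => ?_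
  rw [← h l j b hb, LinearMap.add_apply, LinearMap.add_apply,
    h k i _ (Fr.mem_of_lowers hθ hb)]

/-- The operators $S_1,S_2,T$ lower the filtration before the defect is evaluated, so each
application of the recursion gains one step of agreement. The recursion therefore acts as a
contraction for the filtration. -/
lemma step_agree {θ θ'} (hθ : Fr.Lowers θ) {m} (h : Fr.Agree m θ θ') :
    Fr.Agree (m + 1) (Fr.step θ) (Fr.step θ') := fun i j b hb => by
  have h1 := Fr.defect_agree hθ h
  have h2 := Fr.swap.defect_agree (θ' := θ'ᵀ) (Fr.lowers_swap hθ) (m := m) fun i j => h j i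
  rw [step_apply, step_apply]
  simp only [h1 _ _ _ (Fr.S₁_mem _ _ _ _ hb), h2 _ _ _ (Fr.S₂_mem _ _ _ _ hb),
    h1 _ _ _ (Fr.T_mem _ _ _ _ hb)]

/-- The limit of a sequence of linear maps that is stationary along the filtration. -/
lemma exists_limit {V : Type*} [AddCommGroup V] [Module ℂ V] (f : ℕ → B →ₗ[ℂ] V)
    (h : ∀ m, ∀ b ∈ Fr.fil m, f (m + 1) b = f m b) :
    ∃ g : B →ₗ[ℂ] V, ∀ m, ∀ b ∈ Fr.fil m, g b = f m b := by
  have h' : ∀ m t, m ≤ t → ∀ b ∈ Fr.fil m, f t b = f m b := by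
    intro m t hmt b hb
    induction t, hmt using Nat.le_induction with
    | base => rfl
    | succ t ht ih => rw [h t b (Fr.fil_mono ht hb), ih]
  choose d hd using Fr.fil_exhaust
  have key : ∀ m, ∀ b ∈ Fr.fil m, f (d b) b = f m b := fun m b hb => by
    rw [← h' _ _ (le_max_left (d b) m) b (hd b), h' _ _ (le_max_right (d b) m) b hb]
  refine ⟨{ toFun := fun b => f (d b) b, map_add' := fun x y => ?_, map_smul' := fun c x => ?_ },
    key⟩
  · have hx := Fr.fil_mono (le_max_left (d x) (d y)) (hd x)
    have hy := Fr.fil_mono (le_max_right (d x) (d y)) (hd y)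
    rw [key _ _ (add_mem hx hy), key _ _ hx, key _ _ hy, map_add]
  · rw [key _ _ (Submodule.smul_mem _ c (hd x)), map_smul, RingHom.id_apply]

/-- The recursion has a solution. -/
theorem exists_fixed : ∃ θ, Fr.Lowers θ ∧ Fr.step θ = θ := by
  -- Iteration from zero: the sequence is stationary on each step of the filtration, starting from
  -- `fil 0 = ⊥`, so it has a limit and the limit is fixed.
  obtain ⟨t, ht0, ht⟩ : ∃ t : ℕ → Matrix (Fin n) (Fin n) (Module.End ℂ B),
      t 0 = 0 ∧ ∀ m, t (m + 1) = Fr.step (t m) :=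
    ⟨fun m => Fr.step^[m] 0, rfl, fun m => Function.iterate_succ_apply' _ _ _⟩
  have hlow : ∀ m, Fr.Lowers (t m) := fun m => by
    induction m with
    | zero => intro i j m b _; rw [ht0]; exact zero_mem _
    | succ m ih => rw [ht]; exact Fr.lowers_step ih
  have hagree : ∀ m, Fr.Agree m (t (m + 1)) (t m) := fun m => by
    induction m with
    | zero =>
      intro i j b hb
      rw [Fr.fil_zero, Submodule.mem_bot] at hb
      simp [hb]
    | succ m ih =>
      have := Fr.step_agree (hlow (m + 1)) ih
      rwa [← ht (m + 1), ← ht m] at this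
  obtain ⟨θ, hθ⟩ : ∃ θ : Matrix (Fin n) (Fin n) (Module.End ℂ B), ∀ m, Fr.Agree m θ (t m) := by
    have h (i j : Fin n) : ∃ g : B →ₗ[ℂ] B, ∀ m, ∀ b ∈ Fr.fil m, g b = t m i j b :=
      Fr.exists_limit (V := B) (fun m => t m i j) fun m => hagree m i j
    choose θ hθ using h
    exact ⟨Matrix.of θ, fun m i j => hθ i j m⟩
  have hl : Fr.Lowers θ := fun i j m b hb => by
    rw [hθ _ i j b hb]
    exact hlow _ _ _ _ _ hb
  refine ⟨θ, hl, Matrix.ext fun i j => LinearMap.ext fun b => ?_⟩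
  obtain ⟨m, hm⟩ := Fr.fil_exhaust b
  have hm' := Fr.fil_mono (Nat.le_succ m) hm
  have h2 := Fr.step_agree hl (hθ m) i j b hm'
  rw [h2, hθ _ i j b hm', ht]

/-- Contracting with both forms gives $\sum G_{ij}H_{ij}-\sum G_{kl}H_{ij}U_{ki}\theta_{lj}$, which
is symmetric under exchanging the forms and transposing. The single term with $T$ in the recursion
can thus correct both families of relations at once. -/
lemma trace_swap (θ) : Fr.swap.trace θᵀ = Fr.trace θ := by
  ext b
  simp only [trace, LinearMap.sum_apply, LinearMap.smul_apply, defect_apply, smul_sub,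
    Finset.sum_sub_distrib, Finset.smul_sum]
  congr 1
  · exact Finset.sum_congr rfl fun i _ => Finset.sum_congr rfl fun j _ => smul_comm _ _ _
  · rw [sum_comm_pairs]
    refine Finset.sum_congr rfl fun i _ => Finset.sum_congr rfl fun j _ =>
      Finset.sum_congr rfl fun k _ => Finset.sum_congr rfl fun l _ => ?_
    rw [smul_comm]
    rfl

/-- The first relation for `X + θ`, up to the defect. -/
lemma relation_left (θ) : (Fr.X + θ)ᵀ * opScalars B G * (Fr.X + θ) - opScalars B G =
    θᵀ * opScalars B G * Fr.X - Fr.defect θ := by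
  rw [defect, Matrix.mul_add, Matrix.transpose_add, Matrix.add_mul, Matrix.add_mul, Fr.rel_left]
  abel

/-- The cubic expression $U^tGUHU^t$ can be reduced by either family of relations. Comparing the two
reductions, and using $XHX^t=0$ and $GH=1$, writes $dHX^t$, where $d$ is the defect, in terms of the
failures of the two relations. This is the consistency check of the deformation. -/
lemma defect_mul (hGH : G * H = 1) (θ) : Fr.defect θ * opScalars B H * Fr.Xᵀ =
    ((Fr.X + θ)ᵀ * opScalars B G * (Fr.X + θ) - opScalars B G) * opScalars B H * θᵀ -
    (Fr.X + θ)ᵀ * opScalars B G *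
      ((Fr.X + θ) * opScalars B H * (Fr.X + θ)ᵀ - opScalars B H) := by
  have h := Fr.swap.relation_left θᵀ
  have hs : Fr.swap.defect θᵀ = opScalars B H - (Fr.X + θ) * opScalars B H * θᵀ := rfl
  have h2 : (Fr.X + θ) * opScalars B H * (Fr.X + θ)ᵀ - opScalars B H =
    θ * opScalars B H * Fr.Xᵀ - (opScalars B H - (Fr.X + θ) * opScalars B H * θᵀ) := h
  have hGH' : opScalars B G * opScalars B H = 1 := by rw [opScalars_mul, hGH, opScalars_one]
  rw [h2, defect]
  simp only [Matrix.sub_mul, Matrix.mul_sub, Matrix.mul_assoc, hGH', Matrix.mul_one]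
  simp only [Matrix.one_mul, Matrix.transpose_add]
  abel

/-- For a solution of the recursion, the first relation fails only by terms that involve the
relations on smaller steps of the filtration. -/
lemma relation_left_of_fixed {θ} (hfix : Fr.step θ = θ) (j i : Fin n) :
    (θᵀ * opScalars B G * Fr.X - Fr.defect θ) j i =
      - (Fr.defect θ * opScalars B H * Fr.Xᵀ * Fr.S₂) j i
      - (∑ l, ∑ k, G l k • (Fr.swap.defect θᵀ * opScalars B G * Fr.X * Fr.S₁ᵀ) l k) *
        (Fr.Tᵀ * opScalars B G * Fr.X) j i := by
  -- The fixed point equation is substituted in $\theta^tGX$; the three summands are treated in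
  -- turn.
  have h1 : θᵀ = Fr.defect θ * Fr.S₁ᵀ + (Fr.swap.defect θᵀ * Fr.S₂)ᵀ -
      Matrix.of fun a b => Fr.trace θ * Fr.Tᵀ a b := by
    conv_lhs => rw [← hfix]
    rfl
  have h2 : Fr.defect θ * Fr.S₁ᵀ * opScalars B G * Fr.X =
      Fr.defect θ - Fr.defect θ * opScalars B H * Fr.Xᵀ * Fr.S₂ := by
    have := congrArg (Fr.defect θ * ·) Fr.S₁_rel
    simp only [Matrix.mul_add, Matrix.mul_one] at this
    rw [eq_sub_iff_add_eq]
    simpa only [Matrix.mul_assoc] using this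
  -- By `S₂_X` this summand splits as a contraction of the swapped defect with $S_2HX^t=1-GXS_1^t$,
  -- times $T^tGX$. The part from $1$ is the trace and cancels the summand with $T$; the rest is the
  -- second error term of the statement.
  have h3 : ((Fr.swap.defect θᵀ * Fr.S₂)ᵀ * opScalars B G * Fr.X) j i =
      (∑ l, ∑ k, G l k • (Fr.swap.defect θᵀ * (Fr.S₂ * opScalars B H * Fr.Xᵀ)) l k) *
        (Fr.Tᵀ * opScalars B G * Fr.X) j i := by
    rw [Matrix.mul_assoc, Matrix.mul_apply, Finset.sum_mul]
    refine Finset.sum_congr rfl fun l _ => ?_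
    rw [opScalars_mul_apply, Finset.mul_sum, Finset.sum_mul]
    refine Finset.sum_congr rfl fun k _ => ?_
    rw [Matrix.transpose_apply, Matrix.mul_apply, Matrix.mul_apply, mul_smul_comm, smul_mul_assoc,
      Finset.sum_mul, Finset.sum_mul]
    congr 1
    refine Finset.sum_congr rfl fun d _ => ?_
    rw [mul_assoc, mul_assoc, Fr.S₂_X]
  have h4 : ((Matrix.of fun a b => Fr.trace θ * Fr.Tᵀ a b) * opScalars B G * Fr.X) j i =
      Fr.trace θ * (Fr.Tᵀ * opScalars B G * Fr.X) j i := by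
    simp only [Matrix.mul_assoc]
    rw [Matrix.mul_apply, Matrix.mul_apply, Finset.mul_sum]
    simp only [Matrix.of_apply, mul_assoc]
  have h5 : Fr.S₂ * opScalars B H * Fr.Xᵀ = 1 - opScalars B G * Fr.X * Fr.S₁ᵀ :=
    eq_sub_of_add_eq Fr.S₂_rel
  have h6 : ∑ l, ∑ k, G l k • Fr.swap.defect θᵀ l k = Fr.trace θ := Fr.trace_swap θ
  have h7 : (θᵀ * opScalars B G * Fr.X) j i = (Fr.defect θ * Fr.S₁ᵀ * opScalars B G * Fr.X) j i
      + ((Fr.swap.defect θᵀ * Fr.S₂)ᵀ * opScalars B G * Fr.X) j i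
      - ((Matrix.of fun a b => Fr.trace θ * Fr.Tᵀ a b) * opScalars B G * Fr.X) j i := by
    conv_lhs => rw [h1]
    simp only [Matrix.sub_mul, Matrix.add_mul, Matrix.sub_apply, Matrix.add_apply]
  rw [Matrix.sub_apply, h7, h2, h3, h4, h5]
  simp only [Matrix.mul_sub, Matrix.mul_one, Matrix.sub_apply, smul_sub, Finset.sum_sub_distrib,
    h6, sub_mul, Matrix.mul_assoc]
  abel

/-- The operators `X + θ` satisfy the first relation on the `m`-th step of the filtration. -/
def RelatedOn (m : ℕ) (θ : Matrix (Fin n) (Fin n) (Module.End ℂ B)) : Prop :=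
  ∀ i j, ∀ b ∈ Fr.fil m,
    ((Fr.X + θ)ᵀ * opScalars B G * (Fr.X + θ) - opScalars B G) i j b = 0

lemma opScalars_mul_mem {P : Matrix (Fin n) (Fin n) (Module.End ℂ B)} {W : Submodule ℂ B} {b : B}
    {j : Fin n} (h : ∀ i, P i j b ∈ W) (K : Matrix (Fin n) (Fin n) ℂ) (i : Fin n) :
    (opScalars B K * P) i j b ∈ W := by
  rw [mul_apply_apply]
  refine sum_mem fun k _ => ?_
  rw [opScalars_apply_apply]
  exact Submodule.smul_mem _ _ (h k)

lemma defect_mul_eq_zero (hGH : G * H = 1) {θ} (hθ : Fr.Lowers θ) {m : ℕ}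
    (h1 : Fr.RelatedOn m θ) (h2 : Fr.swap.RelatedOn m θᵀ) (i j : Fin n) {b : B}
    (hb : b ∈ Fr.fil m) : (Fr.defect θ * opScalars B H * Fr.Xᵀ) i j b = 0 := by
  rw [Fr.defect_mul hGH, Matrix.sub_apply, LinearMap.sub_apply, Matrix.mul_assoc, mul_apply_apply,
    mul_apply_apply]
  have e1 : ∀ k, ((Fr.X + θ)ᵀ * opScalars B G * (Fr.X + θ) - opScalars B G) i k
      ((opScalars B H * θᵀ) k j b) = 0 := fun k =>
    h1 i k _ (opScalars_mul_mem (P := θᵀ) (W := Fr.fil m)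
      (fun l => (Fr.mem_of_lowers hθ hb : θ j l b ∈ Fr.fil m)) H k)
  have e2 : ∀ k, ((Fr.X + θ) * opScalars B H * (Fr.X + θ)ᵀ - opScalars B H) k j b = 0 := fun k =>
    h2 k j _ hb
  rw [Finset.sum_eq_zero fun k _ => e1 k, zero_sub, neg_eq_zero]
  exact Finset.sum_eq_zero fun k _ => by rw [e2 k, map_zero]

/-- In both error terms of `relation_left_of_fixed` an operator $S_2$ or $S_1$ acts before a product
of the form $dHX^t$ or its swapped analogue. These operators lower the filtration into the step
where both relations hold, and there such products vanish. -/
lemma relatedOn_succ (hGH : G * H = 1) (hHG : H * G = 1) {θ} (hθ : Fr.Lowers θ)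
    (hfix : Fr.step θ = θ) {m : ℕ} (h1 : Fr.RelatedOn m θ) (h2 : Fr.swap.RelatedOn m θᵀ) :
    Fr.RelatedOn (m + 1) θ := fun i j b hb => by
  have e1 := fun i j b hb => Fr.defect_mul_eq_zero hGH hθ h1 h2 i j (b := b) hb
  have e2 := fun i j b hb =>
    Fr.swap.defect_mul_eq_zero hHG (Fr.lowers_swap hθ) h2 h1 i j (b := b) hb
  rw [Fr.relation_left, Fr.relation_left_of_fixed hfix]
  have e3 : ∀ y ∈ Fr.fil (m + 1), ∀ l k,
      (Fr.swap.defect θᵀ * opScalars B G * Fr.X * Fr.S₁ᵀ) l k y = 0 := fun y hy l k => by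
    rw [mul_apply_apply]
    exact Finset.sum_eq_zero fun d _ => e2 _ _ _ (Fr.S₁_mem _ _ _ _ hy)
  have e4 : (Fr.Tᵀ * opScalars B G * Fr.X) i j b ∈ Fr.fil (m + 1) := by
    rw [Matrix.mul_assoc, mul_apply_apply]
    exact sum_mem fun k _ => Fr.T_mem _ _ _ _
      (opScalars_mul_mem (fun i => Fr.X_mem _ _ _ _ hb) _ _)
  rw [LinearMap.sub_apply, LinearMap.neg_apply, mul_apply_apply, Module.End.mul_apply,
    Finset.sum_eq_zero fun d _ => e1 _ _ _ (Fr.S₂_mem _ _ _ _ hb)]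
  simp [LinearMap.sum_apply, e3 _ e4]

/-- The symmetry makes the transpose of a solution a solution for the swapped frame, so every
statement about the first relation also yields the second. -/
lemma step_swap (θ) : Fr.swap.step θᵀ = (Fr.step θ)ᵀ := by
  refine Matrix.ext fun a b => ?_
  have h : Fr.swap.step θᵀ a b = (Fr.swap.defect θᵀ * Fr.S₂) b a +
    (Fr.swap.swap.defect θ * Fr.S₁ᵀ) a b - Fr.swap.trace θᵀ * Fr.T b a := rfl
  rw [h, trace_swap, swap_swap, add_comm]
  rfl

/-- Operators `U = X + θ` that satisfy `Uᵀ G U = G` and `U H Uᵀ = H`. -/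
theorem exists_related (hGH : G * H = 1) (hHG : H * G = 1) : ∃ θ, Fr.Lowers θ ∧
    (Fr.X + θ)ᵀ * opScalars B G * (Fr.X + θ) = opScalars B G ∧
    (Fr.X + θ) * opScalars B H * (Fr.X + θ)ᵀ = opScalars B H := by
  obtain ⟨θ, hθ, hfix⟩ := Fr.exists_fixed
  have hfix' : Fr.swap.step θᵀ = θᵀ := by rw [step_swap, hfix]
  -- The two families are proved together, since each one on a given step uses both on the step
  -- below.
  have key : ∀ m, Fr.RelatedOn m θ ∧ Fr.swap.RelatedOn m θᵀ := fun m => by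
    induction m with
    | zero =>
      constructor
      all_goals
        intro i j b hb
        have : b = 0 := by
          rw [← Submodule.mem_bot ℂ, ← Fr.fil_zero]; exact hb
        rw [this, map_zero]
    | succ m ih =>
      exact ⟨Fr.relatedOn_succ hGH hHG hθ hfix ih.1 ih.2,
        Fr.swap.relatedOn_succ hHG hGH (Fr.lowers_swap hθ) hfix' ih.2 ih.1⟩
  refine ⟨θ, hθ, ?_, ?_⟩
  · refine sub_eq_zero.mp (Matrix.ext fun i j => LinearMap.ext fun b => ?_)
    obtain ⟨m, hm⟩ := Fr.fil_exhaust b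
    exact (key m).1 i j b hm
  · refine sub_eq_zero.mp (Matrix.ext fun i j => LinearMap.ext fun b => ?_)
    obtain ⟨m, hm⟩ := Fr.fil_exhaust b
    exact (key m).2 i j b hm

end Frame
end BilinearForm

/-! ### Comparing the algebra of the bilinear form with the deformed module -/

namespace BilinearForm

open Matrix

section Algebra

variable {n : ℕ} (E : GL (Fin n) ℂ)

lemma scalars_one {R : Type*} [Semiring R] [Algebra ℂ R] :
    scalars R (1 : Matrix (Fin n) (Fin n) ℂ) = 1 := by
  simp [scalars]

lemma scalars_mul {R : Type*} [Semiring R] [Algebra ℂ R] (X Y : Matrix (Fin n) (Fin n) ℂ) :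
    scalars R (X * Y) = scalars R X * scalars R Y := by
  simp [scalars, Matrix.map_mul]

lemma map_scalars {R S : Type*} [Semiring R] [Algebra ℂ R] [Semiring S] [Algebra ℂ S]
    (f : R →ₐ[ℂ] S) (X : Matrix (Fin n) (Fin n) ℂ) : (scalars R X).map f = scalars S X := by
  ext i j; simp [scalars]

lemma map_one_matrix {R S : Type*} [Semiring R] [Algebra ℂ R] [Semiring S] [Algebra ℂ S]
    (f : R →ₐ[ℂ] S) : (1 : Matrix (Fin n) (Fin n) R).map f = 1 := by
  ext i j; simp [Matrix.one_apply, apply_ite f]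

lemma u_left : (u E)ᵀ * scalars _ E.val * u E = scalars _ E.val := by
  have h : scalars _ (E⁻¹).val * (u E)ᵀ * scalars _ E.val * u E = 1 := by
    have h0 : ∀ i j, RingQuot.mkAlgHom ℂ (Rel E) ((scalars _ (E⁻¹).val * (freeU n)ᵀ *
        scalars _ E.val * freeU n :
          Matrix (Fin n) (Fin n) (FreeAlgebra ℂ (Fin n × Fin n))) i j) = RingQuot.mkAlgHom ℂ (Rel E)
          ((1 : Matrix (Fin n) (Fin n) (FreeAlgebra ℂ (Fin n × Fin n))) i j) := fun i j =>
      RingQuot.mkAlgHom_rel ℂ (Rel.left i j)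
    have h1 := Matrix.ext h0
    change Matrix.map _ (RingQuot.mkAlgHom ℂ (Rel E)) =
      Matrix.map 1 (RingQuot.mkAlgHom ℂ (Rel E)) at h1
    rw [map_one_matrix] at h1
    simp only [Matrix.map_mul, map_scalars] at h1
    exact h1
  have h2 := congrArg (scalars _ E.val * ·) h
  simp only [Matrix.mul_one, ← Matrix.mul_assoc] at h2
  rwa [← scalars_mul, E.mul_inv, scalars_one, Matrix.one_mul] at h2

lemma u_right : u E * scalars _ (E⁻¹).val * (u E)ᵀ = scalars _ (E⁻¹).val := by
  have h : u E * scalars _ (E⁻¹).val * (u E)ᵀ * scalars _ E.val = 1 := by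
    have h0 : ∀ i j, RingQuot.mkAlgHom ℂ (Rel E) ((freeU n * scalars _ (E⁻¹).val * (freeU n)ᵀ *
        scalars _ E.val :
          Matrix (Fin n) (Fin n) (FreeAlgebra ℂ (Fin n × Fin n))) i j) = RingQuot.mkAlgHom ℂ (Rel E)
          ((1 : Matrix (Fin n) (Fin n) (FreeAlgebra ℂ (Fin n × Fin n))) i j) := fun i j =>
      RingQuot.mkAlgHom_rel ℂ (Rel.right i j)
    have h1 := Matrix.ext h0
    change Matrix.map _ (RingQuot.mkAlgHom ℂ (Rel E)) =
      Matrix.map 1 (RingQuot.mkAlgHom ℂ (Rel E)) at h1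
    rw [map_one_matrix] at h1
    simp only [Matrix.map_mul, map_scalars] at h1
    exact h1
  have h2 := congrArg (· * scalars _ (E⁻¹).val) h
  simp only [Matrix.one_mul, Matrix.mul_assoc] at h2
  rw [← scalars_mul, E.mul_inv, scalars_one, Matrix.mul_one] at h2
  rwa [Matrix.mul_assoc]

variable {E}

/-- The universal property of the algebra of a bilinear form. -/
lemma exists_algHom {R : Type*} [Ring R] [Algebra ℂ R] (V : Matrix (Fin n) (Fin n) R)
    (h₁ : Vᵀ * scalars _ E.val * V = scalars _ E.val)
    (h₂ : V * scalars _ (E⁻¹).val * Vᵀ = scalars _ (E⁻¹).val) :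
    ∃ f : Alg E →ₐ[ℂ] R, ∀ i j, f (u E i j) = V i j := by
  set f : FreeAlgebra ℂ (Fin n × Fin n) →ₐ[ℂ] R := FreeAlgebra.lift ℂ fun p => V p.1 p.2
  have hu : (freeU n).map f = V := by
    ext i j; simp [freeU, f]
  have hut : ((freeU n)ᵀ).map f = Vᵀ := by
    rw [← hu]; rfl
  have h1 : scalars _ (E⁻¹).val * Vᵀ * scalars _ E.val * V = 1 := by
    rw [Matrix.mul_assoc, Matrix.mul_assoc, ← Matrix.mul_assoc Vᵀ, h₁, ← scalars_mul, E.inv_mul,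
      scalars_one]
  have h2 : V * scalars _ (E⁻¹).val * Vᵀ * scalars _ E.val = 1 := by
    rw [h₂, ← scalars_mul, E.inv_mul, scalars_one]
  refine ⟨RingQuot.liftAlgHom ℂ ⟨f, ?_⟩, fun i j => ?_⟩
  · rintro _ _ (⟨i, j⟩ | ⟨i, j⟩)
    · rw [← Matrix.map_apply (f := f), ← Matrix.map_apply (f := f)]
      simp only [Matrix.map_mul, hu, hut, map_scalars, map_one_matrix, h1]
    · rw [← Matrix.map_apply (f := f), ← Matrix.map_apply (f := f)]
      simp only [Matrix.map_mul, hu, hut, map_scalars, map_one_matrix, h2]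
  · simp [u, freeU, f]

/-- Induction on elements of the algebra of a bilinear form. -/
lemma alg_induction {p : Alg E → Prop} (scalar : ∀ c, p (algebraMap ℂ _ c))
    (gen : ∀ i j, p (u E i j)) (mul : ∀ a b, p a → p b → p (a * b))
    (add : ∀ a b, p a → p b → p (a + b)) (a : Alg E) : p a := by
  obtain ⟨x, rfl⟩ := RingQuot.mkAlgHom_surjective ℂ (Rel E) a
  induction x using FreeAlgebra.induction with
  | grade0 c => rw [AlgHom.commutes]; exact scalar c
  | grade1 x => exact gen x.1 x.2
  | mul x y hx hy => rw [map_mul]; exact mul _ _ hx hy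
  | add x y hx hy => rw [map_add]; exact add _ _ hx hy

lemma u_left_apply (i j : Fin n) :
    ∑ l, ∑ k, E.val k l • (u E k i * u E l j) = algebraMap ℂ _ (E.val i j) := by
  have := congrFun (congrFun (u_left E) i) j
  rw [Matrix.mul_apply] at this
  refine Eq.trans (Finset.sum_congr rfl fun l _ => ?_) this
  rw [Matrix.mul_apply, Finset.sum_mul]
  refine Finset.sum_congr rfl fun k _ => ?_
  simp [scalars, Algebra.smul_def, mul_assoc, Algebra.left_comm]

lemma u_right_apply (i j : Fin n) :
    ∑ l, ∑ k, (E⁻¹).val k l • (u E i k * u E j l) = algebraMap ℂ _ ((E⁻¹).val i j) := by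
  have := congrFun (congrFun (u_right E) i) j
  rw [Matrix.mul_apply] at this
  refine Eq.trans (Finset.sum_congr rfl fun l _ => ?_) this
  rw [Matrix.mul_apply, Finset.sum_mul]
  refine Finset.sum_congr rfl fun k _ => ?_
  simp [scalars, Algebra.smul_def, mul_assoc, Algebra.left_comm]

end Algebra

lemma opScalars_sandwich_apply {n : ℕ} {B : Type*} [AddCommGroup B] [Module ℂ B]
    (M P : Matrix (Fin n) (Fin n) (Module.End ℂ B)) (G : Matrix (Fin n) (Fin n) ℂ) (i j : Fin n) :
    (M * opScalars B G * P) i j = ∑ l, ∑ k, G l k • (M i l * P k j) := by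
  rw [Matrix.mul_assoc, Matrix.mul_apply]
  refine Finset.sum_congr rfl fun l _ => ?_
  rw [opScalars_mul_apply, Finset.mul_sum]
  exact Finset.sum_congr rfl fun k _ => mul_smul_comm _ _ _

lemma map_op_mul_map_op {n : ℕ} {R : Type*} [Ring R] (M N : Matrix (Fin n) (Fin n) R) :
    M.map op * N.map op = (Nᵀ * Mᵀ)ᵀ.map op := by
  ext i j
  simp [Matrix.mul_apply]

/-- Operators `U` with `Uᵀ G U = G` and `U H Uᵀ = H` define a right action of the algebra of the
bilinear form. -/
lemma exists_action {n : ℕ} {E : GL (Fin n) ℂ} {B : Type*} [AddCommGroup B] [Module ℂ B]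
    (U : Matrix (Fin n) (Fin n) (Module.End ℂ B))
    (h₁ : Uᵀ * opScalars B E.valᵀ * U = opScalars B E.valᵀ)
    (h₂ : U * opScalars B (E⁻¹).valᵀ * Uᵀ = opScalars B (E⁻¹).valᵀ) :
    ∃ f : Alg E →ₐ[ℂ] (Module.End ℂ B)ᵐᵒᵖ, ∀ i j, f (u E i j) = op (U i j) := by
  have hs : ∀ Y : Matrix (Fin n) (Fin n) ℂ, scalars (Module.End ℂ B)ᵐᵒᵖ Y =
      (opScalars B Y).map op := fun Y => by
    ext i j : 1
    simp [scalars, MulOpposite.algebraMap_apply]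
  -- A right action reverses products, so the relation $u^tEu=E$ becomes $U^tE^tU=E^t$ for
  -- operators. This is why frames are used with $G=E^t$ and $H=(E^{-1})^t$.
  refine exists_algHom (U.map op) ?_ ?_
  · rw [← Matrix.transpose_map, hs, map_op_mul_map_op, map_op_mul_map_op, Matrix.transpose_transpose,
      Matrix.transpose_transpose, opScalars_transpose, ← Matrix.mul_assoc, h₁]
    rfl
  · rw [← Matrix.transpose_map, hs, map_op_mul_map_op, map_op_mul_map_op, Matrix.transpose_transpose,
      Matrix.transpose_transpose, opScalars_transpose, ← Matrix.mul_assoc, h₂]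
    rfl

/-- Vanishing of the combinations `∑ K_ak Ξ_a X_k`, where `Ξ_a y = s y v_a - s (θ_a y)`. -/
lemma sum_symbol_eq_zero {n : ℕ} {A B : Type*} [Ring A] [Algebra ℂ A] [AddCommGroup B] [Module ℂ B]
    (s : B →ₗ[ℂ] A) (K : Matrix (Fin n) (Fin n) ℂ) (κ : ℂ) (x : B)
    (X θ X' θ' : Fin n → Module.End ℂ B) (v v' : Fin n → A)
    (hA : ∑ a, ∑ k, K a k • (v' k * v a) = algebraMap ℂ A κ)
    (hB : ∑ a, ∑ k, K a k • (X a + θ a) ((X' k + θ' k) x) = κ • x)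
    (h0 : ∑ a, ∑ k, K a k • X a (X' k x) = 0)
    (h1 : ∀ k, s ((X' k + θ' k) x) = s x * v' k)
    (h2 : ∀ a k, s ((X a + θ a) (θ' k x)) = s (θ' k x) * v a) :
    ∑ a, ∑ k, K a k • (s (X' k x) * v a - s (θ a (X' k x))) = 0 := by
  -- Writing $X'=U'-\theta'$, the algebra relation contributes $\kappa\,s(x)$ and the operator
  -- relation contributes the same scalar with opposite sign. The remaining terms $s(\theta'x)v$
  -- cancel.
  have e1 : ∀ k, s (X' k x) = s x * v' k - s (θ' k x) := fun k => by
    rw [← h1, LinearMap.add_apply, map_add]; abel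
  have e2 : ∑ a, ∑ k, K a k • s (θ a (X' k x)) =
      κ • s x - ∑ a, ∑ k, K a k • (s (θ' k x) * v a) := by
    have := congrArg s hB
    rw [map_smul] at this
    rw [← this, eq_sub_iff_add_eq, ← sub_eq_zero]
    have h0' := congrArg s h0
    rw [map_zero] at h0'
    simp only [← h2, map_sum, map_smul, ← Finset.sum_add_distrib, ← Finset.sum_sub_distrib,
      ← smul_add, ← smul_sub, ← map_add, ← map_sub] at h0' ⊢
    rw [← neg_eq_zero, ← h0', ← Finset.sum_neg_distrib]
    refine Finset.sum_congr rfl fun a _ => ?_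
    rw [← Finset.sum_neg_distrib]
    refine Finset.sum_congr rfl fun k _ => ?_
    rw [← smul_neg, ← map_neg]
    congr 2
    simp only [LinearMap.add_apply, map_add]
    abel
  have e3 : ∑ a, ∑ k, K a k • (s x * v' k * v a) = κ • s x := by
    rw [Algebra.smul_def, Algebra.commutes, ← hA, Finset.mul_sum]
    refine Finset.sum_congr rfl fun a _ => ?_
    rw [Finset.mul_sum]
    exact Finset.sum_congr rfl fun k _ => by rw [mul_smul_comm, mul_assoc]
  simp only [smul_sub, Finset.sum_sub_distrib, e1, sub_mul, e2, e3]
  abel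

section Regular

variable {n : ℕ} {E : GL (Fin n) ℂ} {B : Type*} [AddCommGroup B] [Module ℂ B]
  (Fr : Frame E.valᵀ (E⁻¹).valᵀ B)

/-- The recursion for a section of the orbit map of the right action. -/
noncomputable def sectionStep (θ : Matrix (Fin n) (Fin n) (Module.End ℂ B)) (ε₀ : B →ₗ[ℂ] ℂ)
    (s : B →ₗ[ℂ] Alg E) : B →ₗ[ℂ] Alg E :=
  ∑ i, ∑ j, (LinearMap.mulRight ℂ (u E i j) ∘ₗ s - s ∘ₗ θ i j) ∘ₗ Fr.S₀ i j
    + Algebra.linearMap ℂ (Alg E) ∘ₗ ε₀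

lemma sectionStep_apply (θ : Matrix (Fin n) (Fin n) (Module.End ℂ B)) (ε₀ : B →ₗ[ℂ] ℂ)
    (s : B →ₗ[ℂ] Alg E) (b : B) : sectionStep Fr θ ε₀ s b =
      ∑ i, ∑ j, (s (Fr.S₀ i j b) * u E i j - s (θ i j (Fr.S₀ i j b))) +
        algebraMap ℂ (Alg E) (ε₀ b) := by
  simp [sectionStep, LinearMap.sum_apply]

/-- The recursion comes from $b=\sum(U-\theta)S_0b+\varepsilon b$ and the requirement $s(Ub)=s(b)u$.
As $S_0$ lowers the filtration, the iterates are stationary on each step. -/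
lemma exists_section {θ : Matrix (Fin n) (Fin n) (Module.End ℂ B)} (hθ : Fr.Lowers θ)
    (ε₀ : B →ₗ[ℂ] ℂ) : ∃ s, sectionStep Fr θ ε₀ s = s := by
  obtain ⟨t, ht0, ht⟩ : ∃ t : ℕ → (B →ₗ[ℂ] Alg E),
      t 0 = 0 ∧ ∀ m, t (m + 1) = sectionStep Fr θ ε₀ (t m) :=
    ⟨fun m => (sectionStep Fr θ ε₀)^[m] 0, rfl, fun m => Function.iterate_succ_apply' _ _ _⟩
  have agree : ∀ (f g : B →ₗ[ℂ] Alg E) m, (∀ b ∈ Fr.fil m, f b = g b) →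
      ∀ b ∈ Fr.fil (m + 1), sectionStep Fr θ ε₀ f b = sectionStep Fr θ ε₀ g b := by
    intro f g m h b hb
    rw [sectionStep_apply, sectionStep_apply]
    congr 1
    refine Finset.sum_congr rfl fun i _ => Finset.sum_congr rfl fun j _ => ?_
    have h1 := Fr.S₀_mem i j m b hb
    rw [h _ h1, h _ (Fr.mem_of_lowers hθ h1)]
  have hagree : ∀ m, ∀ b ∈ Fr.fil m, t (m + 1) b = t m b := fun m => by
    induction m with
    | zero =>
      intro b hb
      rw [Fr.fil_zero, Submodule.mem_bot] at hb
      simp [hb]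
    | succ m ih =>
      have := agree _ _ m ih
      rwa [← ht (m + 1), ← ht m] at this
  obtain ⟨s, hs⟩ := Fr.exists_limit t hagree
  refine ⟨s, LinearMap.ext fun b => ?_⟩
  obtain ⟨m, hm⟩ := Fr.fil_exhaust b
  have hm' := Fr.fil_mono (Nat.le_succ m) hm
  rw [agree s (t m) m (hs m) b hm', hs _ b hm', ht]

variable {Fr} {θ : Matrix (Fin n) (Fin n) (Module.End ℂ B)} (hθ : Fr.Lowers θ)
  (h₁ : (Fr.X + θ)ᵀ * opScalars B E.valᵀ * (Fr.X + θ) = opScalars B E.valᵀ)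
  (h₂ : (Fr.X + θ) * opScalars B (E⁻¹).valᵀ * (Fr.X + θ)ᵀ = opScalars B (E⁻¹).valᵀ)
  {ε₀ : B →ₗ[ℂ] ℂ} {s : B →ₗ[ℂ] Alg E} (hs : sectionStep Fr θ ε₀ s = s)

include hθ h₁ in
-- The expression $\Xi_{ij}(y)=s(y)u_{ij}-s(\theta_{ij}y)$ is the value that $s(X_{ij}y)$ must have.
-- It can depend only on $X_{ij}y$ if it respects the leading relations among the $X_{ij}$; this is
-- that check for the first family.
lemma symbol_left {m : ℕ} (ih : ∀ i j, ∀ b ∈ Fr.fil m, s ((Fr.X + θ) i j b) = s b * u E i j)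
    (d e : Fin n) (x : B) (hx : x ∈ Fr.fil m) :
    ∑ a, ∑ k, E.val k a • (s (Fr.X k d x) * u E a e - s (θ a e (Fr.X k d x))) = 0 := by
  refine sum_symbol_eq_zero s E.valᵀ (E.val d e) x (fun a => Fr.X a e) (fun a => θ a e)
    (fun k => Fr.X k d) (fun k => θ k d) (fun a => u E a e) (fun k => u E k d) ?_ ?_ ?_ ?_ ?_
  · exact u_left_apply d e
  · have := LinearMap.congr_fun (congrFun (congrFun h₁ e) d) x
    rw [opScalars_sandwich_apply, opScalars_apply_apply] at this
    simpa [LinearMap.sum_apply] using this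
  · have := LinearMap.congr_fun (congrFun (congrFun Fr.rel_left e) d) x
    rw [opScalars_sandwich_apply] at this
    simpa [LinearMap.sum_apply] using this
  · exact fun k => ih k d x hx
  · exact fun a k => ih a e _ (Fr.mem_of_lowers hθ hx)

include hθ h₂ in
lemma symbol_right {m : ℕ} (ih : ∀ i j, ∀ b ∈ Fr.fil m, s ((Fr.X + θ) i j b) = s b * u E i j)
    (d e : Fin n) (x : B) (hx : x ∈ Fr.fil m) :
    ∑ a, ∑ k, (E⁻¹).val k a • (s (Fr.X d k x) * u E e a - s (θ e a (Fr.X d k x))) = 0 := by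
  refine sum_symbol_eq_zero s (E⁻¹).valᵀ ((E⁻¹).val d e) x (fun a => Fr.X e a) (fun a => θ e a)
    (fun k => Fr.X d k) (fun k => θ d k) (fun a => u E e a) (fun k => u E d k) ?_ ?_ ?_ ?_ ?_
  · exact u_right_apply d e
  · have := LinearMap.congr_fun (congrFun (congrFun h₂ e) d) x
    rw [opScalars_sandwich_apply, opScalars_apply_apply] at this
    simpa [LinearMap.sum_apply] using this
  · have := LinearMap.congr_fun (congrFun (congrFun Fr.rel_right e) d) x
    rw [opScalars_sandwich_apply] at this
    simpa [LinearMap.sum_apply] using this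
  · exact fun k => ih d k x hx
  · exact fun a k => ih e a _ (Fr.mem_of_lowers hθ hx)

include hθ h₁ h₂ hs in
-- The recursion defines $s(X_{ce}b)$ through $S_0X_{ce}b$. By `S₀_X` this differs from the obvious
-- preimage of $X_{ce}b$ only by leading relations, and those are killed by `symbol_left` and
-- `symbol_right`.
lemma section_mul (hε : ∀ i j b, ε₀ (Fr.X i j b) = 0) (i j : Fin n) (b : B) :
    s ((Fr.X + θ) i j b) = s b * u E i j := by
  have key : ∀ m i j, ∀ b ∈ Fr.fil m, s ((Fr.X + θ) i j b) = s b * u E i j := fun m => by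
    induction m with
    | zero =>
      intro i j b hb
      rw [Fr.fil_zero, Submodule.mem_bot] at hb
      simp [hb]
    | succ m ih =>
      intro c e b hb
      obtain ⟨Ξ, hΞ⟩ : ∃ Ξ : Fin n → Fin n → B →ₗ[ℂ] Alg E,
          ∀ i j y, Ξ i j y = s y * u E i j - s (θ i j y) :=
        ⟨fun i j => LinearMap.mulRight ℂ (u E i j) ∘ₗ s - s ∘ₗ θ i j, fun _ _ _ => rfl⟩
      have hl : ∀ d e, ∀ x ∈ Fr.fil m, ∑ a, Ξ a e ((opScalars B E.valᵀ * Fr.X) a d x) = 0 := by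
        intro d e x hx
        rw [← symbol_left hθ h₁ ih d e x hx]
        refine Finset.sum_congr rfl fun a _ => ?_
        rw [opScalars_mul_apply, LinearMap.sum_apply, map_sum]
        exact Finset.sum_congr rfl fun k _ => by rw [LinearMap.smul_apply, map_smul, hΞ]; rfl
      have hr : ∀ d e, ∀ x ∈ Fr.fil m,
          ∑ a, Ξ e a ((opScalars B (E⁻¹).valᵀ * Fr.Xᵀ) a d x) = 0 := by
        intro d e x hx
        rw [← symbol_right hθ h₂ ih d e x hx]
        refine Finset.sum_congr rfl fun a _ => ?_
        rw [opScalars_mul_apply, LinearMap.sum_apply, map_sum]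
        exact Finset.sum_congr rfl fun k _ => by rw [LinearMap.smul_apply, map_smul, hΞ]; rfl
      -- The constant term of the recursion disappears here, since $\varepsilon_0$ vanishes on the
      -- image of $X$.
      have e1 : s (Fr.X c e b) = ∑ i, ∑ j, Ξ i j ((Fr.S₀ i j * Fr.X c e) b) := by
        conv_lhs => rw [← hs, sectionStep_apply, hε, map_zero, add_zero]
        simp only [hΞ, Module.End.mul_apply]
      have e2 : ∀ i j, Ξ i j ((Fr.S₀ i j * Fr.X c e) b) =
          (if i = c ∧ j = e then Ξ i j b else 0)
          - (if j = e then Ξ i j ((opScalars B E.valᵀ * Fr.X * Fr.S₁ᵀ) i c b) else 0)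
          - (if i = c then Ξ i j ((opScalars B (E⁻¹).valᵀ * Fr.Xᵀ * Fr.S₂) j e b) else 0)
          + Ξ i j ((opScalars B E.valᵀ * Fr.X * opScalars B (E⁻¹).valᵀᵀ) i j (Fr.T c e b)) := by
        intro i j
        have h := congrArg (Ξ i j) (LinearMap.congr_fun (Fr.S₀_X i j c e) b)
        rw [LinearMap.sub_apply, LinearMap.add_apply, LinearMap.add_apply, map_sub, map_add,
          map_add] at h
        have h1 : Ξ i j ((if i = c ∧ j = e then (1 : Module.End ℂ B) else 0) b) =
            if i = c ∧ j = e then Ξ i j b else 0 := by split_ifs <;> simp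
        have h2 : Ξ i j ((if j = e then (opScalars B E.valᵀ * Fr.X * Fr.S₁ᵀ) i c else 0) b) =
            if j = e then Ξ i j ((opScalars B E.valᵀ * Fr.X * Fr.S₁ᵀ) i c b) else 0 := by
          split_ifs <;> simp
        have h3 : Ξ i j ((if i = c then (opScalars B (E⁻¹).valᵀ * Fr.Xᵀ * Fr.S₂) j e else 0) b) =
            if i = c then Ξ i j ((opScalars B (E⁻¹).valᵀ * Fr.Xᵀ * Fr.S₂) j e b) else 0 := by
          split_ifs <;> simp
        rw [h1, h2, h3] at h
        rw [← h, Module.End.mul_apply _ (Fr.T c e)]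
        abel
      have e3 : ∑ i, Ξ i e ((opScalars B E.valᵀ * Fr.X * Fr.S₁ᵀ) i c b) = 0 := by
        simp only [mul_apply_apply _ Fr.S₁ᵀ, map_sum]
        rw [Finset.sum_comm]
        exact Finset.sum_eq_zero fun d _ => hl _ _ _ (Fr.S₁_mem _ _ _ _ hb)
      have e4 : ∑ j, Ξ c j ((opScalars B (E⁻¹).valᵀ * Fr.Xᵀ * Fr.S₂) j e b) = 0 := by
        simp only [mul_apply_apply _ Fr.S₂, map_sum]
        rw [Finset.sum_comm]
        exact Finset.sum_eq_zero fun d _ => hr _ _ _ (Fr.S₂_mem _ _ _ _ hb)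
      -- The term with $T$ is a leading relation of the first family as well, with the second form
      -- applied to the argument; `hl` suffices.
      have e5 : ∑ i, ∑ j, Ξ i j ((opScalars B E.valᵀ * Fr.X * opScalars B (E⁻¹).valᵀᵀ) i j
          (Fr.T c e b)) = 0 := by
        simp only [mul_apply_apply _ (opScalars B (E⁻¹).valᵀᵀ), map_sum, opScalars_apply_apply]
        rw [Finset.sum_comm]
        refine Finset.sum_eq_zero fun j _ => ?_
        rw [Finset.sum_comm]
        exact Finset.sum_eq_zero fun d _ => hl _ _ _
          (Submodule.smul_mem _ _ (Fr.T_mem _ _ _ _ hb))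
      have e6 : s (Fr.X c e b) = Ξ c e b := by
        rw [e1]
        have e7 : ∑ i, ∑ j, (if i = c then
            Ξ i j ((opScalars B (E⁻¹).valᵀ * Fr.Xᵀ * Fr.S₂) j e b) else 0) = 0 := by
          rw [Finset.sum_comm]
          refine Eq.trans ?_ e4
          exact Finset.sum_congr rfl fun j _ => by rw [Finset.sum_ite_eq', if_pos (Finset.mem_univ _)]
        simp only [e2, Finset.sum_add_distrib, Finset.sum_sub_distrib, e5, e7, ite_and,
          Finset.sum_ite_eq', Finset.mem_univ, if_true, e3]
        rw [Finset.sum_eq_single c (fun i _ hi => by simp [hi]) (by simp)]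
        simp
      rw [Matrix.add_apply, LinearMap.add_apply, map_add, e6, hΞ]
      abel
  obtain ⟨m, hm⟩ := Fr.fil_exhaust b
  exact key m i j b hm

end Regular

end BilinearForm

/-! ### The deformed module is free of rank one -/

namespace BilinearForm

open Matrix

section Orbit

variable {n : ℕ} {E : GL (Fin n) ℂ} {B : Type*} [AddCommGroup B] [Module ℂ B]
  (Fr : Frame E.valᵀ (E⁻¹).valᵀ B)

/-- The right action constructed from a frame is free of rank one. -/
lemma exists_regular {θ : Matrix (Fin n) (Fin n) (Module.End ℂ B)} (hθ : Fr.Lowers θ)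
    (h₁ : (Fr.X + θ)ᵀ * opScalars B E.valᵀ * (Fr.X + θ) = opScalars B E.valᵀ)
    (h₂ : (Fr.X + θ) * opScalars B (E⁻¹).valᵀ * (Fr.X + θ)ᵀ = opScalars B (E⁻¹).valᵀ)
    {one : B} {ε₀ : B →ₗ[ℂ] ℂ} (hε : ∀ b, Fr.ε b = ε₀ b • one) (hone : ε₀ one = 1) :
    ∃ e : Alg E ≃ₗ[ℂ] B, e 1 = one ∧ ∀ i j a, e (a * u E i j) = (Fr.X + θ) i j (e a) := by
  obtain ⟨f, hf⟩ := exists_action _ h₁ h₂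
  obtain ⟨s, hs⟩ := exists_section Fr hθ ε₀
  have hone1 : one ∈ Fr.fil 1 := by
    have := Fr.ε_mem one
    rwa [hε, hone, one_smul] at this
  have hone0 : one = 0 → ∀ c : ℂ, c = 0 := fun h => by
    rw [h, map_zero] at hone
    exact absurd hone (by simp)
  have hεX : ∀ i j b, ε₀ (Fr.X i j b) = 0 := fun i j b => by
    have := LinearMap.congr_fun (Fr.ε_X i j) b
    rw [Module.End.mul_apply, hε, LinearMap.zero_apply, smul_eq_zero] at this
    exact this.elim id fun h => hone0 h _
  have hsm := section_mul hθ h₁ h₂ hs hεX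
  have hs1 : s one = 1 := by
    rw [← hs, sectionStep_apply, hone, map_one, Finset.sum_eq_zero, zero_add]
    refine fun i _ => Finset.sum_eq_zero fun j _ => ?_
    have := Fr.S₀_mem i j 0 one hone1
    rw [Fr.fil_zero, Submodule.mem_bot] at this
    simp [this]
  let ψ : Alg E →ₗ[ℂ] B :=
    LinearMap.applyₗ one ∘ₗ (opLinearEquiv ℂ).symm.toLinearMap ∘ₗ f.toLinearMap
  have hψ : ∀ a, ψ a = (f a).unop one := fun a => rfl
  have hψ1 : ψ 1 = one := by rw [hψ, map_one]; rfl
  have hψu : ∀ i j a, ψ (a * u E i j) = (Fr.X + θ) i j (ψ a) := fun i j a => by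
    rw [hψ, map_mul, hf, unop_mul, unop_op, Module.End.mul_apply, ← hψ]
  -- By induction on $a$ from `section_mul`: the map $s$ is linear over $A$. Since
  -- $s(\mathrm{one})=1$, it is a left inverse of the orbit map $\psi$.
  have hsf : ∀ a b, s ((f a).unop b) = s b * a := fun a => by
    induction a using alg_induction with
    | scalar c =>
      intro b
      rw [AlgHom.commutes, MulOpposite.algebraMap_apply, unop_op, Module.algebraMap_end_apply,
        map_smul, ← Algebra.commutes, Algebra.smul_def]
    | gen i j => intro b; rw [hf, unop_op, hsm]
    | mul x y hx hy =>
      intro b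
      rw [map_mul, unop_mul, Module.End.mul_apply, hy, hx, mul_assoc]
    | add x y hx hy =>
      intro b
      rw [map_add, MulOpposite.unop_add, LinearMap.add_apply, map_add, hx, hy, mul_add]
  -- The other composite: $\psi s$ fixes the base vector, and $b=\sum X S_0b+\varepsilon b$
  -- expresses the rest by elements of a smaller step.
  have hψs : ∀ b, ψ (s b) = b := fun b => by
    obtain ⟨m, hm⟩ := Fr.fil_exhaust b
    induction m generalizing b with
    | zero =>
      rw [Fr.fil_zero, Submodule.mem_bot] at hm
      simp [hm]
    | succ m ih =>
      have hX := LinearMap.congr_fun Fr.X_S₀ b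
      rw [LinearMap.sub_apply, hε, eq_sub_iff_add_eq, Module.End.one_apply] at hX
      rw [← hs, sectionStep_apply, map_add, Algebra.algebraMap_eq_smul_one, map_smul, hψ1]
      refine Eq.trans ?_ hX
      congr 1
      simp only [map_sum, LinearMap.sum_apply]
      refine Finset.sum_congr rfl fun i _ => Finset.sum_congr rfl fun j _ => ?_
      have h := Fr.S₀_mem i j m b hm
      rw [map_sub, hψu, ih _ h, ih _ (Fr.mem_of_lowers hθ h), Matrix.add_apply,
        LinearMap.add_apply, add_sub_cancel_right, Module.End.mul_apply]
  exact ⟨LinearEquiv.ofLinearMap ψ s (LinearMap.ext hψs)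
    (LinearMap.ext fun a => by
      rw [LinearMap.comp_apply, hψ, hsf, hs1, one_mul, LinearMap.id_apply]), hψ1, hψu⟩

end Orbit

/-- The algebra of a bilinear form, as a right module over itself, comes from a frame. -/
theorem exists_regular_frame {n : ℕ} (hn : 2 ≤ n) (E : GL (Fin n) ℂ) :
    ∃ (B : Type) (_ : AddCommGroup B) (_ : Module ℂ B) (Fr : Frame E.valᵀ (E⁻¹).valᵀ B)
      (θ : Matrix (Fin n) (Fin n) (Module.End ℂ B)) (e : Alg E ≃ₗ[ℂ] B), Fr.Lowers θ ∧
      (∀ b, ∃ c : ℂ, Fr.ε b = c • e 1) ∧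
      (Fr.X + θ)ᵀ * opScalars B E.valᵀ * (Fr.X + θ) = opScalars B E.valᵀ ∧
      (Fr.X + θ) * opScalars B (E⁻¹).valᵀ * (Fr.X + θ)ᵀ = opScalars B (E⁻¹).valᵀ ∧
      ∀ i j a, e (a * u E i j) = (Fr.X + θ) i j (e a) := by
  obtain ⟨D⟩ := exists_tower hn E.mul_inv
  obtain ⟨D'⟩ := exists_tower hn E.inv_mul
  -- The frame for $(G,H)$ needs towers of $G^t$ and $H^t$; for $G=E^t$ and $H=(E^{-1})^t$ the
  -- double transposes reduce definitionally to $E$ and $E^{-1}$.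
  let D₁ : Tower (E.valᵀ)ᵀ := D
  let D₂ : Tower ((E⁻¹).valᵀ)ᵀ := D'
  let Fr := segreFrame D₁ D₂
  obtain ⟨θ, hθ, h₁, h₂⟩ := Fr.exists_related
    (by rw [← transpose_mul, E.inv_mul, transpose_one])
    (by rw [← transpose_mul, E.mul_inv, transpose_one])
  let one : Segre D₁ D₂ := Segre.tm D₁ D₂ 0 (D₁.unit.symm 1) (D₂.unit.symm 1)
  let ε₁ : ∀ m, D₁.R m ⊗[ℂ] D₂.R m →ₗ[ℂ] ℂ := fun m => match m with
    | 0 => LinearMap.mul' ℂ ℂ ∘ₗ TensorProduct.map D₁.unit.toLinearMap D₂.unit.toLinearMap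
    | _ + 1 => 0
  let ε₀ : Segre D₁ D₂ →ₗ[ℂ] ℂ := DirectSum.toModule ℂ ℕ ℂ ε₁
  have hε0 : ∀ r r', ε₀ (Segre.tm D₁ D₂ 0 r r') = D₁.unit r * D₂.unit r' := fun r r' => by
    simp [ε₀, Segre.tm, ε₁]
  have hε1 : ∀ m r r', ε₀ (Segre.tm D₁ D₂ (m + 1) r r') = 0 := fun m r r' => by
    simp [ε₀, Segre.tm, ε₁]
  have hε : ∀ b, Fr.ε b = ε₀ b • one := fun b => by
    have : Fr.ε = ε₀.smulRight one := Segre.hom_ext fun m r r' => by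
      cases m with
      | zero =>
        rw [LinearMap.smulRight_apply, hε0]
        refine (Segre.base_tm_zero r r').trans ?_
        have h1 : r = D₁.unit r • D₁.unit.symm 1 := by
          rw [← map_smul, smul_eq_mul, mul_one, LinearEquiv.symm_apply_apply]
        have h2 : r' = D₂.unit r' • D₂.unit.symm 1 := by
          rw [← map_smul, smul_eq_mul, mul_one, LinearEquiv.symm_apply_apply]
        conv_lhs => rw [h1, h2]
        rw [map_smul, map_smul, LinearMap.smul_apply, smul_smul, mul_comm]
      | succ m =>
        rw [LinearMap.smulRight_apply, hε1, zero_smul]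
        exact Segre.base_tm_succ m r r'
    rw [this, LinearMap.smulRight_apply]
  obtain ⟨e, he1, he⟩ := exists_regular Fr hθ h₁ h₂ hε (by simp [one, hε0])
  exact ⟨_, _, _, Fr, θ, e, hθ, fun b => ⟨ε₀ b, by rw [hε, he1]⟩, h₁, h₂, he⟩

/-! ### Extension of frames to a tensor product with a second factor -/

section Extend

variable {n : ℕ} {G H : Matrix (Fin n) (Fin n) ℂ} {B : Type*} [AddCommGroup B] [Module ℂ B]
  (V : Type*) [AddCommGroup V] [Module ℂ V]

/-- The subspace `W ⊗ V`. -/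
def tensorSub (W : Submodule ℂ B) : Submodule ℂ (B ⊗[ℂ] V) :=
  Submodule.span ℂ {x | ∃ b ∈ W, ∃ v, x = b ⊗ₜ v}

variable {V} in
lemma tmul_mem_tensorSub {W : Submodule ℂ B} {b : B} (hb : b ∈ W) (v : V) :
    b ⊗ₜ v ∈ tensorSub V W :=
  Submodule.subset_span ⟨b, hb, v, rfl⟩

variable {V} in
lemma map_mem_of_mem_tensorSub {N : Type*} [AddCommGroup N] [Module ℂ N] {W : Submodule ℂ B}
    (f : B ⊗[ℂ] V →ₗ[ℂ] N) (W' : Submodule ℂ N) (h : ∀ b ∈ W, ∀ v, f (b ⊗ₜ v) ∈ W') {x}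
    (hx : x ∈ tensorSub V W) : f x ∈ W' := by
  have : tensorSub V W ≤ W'.comap f := by
    refine Submodule.span_le.2 ?_
    rintro _ ⟨b, hb, v, rfl⟩
    exact h b hb v
  exact this hx

lemma tensorSub_mono {W W' : Submodule ℂ B} (h : W ≤ W') : tensorSub V W ≤ tensorSub V W' :=
  fun _ hx => map_mem_of_mem_tensorSub LinearMap.id _
    (fun _ hb v => tmul_mem_tensorSub (h hb) v) hx

/-- The extension of operators from `B` to `B ⊗ V`. -/
noncomputable abbrev extend : Module.End ℂ B →ₐ[ℂ] Module.End ℂ (B ⊗[ℂ] V) :=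
  Module.End.rTensorAlgHom ℂ B V

lemma extend_mem {f : Module.End ℂ B} {W W' : Submodule ℂ B} (h : ∀ b ∈ W, f b ∈ W') (x)
    (hx : x ∈ tensorSub V W) : extend V f x ∈ tensorSub V W' :=
  map_mem_of_mem_tensorSub _ _ (fun b hb v => tmul_mem_tensorSub (h b hb) v) hx

lemma map_extend_mul (M P : Matrix (Fin n) (Fin n) (Module.End ℂ B)) :
    (M * P).map (extend V) = M.map (extend V) * P.map (extend V) := Matrix.map_mul

lemma map_extend_mul_apply (M P : Matrix (Fin n) (Fin n) (Module.End ℂ B)) (i j : Fin n) :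
    extend V ((M * P) i j) =
      (M.map (extend V) * P.map (extend V) : Matrix _ _ (Module.End ℂ (B ⊗[ℂ] V))) i j := by
  rw [← map_extend_mul]; rfl

lemma map_extend_opScalars (G : Matrix (Fin n) (Fin n) ℂ) :
    (opScalars B G).map (extend V) = opScalars (B ⊗[ℂ] V) G := map_scalars _ _

lemma map_extend_zero :
    (0 : Matrix (Fin n) (Fin n) (Module.End ℂ B)).map (extend V) = 0 := by
  ext i j : 1; simp

/-- A frame on `B` extends to `B ⊗ V`. -/
noncomputable def Frame.extend (Fr : Frame G H B) : Frame G H (B ⊗[ℂ] V) where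
  fil m := tensorSub V (Fr.fil m)
  fil_zero := by
    refine (Submodule.span_eq_bot).2 ?_
    rintro _ ⟨b, hb, v, rfl⟩
    rw [Fr.fil_zero, Submodule.mem_bot] at hb
    rw [hb, zero_tmul]
  fil_mono := fun _ _ h => tensorSub_mono V (Fr.fil_mono h)
  fil_exhaust := fun x => by
    induction x with
    | zero => exact ⟨0, zero_mem _⟩
    | tmul b v =>
      obtain ⟨m, hm⟩ := Fr.fil_exhaust b
      exact ⟨m, tmul_mem_tensorSub hm v⟩
    | add x y hx hy =>
      obtain ⟨m, hm⟩ := hx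
      obtain ⟨m', hm'⟩ := hy
      exact ⟨max m m', add_mem (tensorSub_mono V (Fr.fil_mono (le_max_left _ _)) hm)
        (tensorSub_mono V (Fr.fil_mono (le_max_right _ _)) hm')⟩
  X := Fr.X.map (BilinearForm.extend V)
  S₀ := Fr.S₀.map (BilinearForm.extend V)
  S₁ := Fr.S₁.map (BilinearForm.extend V)
  S₂ := Fr.S₂.map (BilinearForm.extend V)
  T := Fr.T.map (BilinearForm.extend V)
  ε := BilinearForm.extend V Fr.ε
  X_mem := fun i j m => extend_mem V (Fr.X_mem i j m)
  S₀_mem := fun i j m => extend_mem V (Fr.S₀_mem i j m)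
  S₁_mem := fun i j m => extend_mem V (Fr.S₁_mem i j m)
  S₂_mem := fun i j m => extend_mem V (Fr.S₂_mem i j m)
  T_mem := fun i j m => extend_mem V (Fr.T_mem i j m)
  ε_mem := fun x => by
    induction x with
    | zero => rw [map_zero]; exact zero_mem _
    | tmul b v => exact tmul_mem_tensorSub (Fr.ε_mem b) v
    | add x y hx hy => rw [map_add]; exact add_mem hx hy
  ε_X := fun i j => by
    rw [Matrix.map_apply, ← map_mul, Fr.ε_X, map_zero]
  rel_left := by
    rw [← Matrix.transpose_map, ← map_extend_opScalars, ← map_extend_mul, ← map_extend_mul,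
      Fr.rel_left, map_extend_zero]
  rel_right := by
    rw [← Matrix.transpose_map, ← map_extend_opScalars, ← map_extend_mul, ← map_extend_mul,
      Fr.rel_right, map_extend_zero]
  X_S₀ := by
    simp only [Matrix.map_apply, ← map_mul, ← map_sum, Fr.X_S₀, map_sub, map_one]
  S₀_X := fun a b c e => by
    have := congrArg (BilinearForm.extend V) (Fr.S₀_X a b c e)
    simp only [map_sub, map_add, map_mul, apply_ite (BilinearForm.extend V), map_zero, map_one,
      map_extend_mul_apply, map_extend_mul, map_extend_opScalars, Matrix.transpose_map] at this
    exact this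
  S₁_rel := by
    have := congrArg (Matrix.map · (BilinearForm.extend V)) Fr.S₁_rel
    simp only [Matrix.map_add _ (map_add _), map_extend_mul, map_extend_opScalars,
      Matrix.transpose_map, map_one_matrix] at this
    exact this
  S₂_rel := by
    have := congrArg (Matrix.map · (BilinearForm.extend V)) Fr.S₂_rel
    simp only [Matrix.map_add _ (map_add _), map_extend_mul, map_extend_opScalars,
      Matrix.transpose_map, map_one_matrix] at this
    exact this
  S₁_X := fun a e d l => by
    have := congrArg (BilinearForm.extend V) (Fr.S₁_X a e d l)
    simp only [map_mul, map_extend_mul_apply, map_extend_mul, map_extend_opScalars,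
      Matrix.transpose_map] at this
    exact this
  S₂_X := fun a e d l => by
    have := congrArg (BilinearForm.extend V) (Fr.S₂_X a e d l)
    simp only [map_mul, map_extend_mul_apply, map_extend_mul, map_extend_opScalars,
      Matrix.transpose_map] at this
    exact this
  T_rel := by
    have := congrArg (BilinearForm.extend V) Fr.T_rel
    simp only [map_sum, map_mul, map_extend_mul_apply, map_extend_mul, map_extend_opScalars,
      map_one] at this
    exact this

end Extend

end BilinearForm

/-! ### The differentials of the length three complex -/

namespace BilinearForm

open Matrix

section Differentials

variable {n : ℕ} {S N : Type*} [Ring S] [AddCommGroup N] [Module S N]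

/-- A matrix of operators on `N` acts on matrices with entries in `N`. -/
def act (M : Matrix (Fin n) (Fin n) (Module.End S N)) :
    Matrix (Fin n) (Fin n) N →ₗ[S] Matrix (Fin n) (Fin n) N where
  toFun z := of fun i j => ∑ k, M i k (z k j)
  map_add' y z := by ext i j; simp [Finset.sum_add_distrib]
  map_smul' c z := by ext i j; simp [Finset.smul_sum]

lemma act_apply (M : Matrix (Fin n) (Fin n) (Module.End S N)) (z : Matrix (Fin n) (Fin n) N)
    (i j : Fin n) : act M z i j = ∑ k, M i k (z k j) := rfl

lemma act_mul (M P : Matrix (Fin n) (Fin n) (Module.End S N)) (z : Matrix (Fin n) (Fin n) N) :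
    act (M * P) z = act M (act P z) := by
  ext i j
  simp only [act_apply, Matrix.mul_apply, LinearMap.sum_apply, map_sum, Module.End.mul_apply]
  exact Finset.sum_comm

lemma act_one (z : Matrix (Fin n) (Fin n) N) :
    act (1 : Matrix (Fin n) (Fin n) (Module.End S N)) z = z := by
  ext i j
  rw [act_apply, Finset.sum_eq_single i]
  · simp
  · intro k _ hk; simp [Matrix.one_apply_ne hk.symm]
  · simp

lemma act_sub (M P : Matrix (Fin n) (Fin n) (Module.End S N)) (z : Matrix (Fin n) (Fin n) N) :
    act (M - P) z = act M z - act P z := by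
  ext i j
  simp [act_apply, Finset.sum_sub_distrib]

/-- Commuting matrices of operators act on rows and columns independently. -/
lemma act_transpose_comm {M P : Matrix (Fin n) (Fin n) (Module.End S N)}
    (h : ∀ i j k l, Commute (M i j) (P k l)) (z : Matrix (Fin n) (Fin n) N) :
    act M (act P z)ᵀ = (act P (act M zᵀ)ᵀ)ᵀ := by
  ext i j
  simp only [act_apply, Matrix.transpose_apply, map_sum]
  rw [Finset.sum_comm]
  exact Finset.sum_congr rfl fun k _ => Finset.sum_congr rfl fun l _ =>
    LinearMap.congr_fun (h i l j k) (z k l)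

/-- The first differential `z ↦ ∑ D_kl z_kl`. -/
def total (D : Matrix (Fin n) (Fin n) (Module.End S N)) : Matrix (Fin n) (Fin n) N →ₗ[S] N where
  toFun z := ∑ k, ∑ l, D k l (z k l)
  map_add' y z := by simp [Finset.sum_add_distrib]
  map_smul' c z := by simp [Finset.smul_sum]

lemma total_apply (D : Matrix (Fin n) (Fin n) (Module.End S N)) (z : Matrix (Fin n) (Fin n) N) :
    total D z = ∑ k, ∑ l, D k l (z k l) := rfl

/-- The second differential. -/
def diff₂ (P R : Matrix (Fin n) (Fin n) (Module.End S N)) :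
    Matrix (Fin n) (Fin n) N →ₗ[S] Matrix (Fin n) (Fin n) N where
  toFun y := act P y + act R yᵀ
  map_add' y z := by rw [transpose_add, map_add, map_add]; abel
  map_smul' c z := by rw [transpose_smul, map_smul, map_smul, smul_add]; rfl

lemma diff₂_apply (P R : Matrix (Fin n) (Fin n) (Module.End S N)) (y : Matrix (Fin n) (Fin n) N) :
    diff₂ P R y = act P y + act R yᵀ := rfl

/-- The change of variables that expresses the second family of relations by the first one. -/
def convert (Q T : Matrix (Fin n) (Fin n) (Module.End S N)) :
    Matrix (Fin n) (Fin n) N →ₗ[S] Matrix (Fin n) (Fin n) N where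
  toFun y := act Q (act T yᵀ)ᵀ
  map_add' y z := by rw [transpose_add, map_add, transpose_add, map_add]
  map_smul' c z := by rw [transpose_smul, map_smul, transpose_smul, map_smul]; rfl

lemma convert_apply (Q T : Matrix (Fin n) (Fin n) (Module.End S N))
    (y : Matrix (Fin n) (Fin n) N) : convert Q T y = act Q (act T yᵀ)ᵀ := rfl

/-- For $Q=HU^t$ and $T=H^tL^t$ the right side is the linearisation of the second family of
relations. So that family already lies in the image of `diff₂`, and one copy of the matrices is
enough in degree two. -/
lemma diff₂_convert {P Q R T : Matrix (Fin n) (Fin n) (Module.End S N)} (hPQ : P * Q = 1)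
    (hRT : R * T = 1) (hRQ : ∀ i j k l, Commute (R i j) (Q k l)) (y : Matrix (Fin n) (Fin n) N) :
    diff₂ P R (convert Q T y) = (act T yᵀ)ᵀ + (act Q y)ᵀ := by
  rw [diff₂_apply, convert_apply, ← act_mul, hPQ, act_one, act_transpose_comm hRQ,
    transpose_transpose, ← act_mul, hRT, act_one, transpose_transpose]

variable {S' N' : Type*} [Ring S'] [AddCommGroup N'] [Module S' N'] (φ : N →+ N')

lemma map_act {M : Matrix (Fin n) (Fin n) (Module.End S N)}
    {M' : Matrix (Fin n) (Fin n) (Module.End S' N')}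
    (h : ∀ i j x, φ (M i j x) = M' i j (φ x)) (z : Matrix (Fin n) (Fin n) N) :
    (act M z).map φ = act M' (z.map φ) := by
  ext i j
  simp [act_apply, h]

lemma map_total {M : Matrix (Fin n) (Fin n) (Module.End S N)}
    {M' : Matrix (Fin n) (Fin n) (Module.End S' N')}
    (h : ∀ i j x, φ (M i j x) = M' i j (φ x)) (z : Matrix (Fin n) (Fin n) N) :
    φ (total M z) = total M' (z.map φ) := by
  simp [total_apply, h]

lemma map_diff₂ {P R : Matrix (Fin n) (Fin n) (Module.End S N)}
    {P' R' : Matrix (Fin n) (Fin n) (Module.End S' N')}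
    (hP : ∀ i j x, φ (P i j x) = P' i j (φ x)) (hR : ∀ i j x, φ (R i j x) = R' i j (φ x))
    (z : Matrix (Fin n) (Fin n) N) : (diff₂ P R z).map φ = diff₂ P' R' (z.map φ) := by
  rw [diff₂_apply, diff₂_apply, Matrix.map_add _ (map_add φ), map_act φ hP, map_act φ hR,
    Matrix.transpose_map]

lemma map_convert {Q T : Matrix (Fin n) (Fin n) (Module.End S N)}
    {Q' T' : Matrix (Fin n) (Fin n) (Module.End S' N')}
    (hQ : ∀ i j x, φ (Q i j x) = Q' i j (φ x)) (hT : ∀ i j x, φ (T i j x) = T' i j (φ x))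
    (z : Matrix (Fin n) (Fin n) N) : (convert Q T z).map φ = convert Q' T' (z.map φ) := by
  rw [convert_apply, convert_apply, map_act φ hQ, Matrix.transpose_map, map_act φ hT,
    Matrix.transpose_map]

variable [Module ℂ N] [SMulCommClass S ℂ N]

/-- The matrix with entries `E_ij w`. -/
def spread (E : Matrix (Fin n) (Fin n) ℂ) : N →ₗ[S] Matrix (Fin n) (Fin n) N where
  toFun w := of fun i j => E i j • w
  map_add' y z := by ext i j; simp
  map_smul' c z := by ext i j; simp [smul_comm]

lemma spread_apply (E : Matrix (Fin n) (Fin n) ℂ) (w : N) (i j : Fin n) :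
    spread (S := S) E w i j = E i j • w := rfl

/-- The third differential. -/
def diff₃ (E F : Matrix (Fin n) (Fin n) ℂ) (Q T : Matrix (Fin n) (Fin n) (Module.End S N)) :
    N →ₗ[S] Matrix (Fin n) (Fin n) N :=
  spread F - convert Q T ∘ₗ spread E

lemma diff₃_apply (E F : Matrix (Fin n) (Fin n) ℂ)
    (Q T : Matrix (Fin n) (Fin n) (Module.End S N)) (w : N) :
    diff₃ E F Q T w = spread (S := S) F w - convert Q T (spread (S := S) E w) := rfl

lemma map_diff₃ [Module ℂ N'] [SMulCommClass S' ℂ N'] (hφ : ∀ (c : ℂ) x, φ (c • x) = c • φ x)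
    (E F : Matrix (Fin n) (Fin n) ℂ) {Q T : Matrix (Fin n) (Fin n) (Module.End S N)}
    {Q' T' : Matrix (Fin n) (Fin n) (Module.End S' N')}
    (hQ : ∀ i j x, φ (Q i j x) = Q' i j (φ x)) (hT : ∀ i j x, φ (T i j x) = T' i j (φ x))
    (w : N) : (diff₃ E F Q T w).map φ = diff₃ E F Q' T' (φ w) := by
  have hs : ∀ E : Matrix (Fin n) (Fin n) ℂ,
      (spread (S := S) E w).map φ = spread (S := S') E (φ w) := fun E => by
    ext i j
    simp [spread_apply, hφ]
  rw [diff₃_apply, diff₃_apply, Matrix.map_sub _ (map_sub φ), map_convert φ hQ hT, hs, hs]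

end Differentials

section Operators

variable {n : ℕ} {N : Type*} [AddCommGroup N] [Module ℂ N]

lemma act_opScalars_spread (G E : Matrix (Fin n) (Fin n) ℂ) (w : N) :
    act (opScalars N G) (spread (S := ℂ) E w) = spread (S := ℂ) (G * E) w := by
  ext i j
  simp [act_apply, spread_apply, opScalars_apply_apply, Matrix.mul_apply, Finset.sum_smul, smul_smul,
    mul_comm]

/-- Entry $(i,j)$ of both sides is $\sum A_{ik}K_{lj}M_{kl}w$, read once by rows and once by
columns. In $d_2d_3$ this makes the four terms cancel in pairs. -/
lemma act_spread_transpose (M : Matrix (Fin n) (Fin n) (Module.End ℂ N))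
    (A K : Matrix (Fin n) (Fin n) ℂ) (w : N) :
    act (opScalars N A * M) (spread (S := ℂ) K w) =
      (act (opScalars N Kᵀ * Mᵀ) (spread (S := ℂ) Aᵀ w))ᵀ := by
  ext i j
  simp only [act_apply, transpose_apply, spread_apply, Matrix.mul_apply, LinearMap.sum_apply,
    Module.End.mul_apply, map_smul, opScalars_apply_apply, Finset.smul_sum]
  rw [Finset.sum_comm]
  exact Finset.sum_congr rfl fun k _ => Finset.sum_congr rfl fun l _ => smul_comm _ _ _

variable {G H : Matrix (Fin n) (Fin n) ℂ} {U L : Matrix (Fin n) (Fin n) (Module.End ℂ N)}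

/-- `d₁ d₂ = 0`. -/
lemma total_diff₂ (hU : Uᵀ * opScalars N G * U = opScalars N G)
    (hL : Lᵀ * opScalars N Gᵀ * L = opScalars N Gᵀ) (hUL : ∀ i j k l, Commute (U i j) (L k l))
    (y : Matrix (Fin n) (Fin n) N) :
    total (U - L) (diff₂ (opScalars N G * U) (opScalars N Gᵀ * L) y) = 0 := by
  -- The unmixed terms are traces of $V^tKM$ acting on $z$, which the relation turns into the scalar
  -- matrix $K$. The two of them cancel because one uses $G$ with $y$ and the other $G^t$ with
  -- $y^t$.
  have h1 : ∀ (V M : Matrix (Fin n) (Fin n) (Module.End ℂ N)) (K : Matrix (Fin n) (Fin n) ℂ)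
      (z : Matrix (Fin n) (Fin n) N), Vᵀ * opScalars N K * M = opScalars N K →
      total V (act (opScalars N K * M) z) = ∑ i, ∑ j, K i j • z j i := by
    intro V M K z h
    have : total V (act (opScalars N K * M) z) =
        ∑ i, act (Vᵀ * opScalars N K * M) z i i := by
      rw [Matrix.mul_assoc, total_apply, Finset.sum_comm]
      exact Finset.sum_congr rfl fun i _ => by rw [act_mul Vᵀ]; rfl
    rw [this, h]
    simp [act_apply, opScalars_apply_apply]
  -- The mixed terms agree because $U$ and $L$ commute entrywise; what follows only reorders the
  -- four sums.
  have h2 : total U (act (opScalars N Gᵀ * L) yᵀ) = total L (act (opScalars N G * U) y) := by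
    simp only [total_apply, act_apply, opScalars_mul_apply, LinearMap.sum_apply, map_sum,
      LinearMap.smul_apply, map_smul, transpose_apply]
    calc ∑ p, ∑ q, ∑ j, ∑ l, G l p • U p q (L l j (y q j))
        = ∑ p, ∑ q, ∑ l, ∑ j, G l p • U p q (L l j (y q j)) :=
          Finset.sum_congr rfl fun p _ => Finset.sum_congr rfl fun q _ => Finset.sum_comm
      _ = ∑ p, ∑ l, ∑ q, ∑ j, G l p • U p q (L l j (y q j)) :=
          Finset.sum_congr rfl fun p _ => Finset.sum_comm
      _ = ∑ l, ∑ p, ∑ q, ∑ j, G l p • U p q (L l j (y q j)) := Finset.sum_comm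
      _ = ∑ l, ∑ p, ∑ j, ∑ q, G l p • L l j (U p q (y q j)) :=
          Finset.sum_congr rfl fun l _ => Finset.sum_congr rfl fun p _ => by
            rw [Finset.sum_comm]
            exact Finset.sum_congr rfl fun j _ => Finset.sum_congr rfl fun q _ =>
              congrArg _ (LinearMap.congr_fun (hUL p q l j) (y q j))
      _ = ∑ l, ∑ j, ∑ p, ∑ q, G l p • L l j (U p q (y q j)) :=
          Finset.sum_congr rfl fun l _ => Finset.sum_comm
      _ = ∑ l, ∑ j, ∑ q, ∑ p, G l p • L l j (U p q (y q j)) :=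
          Finset.sum_congr rfl fun l _ => Finset.sum_congr rfl fun j _ => Finset.sum_comm
  have h3 : ∀ z, total (U - L) z = total U z - total L z := fun z => by
    simp [total_apply, Finset.sum_sub_distrib]
  rw [diff₂_apply, map_add, h3, h3, h2, h1 _ _ _ _ hU, h1 _ _ _ _ hL]
  simp only [transpose_apply]
  rw [Finset.sum_comm]
  abel

/-- `d₂ d₃ = 0`. -/
lemma diff₂_diff₃ (hPQ : (opScalars N G * U) * (opScalars N H * Uᵀ) = 1)
    (hRT : (opScalars N Gᵀ * L) * (opScalars N Hᵀ * Lᵀ) = 1)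
    (hUL : ∀ i j k l, Commute ((opScalars N Gᵀ * L) i j) ((opScalars N H * Uᵀ) k l)) (w : N) :
    diff₂ (opScalars N G * U) (opScalars N Gᵀ * L)
      (diff₃ Gᵀ Hᵀ (opScalars N H * Uᵀ) (opScalars N Hᵀ * Lᵀ) w) = 0 := by
  have hs : ∀ K : Matrix (Fin n) (Fin n) ℂ, (spread (S := ℂ) K w)ᵀ = spread (S := ℂ) Kᵀ w :=
    fun K => rfl
  rw [diff₃_apply, map_sub, diff₂_convert hPQ hRT hUL, diff₂_apply, hs, hs,
    act_spread_transpose U G Hᵀ, act_spread_transpose L Gᵀ Hᵀᵀ]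
  simp only [transpose_transpose]
  abel

end Operators

end BilinearForm

/-! ### Exactness by induction on the filtration -/

namespace BilinearForm

open Matrix

section MatrixFiltration

variable {n : ℕ} {N : Type*} [AddCommGroup N] [Module ℂ N]

/-- The matrices with entries in a subspace. -/
def entries (W : Submodule ℂ N) : Submodule ℂ (Matrix (Fin n) (Fin n) N) where
  carrier := {z | ∀ i j, z i j ∈ W}
  add_mem' hy hz i j := add_mem (hy i j) (hz i j)
  zero_mem' _ _ := zero_mem W
  smul_mem' c _ hz i j := W.smul_mem c (hz i j)

lemma transpose_mem_entries {W : Submodule ℂ N} {z : Matrix (Fin n) (Fin n) N}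
    (hz : z ∈ entries W) : zᵀ ∈ entries W := fun i j => hz j i

lemma act_mem_entries {W W' : Submodule ℂ N} {M : Matrix (Fin n) (Fin n) (Module.End ℂ N)}
    (hM : ∀ i j, ∀ x ∈ W, M i j x ∈ W') {z : Matrix (Fin n) (Fin n) N} (hz : z ∈ entries W) :
    act M z ∈ entries W' := fun i j => by
  rw [act_apply]
  exact sum_mem fun k _ => hM i k _ (hz k j)

lemma total_mem {W W' : Submodule ℂ N} {M : Matrix (Fin n) (Fin n) (Module.End ℂ N)}
    (hM : ∀ i j, ∀ x ∈ W, M i j x ∈ W') {z : Matrix (Fin n) (Fin n) N} (hz : z ∈ entries W) :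
    total M z ∈ W' := by
  rw [total_apply]
  exact sum_mem fun i _ => sum_mem fun j _ => hM i j _ (hz i j)

lemma mem_of_opScalars_mul {W W' : Submodule ℂ N} (G : Matrix (Fin n) (Fin n) ℂ)
    {M : Matrix (Fin n) (Fin n) (Module.End ℂ N)} (hM : ∀ i j, ∀ x ∈ W, M i j x ∈ W') (i j : Fin n)
    (x : N) (hx : x ∈ W) : (opScalars N G * M) i j x ∈ W' := by
  rw [opScalars_mul_apply, LinearMap.sum_apply]
  exact sum_mem fun k _ => W'.smul_mem _ (hM _ _ _ hx)

lemma spread_mem_entries {W : Submodule ℂ N} (G : Matrix (Fin n) (Fin n) ℂ) {w : N} (hw : w ∈ W) :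
    spread (S := ℂ) G w ∈ entries W := fun _ _ => W.smul_mem _ hw

end MatrixFiltration

namespace Frame

variable {n : ℕ} {G H : Matrix (Fin n) (Fin n) ℂ} {N : Type*} [AddCommGroup N] [Module ℂ N]
  (Fr : Frame G H N)

lemma exists_mem_entries (z : Matrix (Fin n) (Fin n) N) : ∃ m, z ∈ entries (Fr.fil m) := by
  choose m hm using fun i j => Fr.fil_exhaust (z i j)
  refine ⟨∑ i, ∑ j, m i j, fun i j => Fr.fil_mono ?_ (hm i j)⟩
  exact (Finset.single_le_sum (f := fun j => m i j) (fun _ _ => Nat.zero_le _)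
    (Finset.mem_univ j)).trans (Finset.single_le_sum (f := fun i => ∑ j, m i j)
    (fun _ _ => Nat.zero_le _) (Finset.mem_univ i))

lemma entries_zero {z : Matrix (Fin n) (Fin n) N} (hz : z ∈ entries (Fr.fil 0)) : z = 0 := by
  ext i j
  have := hz i j
  rwa [Fr.fil_zero, Submodule.mem_bot] at this

/-- The contraction of a matrix against `Tᵀ G X`. -/
noncomputable def contraction (y : Matrix (Fin n) (Fin n) N) : N :=
  total Fr.T (act (opScalars N G * Fr.X) y)

lemma contraction_eq (y : Matrix (Fin n) (Fin n) N) :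
    Fr.contraction y = ∑ b, ∑ d, (Fr.Tᵀ * opScalars N G * Fr.X) b d (y d b) := by
  have : Fr.contraction y = ∑ b, act (Fr.Tᵀ * (opScalars N G * Fr.X)) y b b := by
    rw [contraction, total_apply, Finset.sum_comm]
    exact Finset.sum_congr rfl fun i _ => by rw [act_mul Fr.Tᵀ]; rfl
  rw [this, Matrix.mul_assoc]
  rfl

lemma contraction_mem {y : Matrix (Fin n) (Fin n) N} {m : ℕ} (hy : y ∈ entries (Fr.fil m)) :
    Fr.contraction y ∈ Fr.fil m :=
  total_mem (fun _ _ => Fr.T_mem _ _ _)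
    (act_mem_entries (mem_of_opScalars_mul G fun _ _ _ h => Fr.X_mem _ _ _ _ h) hy)

lemma total_T_mem {y : Matrix (Fin n) (Fin n) N} {m : ℕ} (hy : y ∈ entries (Fr.fil (m + 1))) :
    total Fr.T y ∈ Fr.fil m :=
  total_mem (fun _ _ => Fr.T_mem _ _ _) hy

/-- The identity `T_rel` read on the leading part of the last differential: $T$ recovers $w$ from
it. -/
lemma total_T_spread (w : N) :
    total Fr.T (act (opScalars N G * Fr.X) (spread (S := ℂ) Hᵀ w)) = w := by
  have := LinearMap.congr_fun Fr.T_rel w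
  rw [Module.End.one_apply] at this
  refine Eq.trans ?_ this
  simp only [total_apply, LinearMap.sum_apply]
  refine Finset.sum_congr rfl fun a _ => Finset.sum_congr rfl fun b _ => ?_
  rw [Module.End.mul_apply, mul_apply_apply]
  simp only [act_apply, spread_apply, opScalars_apply_apply]

lemma total_T_transpose (y : Matrix (Fin n) (Fin n) N) :
    total Fr.T (act (opScalars N H * Fr.Xᵀ) y)ᵀ = Fr.swap.contraction y := by
  rw [contraction, total_apply, total_apply, Finset.sum_comm]
  rfl

/-- By `S₁_X` the two Segre factors separate, and $y$ enters only through its contraction. Hence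
solving the degree two symbol equation for one unknown involves the other only through a single
element of $N$. -/
lemma act_S₁_transpose (y : Matrix (Fin n) (Fin n) N) :
    act Fr.S₁ᵀ (act (opScalars N H * Fr.Xᵀ) y)ᵀ =
      act (Fr.S₁ᵀ * opScalars N G * Fr.X) (spread (S := ℂ) Hᵀ (Fr.swap.contraction y)) := by
  have hS : ∀ a e b d, Fr.S₁ a e * (opScalars N H * Fr.Xᵀ) b d =
      ∑ k, H b k • ((Fr.S₁ᵀ * opScalars N G * Fr.X) e k *
        (Fr.T * opScalars N H * Fr.Xᵀ) a d) := fun a e b d => by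
    rw [opScalars_mul_apply, Finset.mul_sum]
    exact Finset.sum_congr rfl fun k _ => by rw [mul_smul_comm, transpose_apply, Fr.S₁_X]
  ext e b
  simp only [act_apply, transpose_apply, spread_apply, map_sum]
  have : ∀ a d, Fr.S₁ a e ((opScalars N H * Fr.Xᵀ) b d (y d a)) =
      ∑ k, H b k • (Fr.S₁ᵀ * opScalars N G * Fr.X) e k
        ((Fr.T * opScalars N H * Fr.Xᵀ) a d (y d a)) := fun a d => by
    have := LinearMap.congr_fun (hS a e b d) (y d a)
    rw [LinearMap.sum_apply] at this
    exact this
  simp only [this]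
  have hc : Fr.swap.contraction y = ∑ a, ∑ d, (Fr.T * opScalars N H * Fr.Xᵀ) a d (y d a) :=
    Fr.swap.contraction_eq y
  rw [hc]
  simp only [map_sum, map_smul, Finset.smul_sum]
  calc ∑ a, ∑ d, ∑ k, _ = ∑ a, ∑ k, ∑ d, _ := Finset.sum_congr rfl fun a _ => Finset.sum_comm
    _ = _ := Finset.sum_comm

/-- Solutions of the symbol equation in degree two, up to lower order terms. -/
lemma sub_act_mem {y y' : Matrix (Fin n) (Fin n) N} {m : ℕ}
    (h : act (opScalars N G * Fr.X) y + (act (opScalars N H * Fr.Xᵀ) y')ᵀ ∈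
      entries (Fr.fil (m + 1))) :
    y + spread (S := ℂ) Hᵀ (Fr.swap.contraction y') - act (opScalars N H * Fr.Xᵀ)
      (act Fr.S₂ (y + spread (S := ℂ) Hᵀ (Fr.swap.contraction y'))) ∈ entries (Fr.fil m) := by
  have h1 : act Fr.S₁ᵀ (act (opScalars N G * Fr.X) y + (act (opScalars N H * Fr.Xᵀ) y')ᵀ) ∈
      entries (Fr.fil m) := act_mem_entries (fun _ _ => Fr.S₁_mem _ _ _) h
  rw [map_add, act_S₁_transpose, ← act_mul, ← Matrix.mul_assoc, ← map_add] at h1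
  have h2 : Fr.S₁ᵀ * opScalars N G * Fr.X = 1 - opScalars N H * Fr.Xᵀ * Fr.S₂ :=
    eq_sub_of_add_eq Fr.S₁_rel
  rwa [h2, act_sub, act_one, act_mul] at h1

/-- Applying $T$ to the symbol equation shows that the contractions of the two unknowns are opposite
up to lower order. Both describe the same candidate for the preimage under $d_3$. -/
lemma contraction_add_mem {y y' : Matrix (Fin n) (Fin n) N} {m : ℕ}
    (h : act (opScalars N G * Fr.X) y + (act (opScalars N H * Fr.Xᵀ) y')ᵀ ∈
      entries (Fr.fil (m + 1))) :
    Fr.contraction y + Fr.swap.contraction y' ∈ Fr.fil m := by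
  have := Fr.total_T_mem h
  rwa [map_add, total_T_transpose] at this

section Exact

variable {θ U L R T : Matrix (Fin n) (Fin n) (Module.End ℂ N)} (hθ : Fr.Lowers θ)
  (hU : U = Fr.X + θ) (hL : ∀ i j m, ∀ b ∈ Fr.fil m, L i j b ∈ Fr.fil m)
  (hR : ∀ i j m, ∀ b ∈ Fr.fil m, R i j b ∈ Fr.fil m)
  (hT : ∀ i j m, ∀ b ∈ Fr.fil m, T i j b ∈ Fr.fil m)

include hθ hU in
lemma act_sub_act_mem {z : Matrix (Fin n) (Fin n) N} {m : ℕ} (hz : z ∈ entries (Fr.fil m)) :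
    act (opScalars N G * U) z - act (opScalars N G * Fr.X) z ∈ entries (Fr.fil m) := by
  rw [← act_sub, ← Matrix.mul_sub, hU, add_sub_cancel_left]
  exact act_mem_entries (mem_of_opScalars_mul G fun _ _ _ hx => Fr.mem_of_lowers hθ hx) hz

include hθ hU hL in
/-- Exactness in degree zero. -/
theorem exists_total (b : N) : ∃ z c, b = total (U - L) z + Fr.ε c := by
  obtain ⟨m, hm⟩ := Fr.fil_exhaust b
  induction m generalizing b with
  | zero =>
    rw [Fr.fil_zero, Submodule.mem_bot] at hm
    exact ⟨0, 0, by simp [hm]⟩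
  | succ m ih =>
    -- The leading part $X$ sends $S_0b$ to $b-\varepsilon b$; the error $(L-\theta)S_0b$ lies one
    -- step lower because $L$ preserves the filtration.
    let z : Matrix (Fin n) (Fin n) N := of fun i j => Fr.S₀ i j b
    have hX : total Fr.X z = b - Fr.ε b := by
      have := LinearMap.congr_fun Fr.X_S₀ b
      simp only [LinearMap.sum_apply] at this
      exact this
    have hz : ∀ i j, z i j ∈ Fr.fil m := fun i j => Fr.S₀_mem i j m b hm
    have hlow : total (L - θ) z ∈ Fr.fil m := total_mem (fun i j x hx =>
      sub_mem (hL _ _ _ _ hx) (Fr.mem_of_lowers hθ hx)) hz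
    obtain ⟨z', c, h⟩ := ih _ hlow
    refine ⟨z + z', b + c, ?_⟩
    have hsum : total (U - L) z = total Fr.X z - total (L - θ) z := by
      simp only [total_apply, ← Finset.sum_sub_distrib]
      refine Finset.sum_congr rfl fun i _ => Finset.sum_congr rfl fun j _ => ?_
      rw [hU]
      simp only [Matrix.sub_apply, Matrix.add_apply, LinearMap.sub_apply, LinearMap.add_apply]
      abel
    rw [map_add, map_add, hsum, hX, h]
    abel

/-- This is `S₀_X` applied to the entries of $z$ and summed, that is, the homotopy identity in
degree one: $z$ is a lift of its image plus leading parts of both families of relations. -/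
lemma symbol_decomposition (z : Matrix (Fin n) (Fin n) N) :
    z = of (fun a b => Fr.S₀ a b (total Fr.X z)) +
      (act (opScalars N G * Fr.X) (act Fr.S₁ᵀ z - spread (S := ℂ) Hᵀ (total Fr.T z)) +
        (act (opScalars N H * Fr.Xᵀ) (act Fr.S₂ zᵀ))ᵀ) := by
  ext a b
  have h := fun c e => LinearMap.congr_fun (Fr.S₀_X a b c e) (z c e)
  have h1 : ∀ c e, (if a = c ∧ b = e then (1 : Module.End ℂ N) else 0) (z c e) =
      if a = c then (if b = e then z c e else 0) else 0 := fun c e => by split_ifs <;> simp_all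
  have h2 : ∀ c e, (if b = e then (opScalars N G * Fr.X * Fr.S₁ᵀ) a c else 0) (z c e) =
      if b = e then (opScalars N G * Fr.X * Fr.S₁ᵀ) a c (z c e) else 0 := fun c e => by
    split_ifs <;> rfl
  have h3 : ∀ c e, (if a = c then (opScalars N H * Fr.Xᵀ * Fr.S₂) b e else 0) (z c e) =
      if a = c then (opScalars N H * Fr.Xᵀ * Fr.S₂) b e (z c e) else 0 := fun c e => by
    split_ifs <;> rfl
  simp only [LinearMap.sub_apply, LinearMap.add_apply, h1, h2, h3] at h
  have h' := Finset.sum_congr (rfl : (Finset.univ : Finset (Fin n)) = Finset.univ) fun c _ =>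
    Finset.sum_congr (rfl : (Finset.univ : Finset (Fin n)) = Finset.univ) fun e _ => h c e
  have e3 : ∑ c, ∑ e, (if a = c then (opScalars N H * Fr.Xᵀ * Fr.S₂) b e (z c e) else 0) =
      (act (opScalars N H * Fr.Xᵀ) (act Fr.S₂ zᵀ))ᵀ a b := by
    rw [← act_mul, transpose_apply, act_apply, Finset.sum_comm]
    exact Finset.sum_congr rfl fun e _ => by
      rw [Finset.sum_ite_eq, if_pos (Finset.mem_univ _)]; rfl
  have e2 : ∑ c, ∑ e, (if b = e then (opScalars N G * Fr.X * Fr.S₁ᵀ) a c (z c e) else 0) =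
      act (opScalars N G * Fr.X) (act Fr.S₁ᵀ z) a b := by
    rw [← act_mul, act_apply]
    exact Finset.sum_congr rfl fun c _ => by
      rw [Finset.sum_ite_eq, if_pos (Finset.mem_univ _)]
  have e1 : ∑ c, ∑ e, (if a = c then (if b = e then z c e else 0) else 0) = z a b := by
    rw [Finset.sum_eq_single a (fun c _ hc => by simp [Ne.symm hc]) (by simp)]
    simp
  have e4 : ∑ c, ∑ e, (Fr.S₀ a b * Fr.X c e) (z c e) = Fr.S₀ a b (total Fr.X z) := by
    simp only [total_apply, map_sum, Module.End.mul_apply]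
  have e5 : ∑ c, ∑ e, ((opScalars N G * Fr.X * opScalars N Hᵀ) a b * Fr.T c e) (z c e) =
      act (opScalars N G * Fr.X) (spread (S := ℂ) Hᵀ (total Fr.T z)) a b := by
    have : act (opScalars N G * Fr.X) (spread (S := ℂ) Hᵀ (total Fr.T z)) a b =
        (opScalars N G * Fr.X * opScalars N Hᵀ) a b (total Fr.T z) := by
      rw [mul_apply_apply _ (opScalars N Hᵀ)]
      simp only [opScalars_apply_apply]
      rfl
    rw [this, total_apply]
    simp only [map_sum, Module.End.mul_apply]
  simp only [Finset.sum_sub_distrib, Finset.sum_add_distrib, e1, e2, e3, e4, e5] at h'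
  rw [Matrix.add_apply, Matrix.add_apply, map_sub, Matrix.sub_apply, of_apply, ← h']
  abel

include hθ hU hL hR hT in
/-- Exactness in degree one. -/
theorem exists_diff₂ {Q : Matrix (Fin n) (Fin n) (Module.End ℂ N)} (hQ : Q = opScalars N H * Uᵀ)
    (hd : ∀ y, total (U - L) (diff₂ (opScalars N G * U) R y) = 0)
    (hconv : ∀ y, diff₂ (opScalars N G * U) R (convert Q T y) = (act T yᵀ)ᵀ + (act Q y)ᵀ)
    (z : Matrix (Fin n) (Fin n) N) (hz : total (U - L) z = 0) :
    ∃ y, diff₂ (opScalars N G * U) R y = z := by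
  obtain ⟨m, hm⟩ := Fr.exists_mem_entries z
  induction m generalizing z with
  | zero =>
    exact ⟨0, by rw [map_zero, Fr.entries_zero hm]⟩
  | succ m ih =>
    -- For a cycle the leading term equals a term that does not raise the filtration, so its lift by
    -- $S_0$ is one step lower.
    have hX : total Fr.X z = total (L - θ) z := by
      rw [← sub_eq_zero, ← hz]
      simp only [total_apply, ← Finset.sum_sub_distrib, hU]
      refine Finset.sum_congr rfl fun i _ => Finset.sum_congr rfl fun j _ => ?_
      simp only [Matrix.sub_apply, Matrix.add_apply, LinearMap.sub_apply, LinearMap.add_apply]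
      abel
    set p := act Fr.S₁ᵀ z - spread (S := ℂ) Hᵀ (total Fr.T z) with hp
    set p' := act Fr.S₂ zᵀ with hp'
    have hpm : p ∈ entries (Fr.fil m) :=
      sub_mem (act_mem_entries (fun _ _ => Fr.S₁_mem _ _ _) hm)
        (spread_mem_entries _ (Fr.total_T_mem hm))
    have hpm' : p' ∈ entries (Fr.fil m) :=
      act_mem_entries (fun _ _ => Fr.S₂_mem _ _ _) (transpose_mem_entries hm)
    have hdec := Fr.symbol_decomposition z
    rw [hX, ← hp, ← hp'] at hdec
    clear_value p p'
    have h0 : of (fun a b => Fr.S₀ a b (total (L - θ) z)) ∈ entries (Fr.fil m) := fun a b =>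
      Fr.S₀_mem _ _ _ _ (total_mem (fun i j x hx =>
        sub_mem (hL _ _ _ _ hx) (Fr.mem_of_lowers hθ hx)) hm)
    have h1 := Fr.act_sub_act_mem hθ hU hpm
    have h2 := Fr.swap.act_sub_act_mem (U := Uᵀ) (Fr.lowers_swap hθ)
      (by rw [hU, transpose_add]; rfl) hpm'
    -- The matrices $p$ and $p'$ are already one step lower, so replacing leading parts by the true
    -- differentials costs only terms in `fil m`.
    have hlow : z - diff₂ (opScalars N G * U) R (p + convert Q T p') ∈ entries (Fr.fil m) := by
      rw [map_add, hconv, diff₂_apply, hQ]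
      have : z - (act (opScalars N G * U) p + act R pᵀ +
          ((act T p'ᵀ)ᵀ + (act (opScalars N H * Uᵀ) p')ᵀ)) =
          of (fun a b => Fr.S₀ a b (total (L - θ) z))
          - (act (opScalars N G * U) p - act (opScalars N G * Fr.X) p)
          - (act (opScalars N H * Uᵀ) p' - act (opScalars N H * Fr.Xᵀ) p')ᵀ
          - act R pᵀ - (act T p'ᵀ)ᵀ := by
        nth_rewrite 1 [hdec]
        rw [transpose_sub]
        abel
      rw [this]
      exact sub_mem (sub_mem (sub_mem (sub_mem h0 h1) (transpose_mem_entries h2))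
        (act_mem_entries (fun _ _ => hR _ _ _) (transpose_mem_entries hpm)))
        (transpose_mem_entries
          (act_mem_entries (fun _ _ => hT _ _ _) (transpose_mem_entries hpm')))
    obtain ⟨y, hy⟩ := ih _ (by rw [map_sub, hz, hd, sub_zero]) hlow
    exact ⟨y + (p + convert Q T p'), by rw [map_add, hy, sub_add_cancel]⟩

include hθ hU hR hT in
/-- Exactness in degree two. -/
theorem exists_diff₃ {P Q : Matrix (Fin n) (Fin n) (Module.End ℂ N)} (hP : P = opScalars N G * U)
    (hQ : Q = opScalars N H * Uᵀ) (hQP : Q * P = 1) (hTR : T * R = 1)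
    (hTP : ∀ i j k l, Commute (T i j) (P k l))
    (hd : ∀ w, diff₂ P R (diff₃ Gᵀ Hᵀ Q T w) = 0)
    (hconv : ∀ y, diff₂ P R (convert Q T y) = (act T yᵀ)ᵀ + (act Q y)ᵀ)
    (y : Matrix (Fin n) (Fin n) N) (hy : diff₂ P R y = 0) :
    ∃ w, diff₃ Gᵀ Hᵀ Q T w = y := by
  -- The induction runs over pairs, with $y'$ the coefficients of the second family. Since `convert`
  -- involves $U$ and can raise the filtration, the size of $y'$ has to be recorded separately from
  -- that of its image.
  have key : ∀ m, ∀ y ∈ entries (n := n) (Fr.fil m), ∀ y' ∈ entries (n := n) (Fr.fil m),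
      diff₂ P R (y + convert Q T y') = 0 → ∃ w, diff₃ Gᵀ Hᵀ Q T w = y + convert Q T y' := by
    intro m
    induction m with
    | zero =>
      intro y hy y' hy' _
      exact ⟨0, by rw [Fr.entries_zero hy, Fr.entries_zero hy', map_zero, map_zero, add_zero]⟩
    | succ m ih =>
      intro y hy y' hy' h
      have hsym : act (opScalars N G * Fr.X) y + (act (opScalars N H * Fr.Xᵀ) y')ᵀ ∈
          entries (Fr.fil (m + 1)) := by
        have h1 := Fr.act_sub_act_mem hθ hU hy
        have h2 := Fr.swap.act_sub_act_mem (U := Uᵀ) (Fr.lowers_swap hθ)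
          (by rw [hU, transpose_add]; rfl) hy'
        rw [← hP] at h1
        rw [← hQ] at h2
        rw [map_add, hconv, diff₂_apply] at h
        have : act (opScalars N G * Fr.X) y + (act (opScalars N H * Fr.Xᵀ) y')ᵀ =
            act P y + act R yᵀ + ((act T y'ᵀ)ᵀ + (act Q y')ᵀ)
            - (act P y - act (opScalars N G * Fr.X) y)
            - (act Q y' - act (opScalars N H * Fr.Xᵀ) y')ᵀ - act R yᵀ - (act T y'ᵀ)ᵀ := by
          rw [transpose_sub]
          abel
        rw [this, h]
        exact sub_mem (sub_mem (sub_mem (sub_mem (zero_mem _) h1) (transpose_mem_entries h2))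
          (act_mem_entries (fun _ _ => hR _ _ _) (transpose_mem_entries hy)))
          (transpose_mem_entries
            (act_mem_entries (fun _ _ => hT _ _ _) (transpose_mem_entries hy')))
      -- The element $w$ is the first approximation to the preimage. The solved symbol equations say
      -- $y\equiv H^tw+Qg$ and $y'\equiv-G^tw+Pg'$ modulo `fil m`, so subtracting $d_3w$ removes the
      -- parts with $w$.
      set w := Fr.contraction y with hw
      set w' := Fr.swap.contraction y' with hw'
      have hwm : w ∈ Fr.fil (m + 1) := Fr.contraction_mem hy
      have hww : w + w' ∈ Fr.fil m := Fr.contraction_add_mem hsym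
      have hmain := Fr.sub_act_mem hsym
      have hmain' := Fr.swap.sub_act_mem (y := y') (y' := y) (m := m) (by
        have := transpose_mem_entries hsym
        rw [transpose_add, transpose_transpose,
          add_comm (act (opScalars N G * Fr.X) y)ᵀ] at this
        exact this)
      change y' + spread (S := ℂ) Gᵀ w - act (opScalars N G * Fr.X)
        (act Fr.S₁ᵀ (y' + spread (S := ℂ) Gᵀ w)) ∈ entries (Fr.fil m) at hmain'
      rw [← hw'] at hmain
      set y₁' := y' + spread (S := ℂ) Gᵀ w with hy₁'
      set y₁ := y - spread (S := ℂ) Hᵀ w with hy₁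
      have hy₁m : y₁ ∈ entries (Fr.fil (m + 1)) := sub_mem hy (spread_mem_entries _ hwm)
      have hy₁m' : y₁' ∈ entries (Fr.fil (m + 1)) := add_mem hy' (spread_mem_entries _ hwm)
      -- Here $S_2$ lowers and $X$ raises by one step; this needs a step to lower from, and step
      -- zero is trivial.
      have hQlow : ∀ {z : Matrix (Fin n) (Fin n) N}, z ∈ entries (Fr.fil m) →
          act (opScalars N H * Fr.Xᵀ) (act Fr.S₂ z) ∈ entries (Fr.fil m) := fun hz => by
        rcases m with _ | m
        · rw [Fr.entries_zero hz, map_zero, map_zero]; exact zero_mem _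
        · exact act_mem_entries (mem_of_opScalars_mul H fun _ _ _ hx => Fr.X_mem _ _ _ _ hx)
            (act_mem_entries (fun _ _ => Fr.S₂_mem _ _ _) hz)
      clear_value w w'
      -- The symbol equation for $y$ contains $w'$; it is replaced by $-w$, which is allowed modulo
      -- `fil m`.
      have hmain₁ : y₁ - act (opScalars N H * Fr.Xᵀ) (act Fr.S₂ y₁) ∈ entries (Fr.fil m) := by
        obtain ⟨s, hs', hs⟩ : ∃ s, s = spread (S := ℂ) Hᵀ (w + w') ∧ s ∈ entries (Fr.fil m) :=
          ⟨_, rfl, spread_mem_entries (n := n) Hᵀ hww⟩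
        have he : y + spread (S := ℂ) Hᵀ w' = y₁ + s := by
          rw [hs', hy₁, map_add]; abel
        rw [he, map_add, map_add] at hmain
        have := add_mem (sub_mem hmain hs) (hQlow hs)
        convert this using 1
        abel
      set g := act Fr.S₂ y₁
      set g' := act Fr.S₁ᵀ y₁'
      have hg : g ∈ entries (Fr.fil m) := act_mem_entries (fun _ _ => Fr.S₂_mem _ _ _) hy₁m
      have hg' : g' ∈ entries (Fr.fil m) := act_mem_entries (fun _ _ => Fr.S₁_mem _ _ _) hy₁m'
      have hPg := Fr.act_sub_act_mem hθ hU hg'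
      have hQg := Fr.swap.act_sub_act_mem (U := Uᵀ) (Fr.lowers_swap hθ)
          (by rw [hU, transpose_add]; rfl) hg
      rw [← hP] at hPg
      rw [← hQ] at hQg
      have hy₂ : y₁ - act Q g + (act T g'ᵀ)ᵀ ∈ entries (Fr.fil m) := by
        have hT' : (act T g'ᵀ)ᵀ ∈ entries (Fr.fil m) := transpose_mem_entries
          (act_mem_entries (fun i j => hT i j m) (transpose_mem_entries hg'))
        have := add_mem (sub_mem hmain₁ hQg) hT'
        convert this using 1
        change _ = _ - (_ - act (opScalars N H * Fr.Xᵀ) g) + _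
        abel
      have hy₂' : y₁' - act P g' + (act R gᵀ)ᵀ ∈ entries (Fr.fil m) := by
        have hR' : (act R gᵀ)ᵀ ∈ entries (Fr.fil m) := transpose_mem_entries
          (act_mem_entries (fun i j => hR i j m) (transpose_mem_entries hg))
        have := add_mem (sub_mem hmain' hPg) hR'
        convert this using 1
        abel
      -- The terms $Qg$ and $Pg'$ need not be small where they stand, but `convert` exchanges the
      -- two slots of the pair: there they become $(Rg^t)^t$ and $(Tg'^t)^t$, and $R,T$ preserve the
      -- filtration.
      have hc₁ : convert Q T (act R gᵀ)ᵀ = act Q g := by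
        rw [convert_apply, transpose_transpose, ← act_mul, hTR, act_one, transpose_transpose]
      have hc₂ : convert Q T (act P g') = (act T g'ᵀ)ᵀ := by
        rw [convert_apply, ← transpose_transpose g', act_transpose_comm hTP, transpose_transpose,
          transpose_transpose, ← act_mul, hQP, act_one]
      have htot : y₁ - act Q g + (act T g'ᵀ)ᵀ + convert Q T (y₁' - act P g' + (act R gᵀ)ᵀ) =
          y + convert Q T y' - diff₃ Gᵀ Hᵀ Q T w := by
        rw [map_add, map_sub, hc₁, hc₂, hy₁, hy₁', map_add, diff₃_apply]
        abel
      obtain ⟨v, hv⟩ := ih _ hy₂ _ hy₂' (by rw [htot, map_sub, h, hd, sub_zero])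
      exact ⟨v + w, by rw [map_add, hv, htot, sub_add_cancel]⟩
  obtain ⟨m, hm⟩ := Fr.exists_mem_entries y
  have := key m y hm 0 (zero_mem _) (by rw [map_zero, add_zero, hy])
  rwa [map_zero, add_zero] at this

include hθ hU hT in
/-- Exactness in degree three. -/
theorem diff₃_injective {P Q : Matrix (Fin n) (Fin n) (Module.End ℂ N)}
    (hP : P = opScalars N G * U) (hPQ : P * Q = 1) (w : N)
    (hw : diff₃ Gᵀ Hᵀ Q T w = 0) : w = 0 := by
  obtain ⟨m, hm⟩ := Fr.fil_exhaust w
  induction m with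
  | zero => rwa [Fr.fil_zero, Submodule.mem_bot] at hm
  | succ m ih =>
    refine ih ?_
    -- Multiplying the vanishing of $d_3w$ by $P=Q^{-1}$ puts the raising operator on one side only.
    -- The other side stays in `fil (m + 1)`, so applying $T$ places $w$ in `fil m`.
    have h1 : act P (spread (S := ℂ) Hᵀ w) = (act T (spread (S := ℂ) Gᵀ w)ᵀ)ᵀ := by
      rw [diff₃_apply, sub_eq_zero] at hw
      rw [hw, convert_apply, ← act_mul, hPQ, act_one]
    have h2 : act P (spread (S := ℂ) Hᵀ w) ∈ entries (Fr.fil (m + 1)) := by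
      rw [h1]
      exact transpose_mem_entries (act_mem_entries (fun _ _ => hT _ _ _)
        (transpose_mem_entries (spread_mem_entries _ hm)))
    have h3 := Fr.act_sub_act_mem hθ hU (spread_mem_entries Hᵀ hm)
    rw [← hP] at h3
    have h4 := Fr.total_T_mem (sub_mem h2 h3)
    rwa [sub_sub_cancel, total_T_spread] at h4

end Exact

end Frame

end BilinearForm

/-! ### The complex of free bimodules -/

namespace BilinearForm

open Matrix

lemma map_scalars_mul {n : ℕ} {S N S' N' : Type*} [Ring S] [AddCommGroup N] [Module S N]
    [Ring S'] [AddCommGroup N'] [Module S' N'] [Module ℂ N] [Module ℂ N'] [SMulCommClass S ℂ N]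
    [SMulCommClass S' ℂ N'] [SMul ℂ S] [SMul ℂ S'] [IsScalarTower ℂ S N] [IsScalarTower ℂ S' N']
    (φ : N →+ N') (hφ : ∀ (c : ℂ) x, φ (c • x) = c • φ x)
    {M : Matrix (Fin n) (Fin n) (Module.End S N)} {M' : Matrix (Fin n) (Fin n) (Module.End S' N')}
    (h : ∀ i j x, φ (M i j x) = M' i j (φ x)) (K : Matrix (Fin n) (Fin n) ℂ) (i j : Fin n) (x : N) :
    φ ((scalars (Module.End S N) K * M) i j x) =
      (scalars (Module.End S' N') K * M') i j (φ x) := by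
  have h1 : ∀ (c : ℂ) (y : N), algebraMap ℂ (Module.End S N) c y = c • y := fun _ _ => rfl
  have h2 : ∀ (c : ℂ) (y : N'), algebraMap ℂ (Module.End S' N') c y = c • y := fun _ _ => rfl
  simp only [Matrix.mul_apply, scalars, map_apply, LinearMap.sum_apply, Module.End.mul_apply, h1,
    h2, map_sum, hφ, h]

section Bimodule

variable {n : ℕ} (E : GL (Fin n) ℂ)

/-- Right multiplication on the enveloping algebra. -/
noncomputable abbrev rightMul {A : Type*} [Ring A] [Algebra ℂ A] (c : Env ℂ A) :
    Module.End (Env ℂ A) (Env ℂ A) :=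
  LinearMap.toSpanSingleton _ _ c

/-- Right multiplication by `u_ij ⊗ 1`. -/
noncomputable def envU : Matrix (Fin n) (Fin n) (Module.End (Env ℂ (Alg E)) (Env ℂ (Alg E))) :=
  of fun i j => rightMul (u E i j ⊗ₜ 1)

/-- Right multiplication by `1 ⊗ u_ij`. -/
noncomputable def envL : Matrix (Fin n) (Fin n) (Module.End (Env ℂ (Alg E)) (Env ℂ (Alg E))) :=
  of fun i j => rightMul (1 ⊗ₜ op (u E i j))

lemma envU_apply (i j : Fin n) (x : Env ℂ (Alg E)) : envU E i j x = x * (u E i j ⊗ₜ 1) := rfl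

lemma envL_apply (i j : Fin n) (x : Env ℂ (Alg E)) :
    envL E i j x = x * (1 ⊗ₜ op (u E i j)) := rfl

/-- The differential `P₁ → P₀`. -/
noncomputable def env₁ :
    Matrix (Fin n) (Fin n) (Env ℂ (Alg E)) →ₗ[Env ℂ (Alg E)] Env ℂ (Alg E) :=
  total (envU E - envL E)

/-- The differential `P₂ → P₁`. -/
noncomputable def env₂ : Matrix (Fin n) (Fin n) (Env ℂ (Alg E)) →ₗ[Env ℂ (Alg E)]
    Matrix (Fin n) (Fin n) (Env ℂ (Alg E)) :=
  diff₂ (scalars _ E.valᵀ * envU E) (scalars _ E.valᵀᵀ * envL E)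

/-- The differential `P₃ → P₂`. -/
noncomputable def env₃ :
    Env ℂ (Alg E) →ₗ[Env ℂ (Alg E)] Matrix (Fin n) (Fin n) (Env ℂ (Alg E)) :=
  diff₃ E.valᵀᵀ (E⁻¹).valᵀᵀ (scalars _ (E⁻¹).valᵀ * (envU E)ᵀ)
    (scalars _ (E⁻¹).valᵀᵀ * (envL E)ᵀ)

/-- The augmentation `a ⊗ b ↦ a b`. -/
noncomputable def multiplication {A : Type*} [Ring A] [Algebra ℂ A] : Env ℂ A →ₗ[ℂ] A :=
  TensorProduct.lift
    ((LinearMap.mul ℂ A).compl₂ (opLinearEquiv ℂ : A ≃ₗ[ℂ] Aᵐᵒᵖ).symm.toLinearMap)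

lemma multiplication_tmul {A : Type*} [Ring A] [Algebra ℂ A] (a : A) (b : Aᵐᵒᵖ) :
    multiplication (a ⊗ₜ[ℂ] b) = a * b.unop := rfl

lemma multiplication_env₁ (z : Matrix (Fin n) (Fin n) (Env ℂ (Alg E))) :
    multiplication (env₁ E z) = 0 := by
  have : ∀ i j (x : Env ℂ (Alg E)), multiplication (envU E i j x - envL E i j x) = 0 := by
    intro i j x
    rw [envU_apply, envL_apply]
    induction x using TensorProduct.induction_on with
    | zero => simp
    | tmul a b => simp [multiplication_tmul, mul_assoc]
    | add x y hx hy => rw [add_mul, add_mul, add_sub_add_comm, map_add, hx, hy, add_zero]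
  rw [env₁, total_apply, map_sum]
  exact Finset.sum_eq_zero fun i _ => by
    rw [map_sum]
    exact Finset.sum_eq_zero fun j _ => this i j _

/-- The bimodule complex `P₃ → P₂ → P₁ → P₀ → B(E)` is exact. -/
theorem env_exact (hn : 2 ≤ n) :
    (∀ y, env₁ E (env₂ E y) = 0) ∧ (∀ w, env₂ E (env₃ E w) = 0) ∧
    (∀ x, multiplication x = 0 → ∃ z, env₁ E z = x) ∧
    (∀ z, env₁ E z = 0 → ∃ y, env₂ E y = z) ∧
    (∀ y, env₂ E y = 0 → ∃ w, env₃ E w = y) ∧ (∀ w, env₃ E w = 0 → w = 0) := by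
  obtain ⟨B, _, _, Fr₀, θ₀, e, hθ₀, hε, h₁, h₂, he⟩ := exists_regular_frame hn E
  -- A model of $A^e$ filtered by the first factor only. Right multiplication by $u\otimes1$ becomes
  -- $(X+\theta)\otimes1$.
  let N := B ⊗[ℂ] Alg E
  let Fr : Frame E.valᵀ (E⁻¹).valᵀ N := Fr₀.extend (Alg E)
  obtain ⟨θ, hθ'⟩ : ∃ θ, θ = θ₀.map (extend (Alg E)) := ⟨_, rfl⟩
  have hθ : Fr.Lowers θ := fun i j m => by
    rw [hθ']
    exact extend_mem _ (hθ₀ i j m)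
  obtain ⟨U, hU⟩ : ∃ U, U = Fr.X + θ := ⟨_, rfl⟩
  have hU' : U = (Fr₀.X + θ₀).map (extend (Alg E)) := by
    rw [hU, hθ', Matrix.map_add _ (map_add _)]
    rfl
  have hU₁ : Uᵀ * opScalars N E.valᵀ * U = opScalars N E.valᵀ := by
    rw [hU', ← Matrix.transpose_map, ← map_extend_opScalars, ← map_extend_mul, ← map_extend_mul, h₁]
  have hU₂ : U * opScalars N (E⁻¹).valᵀ * Uᵀ = opScalars N (E⁻¹).valᵀ := by
    rw [hU', ← Matrix.transpose_map, ← map_extend_opScalars, ← map_extend_mul, ← map_extend_mul, h₂]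
  -- Right multiplication by $1\otimes u$ in $A\otimes A^{op}$ is left multiplication by $u$ on the
  -- second factor, so $L$ satisfies the relations of $u$ itself, without transposing $E$.
  let lact : Alg E →ₐ[ℂ] Module.End ℂ N :=
    (Module.End.lTensorAlgHom ℂ (Alg E) B).comp (Algebra.lmul ℂ (Alg E))
  have hlact : ∀ a b c, lact a (b ⊗ₜ c) = b ⊗ₜ (a * c) := fun a b c => rfl
  obtain ⟨L, hL⟩ : ∃ L, L = (u E).map lact := ⟨_, rfl⟩
  have hL₁ : Lᵀ * opScalars N E.valᵀᵀ * L = opScalars N E.valᵀᵀ := by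
    have := congrArg (Matrix.map · lact) (u_left E)
    simp only [Matrix.map_mul, map_scalars, Matrix.transpose_map] at this
    rwa [← hL] at this
  have hL₂ : L * opScalars N (E⁻¹).valᵀᵀ * Lᵀ = opScalars N (E⁻¹).valᵀᵀ := by
    have := congrArg (Matrix.map · lact) (u_right E)
    simp only [Matrix.map_mul, map_scalars, Matrix.transpose_map] at this
    rwa [← hL] at this
  have hUL : ∀ i j k l, Commute (U i j) (L k l) := fun i j k l => by
    rw [hU', hL]
    exact TensorProduct.ext' fun b c => rfl
  have hFE : opScalars N (E⁻¹).valᵀ * opScalars N E.valᵀ = 1 := by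
    rw [opScalars_mul, ← transpose_mul, E.mul_inv, transpose_one, opScalars_one]
  have hEF : opScalars N E.valᵀ * opScalars N (E⁻¹).valᵀ = 1 := by
    rw [opScalars_mul, ← transpose_mul, E.inv_mul, transpose_one, opScalars_one]
  have hFE' : opScalars N (E⁻¹).valᵀᵀ * opScalars N E.valᵀᵀ = 1 := by
    rw [opScalars_mul, ← transpose_mul, ← transpose_mul, E.inv_mul, transpose_one, transpose_one,
      opScalars_one]
  have hEF' : opScalars N E.valᵀᵀ * opScalars N (E⁻¹).valᵀᵀ = 1 := by
    rw [opScalars_mul, ← transpose_mul, ← transpose_mul, E.mul_inv, transpose_one, transpose_one,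
      opScalars_one]
  obtain ⟨P, hP⟩ : ∃ P, P = opScalars N E.valᵀ * U := ⟨_, rfl⟩
  obtain ⟨Q, hQ⟩ : ∃ Q, Q = opScalars N (E⁻¹).valᵀ * Uᵀ := ⟨_, rfl⟩
  obtain ⟨R, hR⟩ : ∃ R, R = opScalars N E.valᵀᵀ * L := ⟨_, rfl⟩
  obtain ⟨T, hT⟩ : ∃ T, T = opScalars N (E⁻¹).valᵀᵀ * Lᵀ := ⟨_, rfl⟩
  have hPQ : P * Q = 1 := by
    rw [hP, hQ, Matrix.mul_assoc, ← Matrix.mul_assoc U, hU₂, hEF]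
  have hQP : Q * P = 1 := by
    rw [hP, hQ, Matrix.mul_assoc, ← Matrix.mul_assoc Uᵀ, hU₁, hFE]
  have hRT : R * T = 1 := by
    rw [hR, hT, Matrix.mul_assoc, ← Matrix.mul_assoc L, hL₂, hEF']
  have hTR : T * R = 1 := by
    rw [hR, hT, Matrix.mul_assoc, ← Matrix.mul_assoc Lᵀ, hL₁, hFE']
  have hcomm : ∀ {M M' : Matrix (Fin n) (Fin n) (Module.End ℂ N)}
      (_ : ∀ i j k l, Commute (M i j) (M' k l)) (K K' : Matrix (Fin n) (Fin n) ℂ) (i j k l : Fin n),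
      Commute ((opScalars N K * M) i j) ((opScalars N K' * M') k l) := by
    intro M M' h K K' i j k l
    rw [opScalars_mul_apply, opScalars_mul_apply]
    exact Commute.sum_left _ _ _ fun a _ => Commute.sum_right _ _ _ fun b _ =>
      ((h _ _ _ _).smul_left _).smul_right _
  have hRQ : ∀ i j k l, Commute (R i j) (Q k l) := by
    rw [hR, hQ]; exact hcomm (fun i j k l => (hUL l k i j).symm) _ _
  have hTP : ∀ i j k l, Commute (T i j) (P k l) := by
    rw [hT, hP]; exact hcomm (fun i j k l => (hUL k l j i).symm) _ _
  have hLm : ∀ i j m, ∀ b ∈ Fr.fil m, L i j b ∈ Fr.fil m := fun i j m b hb => by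
    rw [hL]
    exact map_mem_of_mem_tensorSub _ _ (fun b hb v => tmul_mem_tensorSub hb _) hb
  have hRm : ∀ i j m, ∀ b ∈ Fr.fil m, R i j b ∈ Fr.fil m := fun i j m => by
    rw [hR]; exact mem_of_opScalars_mul _ (fun i j => hLm i j m) i j
  have hTm : ∀ i j m, ∀ b ∈ Fr.fil m, T i j b ∈ Fr.fil m := fun i j m => by
    rw [hT]; exact mem_of_opScalars_mul _ (fun i j => hLm j i m) i j
  have hd₁ : ∀ y, total (U - L) (diff₂ P R y) = 0 := fun y => by
    rw [hP, hR]; exact total_diff₂ hU₁ hL₁ hUL y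
  have hd₂ : ∀ w, diff₂ P R (diff₃ E.valᵀᵀ (E⁻¹).valᵀᵀ Q T w) = 0 := fun w => by
    rw [hP, hQ] at hPQ
    rw [hR, hT] at hRT
    rw [hR, hQ] at hRQ
    rw [hP, hR, hQ, hT]
    exact diff₂_diff₃ hPQ hRT hRQ w
  have hconv := diff₂_convert hPQ hRT hRQ
  let Φ : Env ℂ (Alg E) ≃ₗ[ℂ] N := TensorProduct.congr e (opLinearEquiv ℂ).symm
  have hΦ : ∀ a c, Φ (a ⊗ₜ c) = e a ⊗ₜ c.unop := fun a c => rfl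
  obtain ⟨φ, hφ⟩ : ∃ φ : Env ℂ (Alg E) →+ N, ∀ x, φ x = Φ x := ⟨Φ.toAddEquiv.toAddMonoidHom, fun _ => rfl⟩
  have hφs : ∀ (c : ℂ) x, φ (c • x) = c • φ x := fun c x => by rw [hφ, hφ, map_smul]
  have hinj : Function.Injective φ := fun x y h => Φ.injective (by rwa [hφ, hφ] at h)
  have hinjM : ∀ {z z' : Matrix (Fin n) (Fin n) (Env ℂ (Alg E))}, z.map φ = z'.map φ → z = z' :=
    fun h => Matrix.map_injective hinj h
  have hsurj : ∀ y, ∃ x, φ x = y := fun y => ⟨Φ.symm y, by rw [hφ, LinearEquiv.apply_symm_apply]⟩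
  have hsurjM : ∀ z : Matrix (Fin n) (Fin n) N, ∃ z', Matrix.map z' φ = z := fun z =>
    ⟨z.map Φ.symm, by ext i j; simp [hφ]⟩
  have hφU : ∀ i j x, φ (envU E i j x) = U i j (φ x) := fun i j x => by
    rw [envU_apply, hφ, hφ, hU']
    induction x using TensorProduct.induction_on with
    | zero => simp
    | tmul a c =>
      rw [Algebra.TensorProduct.tmul_mul_tmul, hΦ, hΦ, mul_one, he]
      rfl
    | add x y hx hy => rw [add_mul, map_add, hx, hy, map_add, map_add]
  have hφL : ∀ i j x, φ (envL E i j x) = L i j (φ x) := fun i j x => by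
    rw [envL_apply, hφ, hφ, hL]
    induction x using TensorProduct.induction_on with
    | zero => simp
    | tmul a c =>
      rw [Algebra.TensorProduct.tmul_mul_tmul, hΦ, hΦ, mul_one]
      rfl
    | add x y hx hy => rw [add_mul, map_add, hx, hy, map_add, map_add]
  have hφP := map_scalars_mul φ hφs hφU E.valᵀ
  have hφQ := map_scalars_mul φ hφs (M := (envU E)ᵀ) (M' := Uᵀ) (fun i j => hφU j i) (E⁻¹).valᵀ
  have hφR := map_scalars_mul φ hφs hφL E.valᵀᵀ
  have hφT := map_scalars_mul φ hφs (M := (envL E)ᵀ) (M' := Lᵀ) (fun i j => hφL j i) (E⁻¹).valᵀᵀ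
  rw [← opScalars, ← hP] at hφP
  rw [← opScalars, ← hQ] at hφQ
  rw [← opScalars, ← hR] at hφR
  rw [← opScalars, ← hT] at hφT
  have n₁ : ∀ z, φ (env₁ E z) = total (U - L) (z.map φ) := map_total φ fun i j x => by
    rw [Matrix.sub_apply, Matrix.sub_apply, LinearMap.sub_apply, LinearMap.sub_apply, map_sub, hφU,
      hφL]
  have n₂ : ∀ y, (env₂ E y).map φ = diff₂ P R (y.map φ) := map_diff₂ φ hφP hφR
  have n₃ : ∀ w, (env₃ E w).map φ = diff₃ E.valᵀᵀ (E⁻¹).valᵀᵀ Q T (φ w) :=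
    map_diff₃ φ hφs _ _ hφQ hφT
  have hz : (0 : Matrix (Fin n) (Fin n) (Env ℂ (Alg E))).map φ = 0 := by ext i j; simp
  refine ⟨fun y => hinj ?_, fun w => hinjM ?_, fun x hx => ?_, fun z hz' => ?_, fun y hy => ?_,
    fun w hw => hinj ?_⟩
  · rw [n₁, n₂, hd₁, map_zero]
  · rw [n₂, n₃, hd₂, hz]
  · obtain ⟨z', c, h⟩ := Fr.exists_total hθ hU hLm (φ x)
    obtain ⟨z, rfl⟩ := hsurjM z'
    -- Exactness at $P_0$ leaves a remainder $1\otimes v$; the augmentation sends it to $v$, which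
    -- must then vanish.
    have hc : ∀ c, ∃ v, Fr.ε c = e 1 ⊗ₜ v := fun c => by
      induction c using TensorProduct.induction_on with
      | zero => exact ⟨0, by simp⟩
      | tmul b v =>
        obtain ⟨r, hr⟩ := hε b
        refine ⟨r • v, ?_⟩
        change Fr₀.ε b ⊗ₜ v = _
        rw [hr, smul_tmul]
      | add x y hx hy =>
        obtain ⟨v, hv⟩ := hx
        obtain ⟨v', hv'⟩ := hy
        exact ⟨v + v', by rw [map_add, hv, hv', tmul_add]⟩
    obtain ⟨v, hv⟩ := hc c
    have hxz : x = env₁ E z + 1 ⊗ₜ op v := hinj (by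
      rw [h, hv, map_add, n₁, hφ (1 ⊗ₜ op v), hΦ, unop_op])
    have hv0 : v = 0 := by
      rw [hxz, map_add, multiplication_env₁, multiplication_tmul, zero_add, one_mul, unop_op] at hx
      exact hx
    exact ⟨z, by rw [hxz, hv0, op_zero, tmul_zero, add_zero]⟩
  · have h0 : total (U - L) (z.map φ) = 0 := by rw [← n₁, hz', map_zero]
    rw [hP] at hd₁ hconv
    obtain ⟨y', hy'⟩ := Fr.exists_diff₂ hθ hU hLm hRm hTm hQ hd₁ hconv _ h0
    obtain ⟨y, rfl⟩ := hsurjM y'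
    exact ⟨y, hinjM (by rw [n₂, hP, hy'])⟩
  · have h0 : diff₂ P R (y.map φ) = 0 := by rw [← n₂, hy, hz]
    obtain ⟨w', hw'⟩ := Fr.exists_diff₃ hθ hU hRm hTm hP hQ hQP hTR hTP hd₂ hconv _ h0
    obtain ⟨w, rfl⟩ := hsurj w'
    exact ⟨w, hinjM (by rw [n₃]; exact hw')⟩
  · rw [map_zero]
    refine Fr.diff₃_injective hθ hU hTm hP hPQ _ ?_
    have := n₃ w
    rw [hw, hz] at this
    exact this.symm

end Bimodule

end BilinearForm

/-! ### Homology of complexes of modules and projective resolutions -/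

section HomologicalAlgebra

universe u v

section Homology

variable {R : Type u} [Ring R]

lemma ChainComplex.exactAt_succ_of_forall (K : ChainComplex (ModuleCat.{v} R) ℕ) (k : ℕ)
    (h : ∀ x : K.X (k + 1), K.d (k + 1) k x = 0 → ∃ y : K.X (k + 2), K.d (k + 2) (k + 1) y = x) :
    K.ExactAt (k + 1) := by
  rw [HomologicalComplex.exactAt_iff' K (k + 2) (k + 1) k (by simp) (by simp),
    ShortComplex.moduleCat_exact_iff]
  exact h

lemma CochainComplex.exactAt_succ_of_forall (K : CochainComplex (ModuleCat.{v} R) ℕ) (k : ℕ)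
    (h : ∀ x : K.X (k + 1), K.d (k + 1) (k + 2) x = 0 → ∃ y : K.X k, K.d k (k + 1) y = x) :
    K.ExactAt (k + 1) := by
  rw [HomologicalComplex.exactAt_iff' K k (k + 1) (k + 2) (by simp) (by simp),
    ShortComplex.moduleCat_exact_iff]
  exact h

lemma ModuleCat.subsingleton_homology {ι : Type*} {c : ComplexShape ι}
    {K : HomologicalComplex (ModuleCat.{v} R) c} {i : ι} (h : K.ExactAt i) :
    Subsingleton (K.homology i) :=
  ModuleCat.subsingleton_of_isZero h.isZero_homology

/-- A linear map on chains that is onto on cycles and kills exactly the boundaries computes the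
homology. -/
lemma ChainComplex.nonempty_homology_equiv (K : ChainComplex (ModuleCat.{v} R) ℕ) (k : ℕ)
    {W : Type*} [AddCommGroup W] [Module R W] (f : K.X (k + 1) →ₗ[R] W)
    (hs : ∀ w, ∃ x, K.d (k + 1) k x = 0 ∧ f x = w)
    (hf : ∀ x, K.d (k + 1) k x = 0 → (f x = 0 ↔ ∃ y, K.d (k + 2) (k + 1) y = x)) :
    Nonempty (K.homology (k + 1) ≃ₗ[R] W) := by
  let S := K.sc' (k + 2) (k + 1) k
  let e₁ : K.homology (k + 1) ≅ S.moduleCatLeftHomologyData.H :=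
    ShortComplex.homologyMapIso (K.isoSc' (k + 2) (k + 1) k (by simp) (by simp)) ≪≫
      S.moduleCatHomologyIso
  let g : LinearMap.ker S.g.hom →ₗ[R] W := f ∘ₗ (LinearMap.ker S.g.hom).subtype
  have hg : Function.Surjective g := fun w => by
    obtain ⟨x, hx, rfl⟩ := hs w
    exact ⟨⟨x, hx⟩, rfl⟩
  have hker : LinearMap.range S.moduleCatToCycles = LinearMap.ker g := by
    ext ⟨x, hx⟩
    rw [LinearMap.mem_ker]
    refine Iff.trans ?_ (hf x hx).symm
    constructor
    · rintro ⟨y, hy⟩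
      exact ⟨y, congrArg Subtype.val hy⟩
    · rintro ⟨y, hy⟩
      exact ⟨y, Subtype.ext hy⟩
  exact ⟨e₁.toLinearEquiv.trans
    ((Submodule.quotEquivOfEq _ _ hker).trans (g.quotKerEquivOfSurjective hg))⟩

end Homology

lemma ChainComplex.of_d_succ {V : Type*} [Category* V] [Limits.HasZeroMorphisms V] (X : ℕ → V)
    (d : ∀ n, X (n + 1) ⟶ X n) (hd : ∀ n, d (n + 1) ≫ d n = 0) (n : ℕ) :
    (ChainComplex.of X d hd).d (n + 1) n = d n :=
  ChainComplex.of_d X d n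

lemma CochainComplex.of_d_succ {V : Type*} [Category* V] [Limits.HasZeroMorphisms V] (X : ℕ → V)
    (d : ∀ n, X n ⟶ X (n + 1)) (hd : ∀ n, d n ≫ d (n + 1) = 0) (n : ℕ) :
    (CochainComplex.of X d hd).d n (n + 1) = d n :=
  CochainComplex.of_d X d n

section Resolution

variable {S : Type u} [Ring S]

/-- A projective resolution from an exact sequence of projective modules. -/
lemma exists_projectiveResolution (X : ℕ → ModuleCat.{u} S) (d : ∀ n, X (n + 1) ⟶ X n)
    {Z : ModuleCat.{u} S} (aug : X 0 ⟶ Z) (hX : ∀ n, Projective (X n))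
    (hd : ∀ n, d (n + 1) ≫ d n = 0) (haug : d 0 ≫ aug = 0)
    (hsurj : Function.Surjective aug) (hex₀ : ∀ x, aug x = 0 → ∃ y, d 0 y = x)
    (hex : ∀ n x, d n x = 0 → ∃ y, d (n + 1) y = x) :
    ∃ P : ProjectiveResolution Z, P.complex = ChainComplex.of X d hd := by
  refine ⟨{ complex := ChainComplex.of X d hd
            projective := hX
            π := (ChainComplex.toSingle₀Equiv _ _).symm ⟨aug, by
              rw [ChainComplex.of_d_succ X d hd]; exact haug⟩
            quasiIso := ⟨fun n => ?_⟩ }, rfl⟩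
  cases n with
  | zero =>
    rw [ChainComplex.quasiIsoAt₀_iff, ShortComplex.quasiIso_iff_of_zeros']
    · refine (ShortComplex.exact_and_epi_g_iff_of_iso (S₁ := ShortComplex.mk (d 0) aug haug) ?_).1
        ⟨?_, ?_⟩
      · refine ShortComplex.isoMk (Iso.refl _) (Iso.refl _) (Iso.refl _) ?_ ?_
        · exact (Category.id_comp _).trans
            ((ChainComplex.of_d_succ X d hd 0).trans (Category.comp_id _).symm)
        · exact (Category.id_comp _).trans
            ((ChainComplex.toSingle₀Equiv_symm_apply_f_zero _ _).trans (Category.comp_id _).symm)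
      · rw [ShortComplex.moduleCat_exact_iff]
        exact hex₀
      · exact (ModuleCat.epi_iff_surjective _).2 hsurj
    all_goals rfl
  | succ n =>
    rw [quasiIsoAt_iff_exactAt']
    · refine ChainComplex.exactAt_succ_of_forall _ n fun x hx => ?_
      rw [ChainComplex.of_d_succ X d hd] at hx ⊢
      exact hex n x hx
    · exact ChainComplex.exactAt_succ_single_obj _ _

end Resolution

end HomologicalAlgebra

/-! ### The bar resolution -/

namespace Hochschild

section Inner

variable (k A : Type*) [CommRing k] [Ring A] [Algebra k A]

/-- The enveloping algebra as a bimodule over `A` through its inner structure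
`a · (x ⊗ y) · b = x b ⊗ a y`, and as a left module over itself. -/
def InnerEnv : Type _ := A ⊗[k] Aᵐᵒᵖ

namespace InnerEnv

instance : AddCommGroup (InnerEnv k A) := inferInstanceAs (AddCommGroup (A ⊗[k] Aᵐᵒᵖ))

instance : Module k (InnerEnv k A) := inferInstanceAs (Module k (A ⊗[k] Aᵐᵒᵖ))

instance : Module (A ⊗[k] Aᵐᵒᵖ) (InnerEnv k A) :=
  inferInstanceAs (Module (A ⊗[k] Aᵐᵒᵖ) (A ⊗[k] Aᵐᵒᵖ))

instance : IsScalarTower k (A ⊗[k] Aᵐᵒᵖ) (InnerEnv k A) :=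
  inferInstanceAs (IsScalarTower k (A ⊗[k] Aᵐᵒᵖ) (A ⊗[k] Aᵐᵒᵖ))

instance : SMulCommClass k (A ⊗[k] Aᵐᵒᵖ) (InnerEnv k A) :=
  inferInstanceAs (SMulCommClass k (A ⊗[k] Aᵐᵒᵖ) (A ⊗[k] Aᵐᵒᵖ))

/-- The enveloping algebra and its synonym are isomorphic left modules. -/
def equiv : (A ⊗[k] Aᵐᵒᵖ) ≃ₗ[A ⊗[k] Aᵐᵒᵖ] InnerEnv k A := LinearEquiv.refl _ (A ⊗[k] Aᵐᵒᵖ)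

variable {k A}

/-- The pure tensor `x ⊗ y`. -/
def mk (x y : A) : InnerEnv k A := equiv k A (x ⊗ₜ op y)

lemma induction {p : InnerEnv k A → Prop} (zero : p 0) (pure : ∀ x y, p (mk x y))
    (add : ∀ z w, p z → p w → p (z + w)) (z : InnerEnv k A) : p z :=
  TensorProduct.induction_on (motive := p) z zero (fun x y => pure x y.unop) add

variable (k A) in
/-- The inner left action, as a homomorphism to the opposite of the enveloping algebra. -/
def leftHom : A →+* (A ⊗[k] Aᵐᵒᵖ)ᵐᵒᵖ where
  toFun a := op (1 ⊗ₜ op a)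
  map_one' := rfl
  map_mul' a b := by
    rw [← op_mul, Algebra.TensorProduct.tmul_mul_tmul, mul_one, op_mul]
  map_zero' := by rw [op_zero, tmul_zero, op_zero]
  map_add' a b := by rw [MulOpposite.op_add, tmul_add, MulOpposite.op_add]

variable (k A) in
/-- The inner right action, as a homomorphism to the opposite of the enveloping algebra. -/
def rightHom : Aᵐᵒᵖ →+* (A ⊗[k] Aᵐᵒᵖ)ᵐᵒᵖ where
  toFun a := op (a.unop ⊗ₜ 1)
  map_one' := rfl
  map_mul' a b := by
    rw [← op_mul, Algebra.TensorProduct.tmul_mul_tmul, mul_one, unop_mul]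
  map_zero' := by rw [unop_zero, zero_tmul, op_zero]
  map_add' a b := by rw [MulOpposite.unop_add, add_tmul, MulOpposite.op_add]

instance : Module A (InnerEnv k A) :=
  show Module A (A ⊗[k] Aᵐᵒᵖ) from Module.compHom _ (leftHom k A)

instance : Module Aᵐᵒᵖ (InnerEnv k A) :=
  show Module Aᵐᵒᵖ (A ⊗[k] Aᵐᵒᵖ) from Module.compHom _ (rightHom k A)

lemma smul_mk (a x y : A) : a • (mk x y : InnerEnv k A) = mk x (a * y) := by
  change (x ⊗ₜ[k] op y) * (1 ⊗ₜ op a) = x ⊗ₜ op (a * y)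
  rw [Algebra.TensorProduct.tmul_mul_tmul, mul_one, op_mul]

lemma op_smul_mk (a x y : A) : op a • (mk x y : InnerEnv k A) = mk (x * a) y := by
  change (x ⊗ₜ[k] op y) * (a ⊗ₜ 1) = (x * a) ⊗ₜ op y
  rw [Algebra.TensorProduct.tmul_mul_tmul, mul_one]

lemma env_smul_mk (a b x y : A) :
    (a ⊗ₜ[k] op b) • (mk x y : InnerEnv k A) = mk (a * x) (y * b) := by
  change (a ⊗ₜ[k] op b) * (x ⊗ₜ op y) = (a * x) ⊗ₜ op (y * b)
  rw [Algebra.TensorProduct.tmul_mul_tmul, op_mul]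

lemma smul_one (z : A ⊗[k] Aᵐᵒᵖ) : z • (mk 1 1 : InnerEnv k A) = equiv k A z :=
  mul_one z

lemma base_smul_mk (c : k) (x y : A) : c • (mk x y : InnerEnv k A) = mk x (c • y) :=
  (tmul_smul c x (op y)).symm

instance : IsScalarTower k A (InnerEnv k A) :=
  ⟨fun c a z => by
    induction z using induction with
    | zero => simp only [smul_zero]
    | pure x y => rw [smul_mk, smul_mk, base_smul_mk, smul_mul_assoc]
    | add z w hz hw => simp only [smul_add, hz, hw]⟩

instance : IsScalarTower k Aᵐᵒᵖ (InnerEnv k A) :=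
  ⟨fun c a z => by
    induction z using induction with
    | zero => simp only [smul_zero]
    | pure x y =>
      induction a using MulOpposite.rec' with
      | _ a =>
        rw [← op_smul, op_smul_mk, op_smul_mk, base_smul_mk, mul_smul_comm]
        exact smul_tmul c (x * a) (op y)
    | add z w hz hw => simp only [smul_add, hz, hw]⟩

instance : SMulCommClass A Aᵐᵒᵖ (InnerEnv k A) :=
  ⟨fun a b z => by
    induction z using induction with
    | zero => simp only [smul_zero]
    | pure x y =>
      induction b using MulOpposite.rec' with
      | _ b => rw [smul_mk, op_smul_mk, op_smul_mk, smul_mk]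
    | add z w hz hw => simp only [smul_add, hz, hw]⟩

lemma env_smul_smul (e : A ⊗[k] Aᵐᵒᵖ) (a : A) (z : InnerEnv k A) : e • a • z = a • e • z :=
  (mul_assoc e ((equiv k A).symm z) (1 ⊗ₜ op a)).symm

lemma env_smul_op_smul (e : A ⊗[k] Aᵐᵒᵖ) (a : A) (z : InnerEnv k A) :
    e • op a • z = op a • e • z :=
  (mul_assoc e ((equiv k A).symm z) (a ⊗ₜ 1)).symm

end InnerEnv

end Inner

section Bar

universe u

variable (k A : Type u) [Field k] [Ring A] [Algebra k A]

/-- The Hochschild boundary is natural in the bimodule. -/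
lemma boundary_rTensor {k A M M' : Type*} [CommRing k] [Ring A] [Algebra k A]
    [AddCommGroup M] [Module k M] [Module A M] [Module Aᵐᵒᵖ M]
    [IsScalarTower k A M] [IsScalarTower k Aᵐᵒᵖ M] [SMulCommClass A Aᵐᵒᵖ M]
    [AddCommGroup M'] [Module k M'] [Module A M'] [Module Aᵐᵒᵖ M']
    [IsScalarTower k A M'] [IsScalarTower k Aᵐᵒᵖ M'] [SMulCommClass A Aᵐᵒᵖ M']
    (f : M →ₗ[k] M') (hl : ∀ (a : A) x, f (a • x) = a • f x)
    (hr : ∀ (a : A) x, f (op a • x) = op a • f x) (n : ℕ) (z : Chains k A M (n + 1)) :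
    boundary k A M' n (f.rTensor _ z) = f.rTensor _ (boundary k A M n z) := by
  induction z using TensorProduct.induction_on with
  | zero => simp
  | add z w hz hw => rw [map_add, map_add, map_add, map_add, hz, hw]
  | tmul x t =>
    induction t using PiTensorProduct.induction_on with
    | smul_tprod r a =>
      simp only [tmul_smul, map_smul, LinearMap.rTensor_tmul, boundary_eq_sum, map_sum, hl, hr]
    | add s t hs ht => simp only [tmul_add, map_add, hs, ht]

/-- The terms of the bar resolution, as Hochschild chains. -/
abbrev Bar (n : ℕ) : Type u := Chains k A (InnerEnv k A) n

/-- The differential of the bar resolution. -/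
noncomputable def barD (n : ℕ) : Bar k A (n + 1) →ₗ[Env k A] Bar k A n where
  toFun := boundary k A (InnerEnv k A) n
  map_add' := map_add _
  map_smul' e z := by
    have h : ∀ m (z : Bar k A m), e • z =
        LinearMap.rTensor _ (DistribSMul.toLinearMap k (InnerEnv k A) e) z :=
      fun m z => rfl
    rw [RingHom.id_apply, h, h]
    exact boundary_rTensor (k := k) (A := A) (M := InnerEnv k A) (M' := InnerEnv k A)
      (DistribSMul.toLinearMap k (InnerEnv k A) e) (fun a x => InnerEnv.env_smul_smul e a x)
      (fun a x => InnerEnv.env_smul_op_smul e a x) n z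

lemma barD_comp (n : ℕ) (z : Bar k A (n + 2)) : barD k A n (barD k A (n + 1) z) = 0 :=
  LinearMap.congr_fun (boundary_comp k A (InnerEnv k A) n) z

variable {k A} in
-- Prepending an entry shifts the index of a face by one. The shift reverses its sign, and this
-- produces the cancellation in the contracting homotopy.
lemma inner_succ_cons {n : ℕ} (x : A) (a : Fin (n + 1) → A) (j : Fin (n + 2)) :
    inner j.succ (Fin.cons x a : Fin (n + 2) → A) =
      (Fin.cons (x * lf j a) (inner j a) : Fin (n + 1) → A) := by
  ext l
  refine Fin.cases ?_ (fun l => ?_) l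
  · rcases eq_or_ne j 0 with rfl | hj
    · simp [inner, lf]
    · have : (j : ℕ) ≠ 0 := fun h => hj (Fin.ext h)
      simp [inner, lf, hj, Nat.pos_of_ne_zero this]
  · simp [inner]

variable {k A} in
lemma rf_succ_cons {n : ℕ} (x : A) (a : Fin (n + 1) → A) (j : Fin (n + 2)) :
    rf j.succ (Fin.cons x a : Fin (n + 2) → A) = rf j a := by
  simp only [rf, ← Fin.succ_last, Fin.succ_inj, Fin.cons_succ]

/-- The contracting homotopy `(x ⊗ y) ⊗ a ↦ (1 ⊗ y) ⊗ (x, a)` of the bar resolution. -/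
noncomputable def barS (n : ℕ) : Bar k A n →ₗ[k] Bar k A (n + 1) :=
  TensorProduct.lift (TensorProduct.lift
    (LinearMap.mk₂ k
      (fun (x : A) (y : Aᵐᵒᵖ) => TensorProduct.mk k (InnerEnv k A) _ (InnerEnv.mk 1 y.unop) ∘ₗ
        PiTensorProduct.lift
          ((PiTensorProduct.tprod k : MultilinearMap k (fun _ : Fin (n + 1) => A) _).curryLeft x))
      (fun x x' y => by rw [map_add, map_add, LinearMap.comp_add])
      (fun c x y => by rw [map_smul, map_smul, LinearMap.comp_smul])
      (fun x y y' => by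
        have : (InnerEnv.mk 1 (y + y').unop : InnerEnv k A) =
          InnerEnv.mk 1 y.unop + InnerEnv.mk 1 y'.unop := tmul_add _ _ _
        rw [this, map_add, LinearMap.add_comp])
      (fun c x y => by
        have : (InnerEnv.mk 1 (c • y).unop : InnerEnv k A) =
          c • InnerEnv.mk 1 y.unop := tmul_smul c (1 : A) y
        rw [this, map_smul, LinearMap.smul_comp])))

lemma barS_tmul (n : ℕ) (x y : A) (a : Fin n → A) :
    barS k A n (InnerEnv.mk x y ⊗ₜ PiTensorProduct.tprod k a) =
      InnerEnv.mk 1 y ⊗ₜ PiTensorProduct.tprod k (Fin.cons x a : Fin (n + 1) → A) := by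
  change InnerEnv.mk 1 y ⊗ₜ PiTensorProduct.lift
    ((PiTensorProduct.tprod k : MultilinearMap k (fun _ : Fin (n + 1) => A) _).curryLeft x)
      (PiTensorProduct.tprod k a) = _
  rw [PiTensorProduct.lift.tprod]
  rfl

variable {k A} in
lemma bar_induction {n : ℕ} {p : Bar k A n → Prop} (zero : p 0)
    (pure : ∀ x y a, p (InnerEnv.mk x y ⊗ₜ PiTensorProduct.tprod k a))
    (smul : ∀ (c : k) z, p z → p (c • z))
    (add : ∀ z w, p z → p w → p (z + w)) (z : Bar k A n) : p z := by
  induction z using TensorProduct.induction_on with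
  | zero => exact zero
  | add z w hz hw => exact add _ _ hz hw
  | tmul e t =>
    induction t using PiTensorProduct.induction_on with
    | smul_tprod r a =>
      rw [tmul_smul]
      refine smul _ _ ?_
      induction e using InnerEnv.induction with
      | zero => rw [zero_tmul]; exact zero
      | pure x y => exact pure x y a
      | add z w hz hw => rw [add_tmul]; exact add _ _ hz hw
    | add s t hs ht => rw [tmul_add]; exact add _ _ hs ht

/-- Face $0$ of the prepended tuple returns the original element. Face $j+1$ cancels against the
prepended face $j$, by the shift of indices. -/
lemma barD_barS (n : ℕ) (z : Bar k A (n + 1)) :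
    barD k A (n + 1) (barS k A (n + 1) z) + barS k A n (barD k A n z) = z := by
  induction z using bar_induction with
  | zero => simp
  | smul c z hz =>
    have h1 : ∀ m (c : k) (z : Bar k A (m + 1)), barD k A m (c • z) = c • barD k A m z :=
      fun m c z => map_smul (boundary k A (InnerEnv k A) m) c z
    rw [map_smul, h1, h1, map_smul, ← smul_add, hz]
  | add z w hz hw =>
    simp only [map_add]
    rw [add_add_add_comm, hz, hw]
  | pure x y a =>
    rw [barS_tmul]
    change boundary k A (InnerEnv k A) (n + 1) _ + barS k A n (boundary k A (InnerEnv k A) n _) = _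
    rw [boundary_eq_sum, boundary_eq_sum, Fin.sum_univ_succ, map_sum, add_assoc,
      ← Finset.sum_add_distrib, Finset.sum_eq_zero, add_zero]
    · rw [inner_zero, Fin.tail_cons]
      simp [rf, lf, InnerEnv.op_smul_mk, (Fin.last_pos).ne]
    · intro j _
      rw [inner_succ_cons, rf_succ_cons, map_smul]
      have hlf : lf j.succ (Fin.cons x a : Fin (n + 2) → A) = 1 := by
        simp [lf, Fin.succ_ne_zero]
      rw [hlf, InnerEnv.op_smul_mk, InnerEnv.op_smul_mk, InnerEnv.smul_mk, InnerEnv.smul_mk,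
        barS_tmul, mul_one, Fin.val_succ, pow_succ, mul_neg_one, neg_smul, neg_add_cancel]

attribute [local instance] instModuleTensorProductMop

/-- The augmentation of the bar resolution. -/
noncomputable def barAug : Bar k A 0 →ₗ[Env k A] A :=
  LinearMap.toSpanSingleton (Env k A) A 1 ∘ₗ (InnerEnv.equiv k A).symm.toLinearMap ∘ₗ
    (AlgebraTensorModule.rid k (Env k A) (InnerEnv k A)).toLinearMap ∘ₗ
    (AlgebraTensorModule.congr (LinearEquiv.refl (Env k A) (InnerEnv k A))
      (PiTensorProduct.isEmptyEquiv (Fin 0))).toLinearMap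

lemma barAug_tmul (x y : A) (a : Fin 0 → A) :
    barAug k A (InnerEnv.mk x y ⊗ₜ PiTensorProduct.tprod k a) = x * y := by
  have : barAug k A (InnerEnv.mk x y ⊗ₜ PiTensorProduct.tprod k a) =
      ((PiTensorProduct.isEmptyEquiv (Fin 0) (PiTensorProduct.tprod k a) : k) •
        (x ⊗ₜ[k] op y : Env k A)) • (1 : A) := rfl
  rw [this, PiTensorProduct.isEmptyEquiv_apply_tprod, one_smul, TensorProduct.Algebra.smul_def]
  simp

end Bar

end Hochschild

namespace Hochschild

section BarResolution

universe u

variable (k A : Type u) [Field k] [Ring A] [Algebra k A]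

/-- The homotopy in degree `-1` that contracts the augmented bar resolution. -/
noncomputable def barUnit : A →ₗ[k] Bar k A 0 :=
  (TensorProduct.mk k (InnerEnv k A) _).flip (PiTensorProduct.tprod k Fin.elim0) ∘ₗ
    ((InnerEnv.equiv k A).toLinearMap.restrictScalars k ∘ₗ TensorProduct.mk k A Aᵐᵒᵖ 1 ∘ₗ
      (opLinearEquiv k).toLinearMap)

lemma barUnit_apply (x : A) (a : Fin 0 → A) :
    barUnit k A x = InnerEnv.mk 1 x ⊗ₜ PiTensorProduct.tprod k a := by
  rw [Subsingleton.elim a Fin.elim0]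
  rfl

lemma barD_smul (n : ℕ) (c : k) (z : Bar k A (n + 1)) : barD k A n (c • z) = c • barD k A n z :=
  map_smul (boundary k A (InnerEnv k A) n) c z

lemma barAug_smul (c : k) (z : Bar k A 0) : barAug k A (c • z) = c • barAug k A z := by
  let := instModuleTensorProductMop k A
  have h : c • z = algebraMap k (Env k A) c • z := (algebraMap_smul (Env k A) c z).symm
  rw [h, map_smul, Algebra.TensorProduct.algebraMap_apply, TensorProduct.Algebra.smul_def]
  simp [Algebra.smul_def]

lemma barD_barS_zero (z : Bar k A 0) :
    barD k A 0 (barS k A 0 z) + barUnit k A (barAug k A z) = z := by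
  induction z using bar_induction with
  | zero => simp
  | smul c z hz => rw [map_smul, barD_smul, barAug_smul, map_smul, ← smul_add, hz]
  | add z w hz hw =>
    simp only [map_add]
    rw [add_add_add_comm, hz, hw]
  | pure x y a =>
    rw [barS_tmul, barAug_tmul, barUnit_apply k A _ a]
    change boundary k A (InnerEnv k A) 0 _ + _ = _
    rw [boundary_tmul]
    simp only [Finset.univ_eq_empty, Finset.sum_empty, add_zero, zero_add, pow_one, Fin.tail_cons,
      Fin.cons_zero, InnerEnv.op_smul_mk, one_mul]
    rw [show (Fin.cons x a : Fin 1 → A) (Fin.last 0) = x from rfl, InnerEnv.smul_mk,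
      Subsingleton.elim (Fin.init (Fin.cons x a : Fin 1 → A)) a, neg_one_smul, neg_add_cancel_right]

lemma barAug_barD (z : Bar k A 1) : barAug k A (barD k A 0 z) = 0 := by
  induction z using bar_induction with
  | zero => simp
  | smul c z hz => rw [barD_smul, barAug_smul, hz, smul_zero]
  | add z w hz hw => rw [map_add, map_add, hz, hw, add_zero]
  | pure x y a =>
    change barAug k A (boundary k A (InnerEnv k A) 0 _) = _
    rw [boundary_tmul]
    simp only [Finset.univ_eq_empty, Finset.sum_empty, add_zero, zero_add, pow_one,
      InnerEnv.op_smul_mk, InnerEnv.smul_mk]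
    rw [map_add, barAug_smul, barAug_tmul, barAug_tmul, mul_assoc, neg_one_smul]
    exact add_neg_cancel _

/-- Over a field every $V$ is projective, and the module is its base change to the enveloping
algebra. -/
instance (V : Type u) [AddCommGroup V] [Module k V] :
    Module.Projective (Env k A) (InnerEnv k A ⊗[k] V) :=
  Module.Projective.of_equiv (M := Env k A ⊗[k] V)
    (AlgebraTensorModule.congr (InnerEnv.equiv k A) (LinearEquiv.refl k V))

/-- The bar resolution is a projective resolution. -/
lemma exists_bar_resolution : ∃ P : ProjectiveResolution (regularBimodule k A),
    P.complex = ChainComplex.of (fun n => ModuleCat.of (Env k A) (Bar k A n))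
      (fun n => ModuleCat.ofHom (barD k A n))
      (fun n => ModuleCat.hom_ext (LinearMap.ext (barD_comp k A n))) := by
  let := instModuleTensorProductMop k A
  refine exists_projectiveResolution _ _ (Z := regularBimodule k A) (ModuleCat.ofHom (barAug k A))
    (fun n => ?_) _ ?_ ?_ ?_ ?_
  · exact (IsProjective.iff_projective (Bar k A n)).1 inferInstance
  · exact ModuleCat.hom_ext (LinearMap.ext (barAug_barD k A))
  · intro x
    refine ⟨barUnit k A x, ?_⟩
    rw [barUnit_apply k A x Fin.elim0]
    exact (barAug_tmul k A 1 x _).trans (one_mul (M := A) x)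
  · intro x hx
    refine ⟨barS k A 0 x, ?_⟩
    have := barD_barS_zero k A x
    change barAug k A x = 0 at hx
    rwa [hx, map_zero, add_zero] at this
  · intro n x hx
    refine ⟨barS k A (n + 1) x, ?_⟩
    have := barD_barS k A n x
    change barD k A n x = 0 at hx
    rwa [hx, map_zero, add_zero] at this

end BarResolution

/-! ### Coefficients: tensoring free bimodules with M and mapping them to M -/

section Coefficients

set_option linter.unusedSectionVars false

variable {k A : Type*} [CommRing k] [Ring A] [Algebra k A]
variable {M : Type*} [AddCommGroup M] [Module k M] [Module A M] [Module Aᵐᵒᵖ M]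
  [IsScalarTower k A M] [IsScalarTower k Aᵐᵒᵖ M] [SMulCommClass A Aᵐᵒᵖ M]

/-- The bimodule map `x ⊗ y ↦ y · m · x` from the inner bimodule. -/
noncomputable def orbit : M →ₗ[k] InnerEnv k A →ₗ[k] M :=
  LinearMap.flip (TensorProduct.lift
    (LinearMap.mk₂ k (fun (x : A) (y : Aᵐᵒᵖ) => leftAct k A M y.unop ∘ₗ rightAct k A M x)
      (fun x x' y => by rw [map_add, LinearMap.comp_add])
      (fun c x y => by rw [map_smul, LinearMap.comp_smul])
      (fun x y y' => by rw [MulOpposite.unop_add, map_add, LinearMap.add_comp])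
      (fun c x y => by rw [unop_smul, map_smul, LinearMap.smul_comp])) :
    A ⊗[k] Aᵐᵒᵖ →ₗ[k] Module.End k M)

lemma orbit_mk (m : M) (x y : A) : orbit m (InnerEnv.mk x y : InnerEnv k A) = y • op x • m := rfl

lemma orbit_smul (m : M) (a : A) (z : InnerEnv k A) : orbit m (a • z) = a • orbit m z := by
  induction z using InnerEnv.induction with
  | zero => simp
  | pure x y => rw [InnerEnv.smul_mk, orbit_mk, orbit_mk, mul_smul]
  | add z w hz hw => rw [smul_add, map_add, map_add, hz, hw, smul_add]

lemma orbit_op_smul (m : M) (a : A) (z : InnerEnv k A) :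
    orbit m (op a • z) = op a • orbit m z := by
  induction z using InnerEnv.induction with
  | zero => simp
  | pure x y => rw [InnerEnv.op_smul_mk, orbit_mk, orbit_mk, op_mul, mul_smul, smul_comm y]
  | add z w hz hw => rw [smul_add, map_add, map_add, hz, hw, smul_add]

/-- The orbit map records $m\cdot e$ for the right action of $A^e$ on $M$, so iterating it
corresponds to a product in $A^e$. -/
lemma orbit_orbit (m : M) (e z : InnerEnv k A) :
    orbit (orbit m e) z = orbit m ((InnerEnv.equiv k A).symm e • z) := by
  induction e using InnerEnv.induction with
  | zero => simp [zero_smul (A ⊗[k] Aᵐᵒᵖ) z]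
  | add e e' h h' => simp only [map_add, LinearMap.add_apply, add_smul, h, h']
  | pure x y =>
    induction z using InnerEnv.induction with
    | zero => simp
    | add z w hz hw => rw [smul_add, map_add, map_add, hz, hw]
    | pure x' y' =>
      have : (InnerEnv.equiv k A).symm (InnerEnv.mk x y) • (InnerEnv.mk x' y' : InnerEnv k A) =
        InnerEnv.mk (x * x') (y' * y) := InnerEnv.env_smul_mk x y x' y'
      rw [this, orbit_mk, orbit_mk, orbit_mk, op_mul, mul_smul, mul_smul, ← smul_comm y (op x')]

variable {V V' V'' : Type*} [AddCommGroup V] [Module k V] [AddCommGroup V'] [Module k V']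
  [AddCommGroup V''] [Module k V'']

/-- The map `M ⊗ V → M ⊗ V'` induced by a map of free bimodules. -/
noncomputable def induced (φ : InnerEnv k A ⊗[k] V →ₗ[A ⊗[k] Aᵐᵒᵖ] InnerEnv k A ⊗[k] V') :
    M ⊗[k] V →ₗ[k] M ⊗[k] V' :=
  TensorProduct.lift ((LinearMap.rTensorHom V' ∘ₗ orbit).compl₂
    (φ.restrictScalars k ∘ₗ TensorProduct.mk k (InnerEnv k A) V (InnerEnv.mk 1 1)))

lemma induced_tmul (φ : InnerEnv k A ⊗[k] V →ₗ[A ⊗[k] Aᵐᵒᵖ] InnerEnv k A ⊗[k] V') (m : M)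
    (v : V) : induced φ (m ⊗ₜ v) = (orbit m).rTensor V' (φ (InnerEnv.mk 1 1 ⊗ₜ v)) := rfl

lemma rTensor_orbit_orbit (m : M) (e : InnerEnv k A) (z : InnerEnv k A ⊗[k] V) :
    (orbit (orbit m e)).rTensor V z =
      (orbit m).rTensor V ((InnerEnv.equiv k A).symm e • z) := by
  induction z using TensorProduct.induction_on with
  | zero => simp
  | add z w hz hw => rw [smul_add, map_add, map_add, hz, hw]
  | tmul x v => rw [smul_tmul', LinearMap.rTensor_tmul, LinearMap.rTensor_tmul, orbit_orbit]

/-- The functor $M\otimes_{A^e}-$ on $A^e\otimes V$ is realised as $M\otimes V$. A map `induced φ`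
is defined by the values at $1\otimes v$, and linearity of $\varphi$ over $A^e$ extends the formula
to all elements; this gives functoriality. -/
lemma induced_rTensor_orbit (φ : InnerEnv k A ⊗[k] V →ₗ[A ⊗[k] Aᵐᵒᵖ] InnerEnv k A ⊗[k] V')
    (m : M) (z : InnerEnv k A ⊗[k] V) :
    induced φ ((orbit m).rTensor V z) = (orbit m).rTensor V' (φ z) := by
  induction z using TensorProduct.induction_on with
  | zero => simp
  | add z w hz hw => simp only [map_add, hz, hw]
  | tmul e v =>
    have : (e ⊗ₜ[k] v : InnerEnv k A ⊗[k] V) =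
        (InnerEnv.equiv k A).symm e • (InnerEnv.mk 1 1 ⊗ₜ v) := by
      rw [smul_tmul', InnerEnv.smul_one, LinearEquiv.apply_symm_apply]
    rw [LinearMap.rTensor_tmul, induced_tmul, rTensor_orbit_orbit, ← map_smul, ← this]

lemma orbit_one (m : M) : orbit m (InnerEnv.mk 1 1 : InnerEnv k A) = m := by
  rw [orbit_mk, op_one, one_smul, one_smul]

lemma rTensor_orbit_one (m : M) (v : V) :
    (orbit m).rTensor V ((InnerEnv.mk 1 1 : InnerEnv k A) ⊗ₜ v) = m ⊗ₜ v := by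
  rw [LinearMap.rTensor_tmul, orbit_one]

lemma induced_id (z : M ⊗[k] V) :
    induced (LinearMap.id : InnerEnv k A ⊗[k] V →ₗ[A ⊗[k] Aᵐᵒᵖ] _) z = z := by
  induction z using TensorProduct.induction_on with
  | zero => simp
  | add z w hz hw => rw [map_add, hz, hw]
  | tmul m v => rw [induced_tmul, LinearMap.id_apply, rTensor_orbit_one]

lemma induced_comp (ψ : InnerEnv k A ⊗[k] V' →ₗ[A ⊗[k] Aᵐᵒᵖ] InnerEnv k A ⊗[k] V'')
    (φ : InnerEnv k A ⊗[k] V →ₗ[A ⊗[k] Aᵐᵒᵖ] InnerEnv k A ⊗[k] V') (z : M ⊗[k] V) :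
    induced (ψ ∘ₗ φ) z = induced ψ (induced φ z) := by
  induction z using TensorProduct.induction_on with
  | zero => simp
  | add z w hz hw => simp only [map_add, hz, hw]
  | tmul m v => rw [induced_tmul, induced_tmul, LinearMap.comp_apply, induced_rTensor_orbit]

lemma induced_add (φ ψ : InnerEnv k A ⊗[k] V →ₗ[A ⊗[k] Aᵐᵒᵖ] InnerEnv k A ⊗[k] V')
    (z : M ⊗[k] V) : induced (φ + ψ) z = induced φ z + induced ψ z := by
  induction z using TensorProduct.induction_on with
  | zero => simp
  | add z w hz hw =>
    rw [map_add, hz, hw, map_add, map_add, add_add_add_comm]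
  | tmul m v => rw [induced_tmul, LinearMap.add_apply, map_add]; rfl

/-- The left action `(a ⊗ b) · m = a · m · b` of the enveloping algebra. -/
noncomputable def envAct : InnerEnv k A →ₗ[k] Module.End k M :=
  (TensorProduct.lift
    (LinearMap.mk₂ k (fun (x : A) (y : Aᵐᵒᵖ) => leftAct k A M x ∘ₗ rightAct k A M y.unop)
      (fun x x' y => by rw [map_add, LinearMap.add_comp])
      (fun c x y => by rw [map_smul, LinearMap.smul_comp])
      (fun x y y' => by rw [MulOpposite.unop_add, map_add, LinearMap.comp_add])
      (fun c x y => by rw [unop_smul, map_smul, LinearMap.comp_smul])) :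
    A ⊗[k] Aᵐᵒᵖ →ₗ[k] Module.End k M)

lemma envAct_mk (m : M) (x y : A) : envAct (InnerEnv.mk x y : InnerEnv k A) m = x • op y • m := rfl

lemma envAct_smul (e z : InnerEnv k A) (m : M) :
    envAct ((InnerEnv.equiv k A).symm e • z) m = envAct e (envAct z m) := by
  induction e using InnerEnv.induction with
  | zero => simp [zero_smul (A ⊗[k] Aᵐᵒᵖ) z]
  | add e e' h h' => simp only [map_add, LinearMap.add_apply, add_smul, h, h']
  | pure x y =>
    induction z using InnerEnv.induction with
    | zero => simp
    | add z w hz hw => simp only [smul_add, map_add, LinearMap.add_apply, hz, hw]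
    | pure x' y' =>
      have : (InnerEnv.equiv k A).symm (InnerEnv.mk x y) • (InnerEnv.mk x' y' : InnerEnv k A) =
        InnerEnv.mk (x * x') (y' * y) := InnerEnv.env_smul_mk x y x' y'
      rw [this, envAct_mk, envAct_mk, envAct_mk, op_mul, mul_smul, mul_smul, ← smul_comm x' (op y)]

/-- The extension of a linear map to a map of bimodules. -/
noncomputable def extendHom (f : V →ₗ[k] M) : InnerEnv k A ⊗[k] V →ₗ[k] M :=
  TensorProduct.lift (envAct.compl₂ f)

lemma extendHom_tmul (f : V →ₗ[k] M) (e : InnerEnv k A) (v : V) :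
    extendHom f (e ⊗ₜ[k] v) = envAct e (f v) := rfl

lemma extendHom_smul (f : V →ₗ[k] M) (e : InnerEnv k A) (z : InnerEnv k A ⊗[k] V) :
    extendHom f ((InnerEnv.equiv k A).symm e • z) = envAct e (extendHom f z) := by
  induction z using TensorProduct.induction_on with
  | zero => simp
  | add z w hz hw => simp only [smul_add, map_add, hz, hw]
  | tmul x v => rw [smul_tmul', extendHom_tmul, extendHom_tmul, envAct_smul]

/-- The restriction of a bimodule map along a map of free bimodules. -/
noncomputable def pullback (φ : InnerEnv k A ⊗[k] V →ₗ[A ⊗[k] Aᵐᵒᵖ] InnerEnv k A ⊗[k] V')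
    (f : V' →ₗ[k] M) : V →ₗ[k] M :=
  extendHom f ∘ₗ φ.restrictScalars k ∘ₗ TensorProduct.mk k (InnerEnv k A) V (InnerEnv.mk 1 1)

/-- The dual statement: under $\mathrm{Hom}_{A^e}(A^e\otimes V,M)=\mathrm{Hom}(V,M)$, pullback is
composition with $\varphi$. -/
lemma extendHom_pullback (φ : InnerEnv k A ⊗[k] V →ₗ[A ⊗[k] Aᵐᵒᵖ] InnerEnv k A ⊗[k] V')
    (f : V' →ₗ[k] M) (z : InnerEnv k A ⊗[k] V) :
    extendHom (pullback φ f) z = extendHom f (φ z) := by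
  induction z using TensorProduct.induction_on with
  | zero => simp
  | add z w hz hw => simp only [map_add, hz, hw]
  | tmul e v =>
    have : (e ⊗ₜ[k] v : InnerEnv k A ⊗[k] V) =
        (InnerEnv.equiv k A).symm e • (InnerEnv.mk 1 1 ⊗ₜ v) := by
      rw [smul_tmul', InnerEnv.smul_one, LinearEquiv.apply_symm_apply]
    conv_rhs => rw [this, map_smul, extendHom_smul]
    rfl

end Coefficients

end Hochschild

section Homotopies

universe u v

variable {R : Type u} [Ring R]

/-- A homotopy equivalence of chain complexes, on elements of positive degree. -/
lemma HomotopyEquiv.exists_homotopy_apply {K L : ChainComplex (ModuleCat.{v} R) ℕ}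
    (e : HomotopyEquiv K L) : ∃ h : ∀ n, L.X n →ₗ[R] L.X (n + 1), ∀ n (x : L.X (n + 1)),
      e.hom.f (n + 1) (e.inv.f (n + 1) x) =
        h n (L.d (n + 1) n x) + L.d (n + 2) (n + 1) (h (n + 1) x) + x := by
  refine ⟨fun n => (e.homotopyInvHomId.hom n (n + 1)).hom, fun n x => ?_⟩
  have h := e.homotopyInvHomId.comm (n + 1)
  rw [Homotopy.dNext_succ_chainComplex, Homotopy.prevD_chainComplex] at h
  exact LinearMap.congr_fun (congrArg ModuleCat.Hom.hom h) x

end Homotopies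

/-! ### Hochschild homology from an arbitrary projective resolution -/

namespace Hochschild

section Comparison

set_option linter.unusedSectionVars false

universe u v

variable {k A : Type u} [Field k] [Ring A] [Algebra k A]
variable {M : Type v} [AddCommGroup M] [Module k M] [Module A M] [Module Aᵐᵒᵖ M]
  [IsScalarTower k A M] [IsScalarTower k Aᵐᵒᵖ M] [SMulCommClass A Aᵐᵒᵖ M]

lemma rTensor_orbit_barD (n : ℕ) (m : M) (z : Bar k A (n + 1)) :
    (orbit m).rTensor _ (barD k A n z) = boundary k A M n ((orbit m).rTensor _ z) :=
  (boundary_rTensor (k := k) (A := A) (M := InnerEnv k A) (M' := M) (orbit m)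
    (orbit_smul m) (orbit_op_smul m) n z).symm

/-- Identifies the standard chain complex with $M\otimes_{A^e}$ the bar resolution, so homotopies of
bimodule complexes act on Hochschild chains. -/
lemma induced_barD (n : ℕ) (z : Chains k A M (n + 1)) :
    induced (barD k A n) z = boundary k A M n z := by
  induction z using TensorProduct.induction_on with
  | zero => simp
  | add z w hz hw => rw [map_add, map_add, hz, hw]
  | tmul m t => rw [induced_tmul, rTensor_orbit_barD, rTensor_orbit_one]

lemma extendHom_barD (n : ℕ) (f : MultilinearMap k (fun _ : Fin n => A) M)
    (a : Fin (n + 1) → A) :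
    extendHom (PiTensorProduct.lift f)
        (barD k A n (InnerEnv.mk 1 1 ⊗ₜ PiTensorProduct.tprod k a)) = coboundary k A M n f a := by
  change extendHom _ (boundary k A (InnerEnv k A) n _) = _
  rw [boundary_eq_sum, coboundary_eq_sum, map_sum]
  refine Finset.sum_congr rfl fun i _ => ?_
  rw [map_smul, InnerEnv.op_smul_mk, InnerEnv.smul_mk, extendHom_tmul, envAct_mk,
    PiTensorProduct.lift.tprod, one_mul, mul_one]

lemma induced_zero {V V' : Type*} [AddCommGroup V] [Module k V] [AddCommGroup V'] [Module k V']
    (z : M ⊗[k] V) :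
    induced (0 : InnerEnv k A ⊗[k] V →ₗ[Env k A] InnerEnv k A ⊗[k] V') z = 0 := by
  induction z using TensorProduct.induction_on with
  | zero => simp
  | add z w hz hw => rw [map_add, hz, hw, add_zero]
  | tmul m t => rw [induced_tmul, LinearMap.zero_apply, map_zero]

/-- The pullback of a multilinear map along a map of bar terms. -/
noncomputable def multilinearPullback {m n : ℕ} (φ : Bar k A m →ₗ[Env k A] Bar k A n)
    (f : MultilinearMap k (fun _ : Fin n => A) M) : MultilinearMap k (fun _ : Fin m => A) M :=
  (pullback φ (PiTensorProduct.lift f)).compMultilinearMap (PiTensorProduct.tprod k)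

lemma lift_multilinearPullback {m n : ℕ} (φ : Bar k A m →ₗ[Env k A] Bar k A n)
    (f : MultilinearMap k (fun _ : Fin n => A) M) :
    PiTensorProduct.lift (multilinearPullback φ f) = pullback φ (PiTensorProduct.lift f) :=
  PiTensorProduct.ext (by ext a; simp [multilinearPullback])

lemma lift_coboundary (n : ℕ) (f : MultilinearMap k (fun _ : Fin n => A) M) :
    PiTensorProduct.lift (coboundary k A M n f) =
      pullback (barD k A n) (PiTensorProduct.lift f) := by
  refine PiTensorProduct.ext ?_
  ext a
  simp only [LinearMap.compMultilinearMap_apply, PiTensorProduct.lift.tprod]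
  exact (extendHom_barD n f a).symm

lemma chainComplex_d_apply (n : ℕ) (x : Chains k A M (n + 1)) :
    (chainComplex k A M).d (n + 1) n x = boundary k A M n x :=
  LinearMap.congr_fun (congrArg ModuleCat.Hom.hom (ChainComplex.of_d_succ
    (fun n => ModuleCat.of k (Chains k A M n)) (fun n => ModuleCat.ofHom (boundary k A M n))
    (fun n => ModuleCat.hom_ext (boundary_comp k A M n)) n)) x

lemma cochainComplex_d_apply (n : ℕ) (f : MultilinearMap k (fun _ : Fin n => A) M) :
    (cochainComplex k A M).d n (n + 1) f = coboundary k A M n f :=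
  LinearMap.congr_fun (congrArg ModuleCat.Hom.hom (CochainComplex.of_d_succ
    (fun n => ModuleCat.of k (MultilinearMap k (fun _ : Fin n => A) M))
    (fun n => ModuleCat.ofHom (coboundary k A M n))
    (fun n => ModuleCat.hom_ext (coboundary_comp k A M n)) n)) f

/-- A projective resolution of the regular bimodule, compared with the bar resolution. -/
lemma exists_comparison (P : ProjectiveResolution (regularBimodule k A)) :
    ∃ (f : ∀ n, Bar k A n →ₗ[Env k A] P.complex.X n)
      (g : ∀ n, P.complex.X n →ₗ[Env k A] Bar k A n)
      (h : ∀ n, Bar k A n →ₗ[Env k A] Bar k A (n + 1))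
      (h' : ∀ n, P.complex.X n →ₗ[Env k A] P.complex.X (n + 1)),
      (∀ n x, f n (barD k A n x) = P.complex.d (n + 1) n (f (n + 1) x)) ∧
      (∀ n x, g n (P.complex.d (n + 1) n x) = barD k A n (g (n + 1) x)) ∧
      (∀ n x, g (n + 1) (f (n + 1) x) =
        h n (barD k A n x) + barD k A (n + 1) (h (n + 1) x) + x) ∧
      (∀ n x, f (n + 1) (g (n + 1) x) = h' n (P.complex.d (n + 1) n x) +
        P.complex.d (n + 2) (n + 1) (h' (n + 1) x) + x) := by
  obtain ⟨Q, hQ⟩ := exists_bar_resolution k A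
  have e := ProjectiveResolution.homotopyEquiv P Q
  rw [hQ] at e
  obtain ⟨h, hh⟩ := e.exists_homotopy_apply
  obtain ⟨h', hh'⟩ := e.symm.exists_homotopy_apply
  refine ⟨fun n => (e.inv.f n).hom, fun n => (e.hom.f n).hom, h, h', fun n x => ?_, fun n x => ?_,
    fun n x => ?_, hh'⟩
  · have := e.inv.comm (n + 1) n
    rw [ChainComplex.of_d_succ] at this
    exact (LinearMap.congr_fun (congrArg ModuleCat.Hom.hom this) x).symm
  · have := e.hom.comm (n + 1) n
    rw [ChainComplex.of_d_succ] at this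
    exact (LinearMap.congr_fun (congrArg ModuleCat.Hom.hom this) x).symm
  · have := hh n x
    rw [ChainComplex.of_d_succ, ChainComplex.of_d_succ] at this
    exact this

/-- A contraction of the bar resolution in one degree, from a resolution that vanishes there. -/
lemma exists_contraction (P : ProjectiveResolution (regularBimodule k A)) {n : ℕ}
    (hP : Limits.IsZero (P.complex.X (n + 1))) :
    ∃ (h : Bar k A n →ₗ[Env k A] Bar k A (n + 1))
      (h' : Bar k A (n + 1) →ₗ[Env k A] Bar k A (n + 2)),
      h ∘ₗ barD k A n + barD k A (n + 1) ∘ₗ h' = LinearMap.id := by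
  obtain ⟨f, g, h, -, -, -, hh, -⟩ := exists_comparison P
  -- The composite through the zero term vanishes in this degree, so the homotopy relation expresses
  -- the identity; the sign comes from its orientation.
  refine ⟨-h n, -h (n + 1), LinearMap.ext fun x => ?_⟩
  have := ModuleCat.subsingleton_of_isZero hP
  have h0 := hh n x
  rw [Subsingleton.elim (f (n + 1) x) 0, map_zero] at h0
  simp only [LinearMap.add_apply, LinearMap.comp_apply, LinearMap.neg_apply, map_neg,
    LinearMap.id_apply]
  rw [← neg_add, neg_eq_iff_add_eq_zero]
  exact h0.symm

variable (M)

/-- Tensoring the contraction with $M$, a cycle $x$ is the boundary of the image of $x$ under $h'$.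
-/
lemma subsingleton_homology (P : ProjectiveResolution (regularBimodule k A)) {n : ℕ}
    (hP : Limits.IsZero (P.complex.X (n + 1))) : Subsingleton (homology k A M (n + 1)) := by
  obtain ⟨h, h', hh⟩ := exists_contraction P hP
  refine ModuleCat.subsingleton_homology (ChainComplex.exactAt_succ_of_forall _ n ?_)
  intro (x : Chains k A M (n + 1)) hx
  replace hx : boundary k A M n x = 0 := (chainComplex_d_apply n x).symm.trans hx
  refine ⟨induced h' x, (chainComplex_d_apply (n + 1) _).trans ?_⟩
  have h1 := induced_id (k := k) (A := A) (M := M) x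
  rw [← hh, induced_add, induced_comp, induced_comp, induced_barD, induced_barD, hx, map_zero,
    zero_add] at h1
  exact h1

/-- Dually, a cocycle $f$ is the coboundary of $f\circ h$; the other half of the contraction enters.
-/
lemma subsingleton_cohomology (P : ProjectiveResolution (regularBimodule k A)) {n : ℕ}
    (hP : Limits.IsZero (P.complex.X (n + 1))) : Subsingleton (cohomology k A M (n + 1)) := by
  obtain ⟨h, h', hh⟩ := exists_contraction P hP
  refine ModuleCat.subsingleton_homology (CochainComplex.exactAt_succ_of_forall _ n ?_)
  intro (f : MultilinearMap k (fun _ : Fin (n + 1) => A) M) hf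
  replace hf : coboundary k A M (n + 1) f = 0 := (cochainComplex_d_apply (n + 1) f).symm.trans hf
  refine ⟨multilinearPullback h f, (cochainComplex_d_apply n _).trans ?_⟩
  refine MultilinearMap.ext fun a => ?_
  have h3 : ∀ z, extendHom (k := k) (A := A) (M := M)
      (0 : PiTensorProduct k (fun _ : Fin (n + 2) => A) →ₗ[k] M) z = 0 := by
    intro z
    induction z using TensorProduct.induction_on with
    | zero => simp
    | add z w hz hw => rw [map_add, hz, hw, add_zero]
    | tmul x v => rw [extendHom_tmul, LinearMap.zero_apply, map_zero]
  obtain ⟨z, hz⟩ : ∃ z : Bar k A (n + 1), z = InnerEnv.mk 1 1 ⊗ₜ PiTensorProduct.tprod k a :=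
    ⟨_, rfl⟩
  have h1 : extendHom (PiTensorProduct.lift f) z = f a := by
    rw [hz, extendHom_tmul, PiTensorProduct.lift.tprod, envAct_mk, op_one, one_smul, one_smul]
  have h2 : h (barD k A n z) + barD k A (n + 1) (h' z) = z := LinearMap.congr_fun hh z
  rw [← extendHom_barD, ← hz, lift_multilinearPullback, extendHom_pullback, ← h1]
  conv_rhs => rw [← h2]
  rw [map_add, ← extendHom_pullback (barD k A (n + 1)), ← lift_coboundary, hf, map_zero, h3,
    add_zero]

variable {M} in
lemma rTensor_orbit_smul {V : Type*} [AddCommGroup V] [Module k V] (m : M) {w : Env k A}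
    (hw : orbit m (InnerEnv.equiv k A w) = 0) (z : InnerEnv k A ⊗[k] V) :
    (orbit m).rTensor V (w • z) = 0 := by
  have := rTensor_orbit_orbit m (InnerEnv.equiv k A w) z
  rw [LinearEquiv.symm_apply_apply, hw, map_zero] at this
  rw [← this, LinearMap.rTensor_zero, LinearMap.zero_apply]

/-- The top homology, for a resolution whose last term is free of rank one and whose last
differential vanishes on the coefficients. -/
lemma nonempty_homology_equiv (P : ProjectiveResolution (regularBimodule k A)) {n : ℕ}
    (hP : Limits.IsZero (P.complex.X (n + 2))) (e : P.complex.X (n + 1) ≃ₗ[Env k A] Env k A)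
    {ι : Type*} [Fintype ι] (w : ι → Env k A) (y : ι → P.complex.X n)
    (hd : P.complex.d (n + 1) n (e.symm 1) = ∑ i, w i • y i)
    (hw : ∀ i (m : M), orbit m (InnerEnv.equiv k A (w i)) = 0) :
    Nonempty (homology k A M (n + 1) ≃ₗ[k] M) := by
  obtain ⟨f, g, h, h', hf, hg, hh, hh'⟩ := exists_comparison P
  have := ModuleCat.subsingleton_of_isZero hP
  -- The top term is rewritten as $A^e\otimes k$ so that `induced` applies to it.
  let ρ : (Env k A) ≃ₗ[Env k A] InnerEnv k A ⊗[k] k :=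
    (InnerEnv.equiv k A).trans (AlgebraTensorModule.rid k (Env k A) (InnerEnv k A)).symm
  have hρ : ∀ z, ρ z = InnerEnv.equiv k A z ⊗ₜ 1 := fun z => rfl
  let φ : Bar k A (n + 1) →ₗ[Env k A] InnerEnv k A ⊗[k] k :=
    ρ.toLinearMap ∘ₗ e.toLinearMap ∘ₗ f (n + 1)
  let γ : InnerEnv k A ⊗[k] k →ₗ[Env k A] Bar k A (n + 1) :=
    g (n + 1) ∘ₗ e.symm.toLinearMap ∘ₗ ρ.symm.toLinearMap
  have hφ : ∀ x, φ (barD k A (n + 1) x) = 0 := fun x => by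
    change ρ (e (f (n + 1) _)) = 0
    rw [hf, Subsingleton.elim (f (n + 2) x) 0, map_zero, map_zero, map_zero]
  have hγφ : γ ∘ₗ φ = h n ∘ₗ barD k A n + barD k A (n + 1) ∘ₗ h (n + 1) + LinearMap.id := by
    refine LinearMap.ext fun x => ?_
    change g (n + 1) (e.symm (ρ.symm (ρ (e (f (n + 1) x))))) = _
    rw [LinearEquiv.symm_apply_apply, LinearEquiv.symm_apply_apply, hh]
    rfl
  refine ChainComplex.nonempty_homology_equiv (chainComplex k A M) n
    (W := M) ((TensorProduct.rid k M).toLinearMap ∘ₗ induced φ) ?_ ?_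
  · intro m
    -- The class of $m$ is represented by $m\cdot g(e^{-1}(1))$. It is a cycle because every
    -- coefficient $w_i$ of $d(e^{-1}(1))$ annihilates $m$.
    refine ⟨(orbit m).rTensor _ (g (n + 1) (e.symm 1)), (chainComplex_d_apply n _).trans ?_, ?_⟩
    · rw [← rTensor_orbit_barD, ← hg, hd, map_sum, map_sum]
      refine Finset.sum_eq_zero fun i _ => ?_
      rw [map_smul]
      exact rTensor_orbit_smul m (hw i m) _
    · change TensorProduct.rid k M (induced φ _) = m
      rw [induced_rTensor_orbit]
      change TensorProduct.rid k M ((orbit m).rTensor k (ρ (e (f (n + 1) (g (n + 1) _))))) = m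
      -- In top degree $fg$ differs from the identity only by $h'd$, since the term above is zero.
      -- That difference again has coefficients $w_i$ and dies on $m$.
      rw [hh', Subsingleton.elim (h' (n + 1) (e.symm 1)) 0, map_zero, add_zero, hd, map_sum,
        map_add, map_sum, map_add, map_add, LinearEquiv.apply_symm_apply, map_sum, map_sum,
        Finset.sum_eq_zero, zero_add, hρ, LinearMap.rTensor_tmul, TensorProduct.rid_tmul, one_smul]
      · exact orbit_one m
      · intro i _
        rw [map_smul, map_smul, map_smul]
        exact rTensor_orbit_smul m (hw i m) _
  · intro (x : Chains k A M (n + 1)) hx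
    replace hx : boundary k A M n x = 0 := (chainComplex_d_apply n x).symm.trans hx
    refine Iff.trans (b := ∃ y, boundary k A M (n + 1) y = x) ?_
      (exists_congr fun y => by rw [← chainComplex_d_apply]; rfl)
    change TensorProduct.rid k M (induced φ x) = 0 ↔ ∃ y, boundary k A M (n + 1) y = x
    rw [LinearEquiv.map_eq_zero_iff]
    constructor
    · intro h0
      refine ⟨-induced (h (n + 1)) x, ?_⟩
      have h1 := induced_comp (M := M) γ φ x
      rw [h0, map_zero, hγφ, induced_add, induced_add, induced_comp, induced_comp, induced_barD,
        induced_barD, hx, map_zero, zero_add, induced_id] at h1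
      rw [map_neg]
      exact neg_eq_of_add_eq_zero_right h1
    · rintro ⟨z, rfl⟩
      rw [← induced_barD, ← induced_comp]
      have : φ ∘ₗ barD k A (n + 1) = 0 := LinearMap.ext hφ
      rw [this, induced_zero]

end Comparison

end Hochschild

/-! ### The resolution of length three and the theorem -/

namespace BilinearForm

open Matrix Hochschild

section Resolution

variable {n : ℕ} (E : GL (Fin n) ℂ)

/-- The terms of the length three resolution of the regular bimodule. -/
noncomputable def koszulTerm : ℕ → ModuleCat.{0} (Env ℂ (Alg E))
  | 0 => ModuleCat.of _ (Env ℂ (Alg E))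
  | 1 => ModuleCat.of _ (Matrix (Fin n) (Fin n) (Env ℂ (Alg E)))
  | 2 => ModuleCat.of _ (Matrix (Fin n) (Fin n) (Env ℂ (Alg E)))
  | 3 => ModuleCat.of _ (Env ℂ (Alg E))
  | _ + 4 => ModuleCat.of _ PUnit

/-- The differentials of the length three resolution of the regular bimodule. -/
noncomputable def koszulD : ∀ m, koszulTerm E (m + 1) ⟶ koszulTerm E m
  | 0 => ModuleCat.ofHom (env₁ E)
  | 1 => ModuleCat.ofHom (env₂ E)
  | 2 => ModuleCat.ofHom (env₃ E)
  | _ + 3 => 0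

lemma finite_koszulTerm : ∀ m, Module.Finite (Env ℂ (Alg E)) (koszulTerm E m)
  | 0 => inferInstanceAs (Module.Finite _ (Env ℂ (Alg E)))
  | 1 => inferInstanceAs (Module.Finite _ (Matrix (Fin n) (Fin n) (Env ℂ (Alg E))))
  | 2 => inferInstanceAs (Module.Finite _ (Matrix (Fin n) (Fin n) (Env ℂ (Alg E))))
  | 3 => inferInstanceAs (Module.Finite _ (Env ℂ (Alg E)))
  | _ + 4 => inferInstanceAs (Module.Finite (Env ℂ (Alg E)) PUnit)

lemma projective_koszulTerm : ∀ m, Projective (koszulTerm E m)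
  | 0 => (IsProjective.iff_projective (Env ℂ (Alg E))).1 inferInstance
  | 1 => (IsProjective.iff_projective (Matrix (Fin n) (Fin n) (Env ℂ (Alg E)))).1 inferInstance
  | 2 => (IsProjective.iff_projective (Matrix (Fin n) (Fin n) (Env ℂ (Alg E)))).1 inferInstance
  | 3 => (IsProjective.iff_projective (Env ℂ (Alg E))).1 inferInstance
  | _ + 4 => (IsProjective.iff_projective PUnit).1 inferInstance

lemma env_smul_one {A : Type} [Ring A] [Algebra ℂ A] (x : Env ℂ A) :
    letI := instModuleTensorProductMop ℂ A
    x • (1 : A) = multiplication x := by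
  let := instModuleTensorProductMop ℂ A
  induction x using TensorProduct.induction_on with
  | zero => rw [map_zero, zero_smul (A ⊗[ℂ] Aᵐᵒᵖ) (1 : A)]
  | add x y hx hy => rw [add_smul, map_add, hx, hy]
  | tmul a b =>
    rw [TensorProduct.Algebra.smul_def, multiplication_tmul]
    simp

/-- The last clause writes the top differential at the generator in the basis of matrix units; its
coefficients are what must annihilate $M$ to compute the top homology. -/
theorem exists_koszul_resolution (hn : 2 ≤ n) :
    ∃ P : ProjectiveResolution (regularBimodule ℂ (Alg E)),
      (∀ m, Module.Finite (Env ℂ (Alg E)) (P.complex.X m)) ∧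
      (∀ m, 3 < m → Limits.IsZero (P.complex.X m)) ∧
      ∃ (e : P.complex.X 3 ≃ₗ[Env ℂ (Alg E)] Env ℂ (Alg E))
        (y : Fin n × Fin n → P.complex.X 2),
        P.complex.d 3 2 (e.symm 1) = ∑ p : Fin n × Fin n, env₃ E 1 p.1 p.2 • y p := by
  let := instModuleTensorProductMop ℂ (Alg E)
  obtain ⟨h12, h23, hex₀, hex₁, hex₂, hex₃⟩ := env_exact E hn
  have haug : ∀ x : Env ℂ (Alg E),
    LinearMap.toSpanSingleton (Env ℂ (Alg E)) (Alg E) 1 x = multiplication x := env_smul_one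
  obtain ⟨P, hP⟩ := exists_projectiveResolution (koszulTerm E) (koszulD E)
    (Z := regularBimodule ℂ (Alg E))
    (ModuleCat.ofHom (LinearMap.toSpanSingleton (Env ℂ (Alg E)) (Alg E) 1))
    (projective_koszulTerm E)
    (fun m => match m with
      | 0 => ModuleCat.hom_ext (LinearMap.ext h12)
      | 1 => ModuleCat.hom_ext (LinearMap.ext h23)
      | _ + 2 => Limits.zero_comp)
    (ModuleCat.hom_ext (LinearMap.ext fun z => (haug _).trans (multiplication_env₁ E z)))
    (fun a => ⟨(a ⊗ₜ[ℂ] 1 : Env ℂ (Alg E)), (haug _).trans (mul_one (M := Alg E) a)⟩)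
    (fun x hx => hex₀ x ((haug x).symm.trans hx))
    (fun m => match m with
      | 0 => hex₁
      | 1 => hex₂
      | 2 => fun x hx => ⟨0, (map_zero _).trans (hex₃ x hx).symm⟩
      | _ + 3 => fun x _ => ⟨0, Subsingleton.elim (α := PUnit) _ _⟩)
  refine ⟨P, ?_⟩
  rw [hP]
  refine ⟨finite_koszulTerm E, fun m hm => ?_, LinearEquiv.refl _ (Env ℂ (Alg E)),
    fun p => (Matrix.single p.1 p.2 1 : Matrix (Fin n) (Fin n) (Env ℂ (Alg E))), ?_⟩
  · obtain ⟨m, rfl⟩ := Nat.exists_eq_add_of_le' hm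
    exact ModuleCat.isZero_of_subsingleton (ModuleCat.of (Env ℂ (Alg E)) PUnit)
  · rw [ChainComplex.of_d_succ]
    change env₃ E 1 = ∑ p : Fin n × Fin n, env₃ E 1 p.1 p.2 •
      (Matrix.single p.1 p.2 1 : Matrix (Fin n) (Fin n) (Env ℂ (Alg E)))
    conv_lhs => rw [matrix_eq_sum_single (env₃ E 1), ← Fintype.sum_prod_type']
    refine Finset.sum_congr rfl fun p _ => ?_
    rw [Matrix.smul_single, smul_eq_mul, mul_one]

/-- The last differential vanishes on the coefficients twisted by the sovereign character. -/
lemma orbit_env₃ (m : CharBimodule (sovereign E) (sovereignInv E)) (i j : Fin n) :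
    orbit m (InnerEnv.equiv ℂ (Alg E) (env₃ E 1 i j)) = 0 := by
  let M := CharBimodule (sovereign E) (sovereignInv E)
  obtain ⟨φ, hφ⟩ : ∃ φ : Env ℂ (Alg E) →+ M, ∀ x, φ x = orbit m (InnerEnv.equiv ℂ (Alg E) x) :=
    ⟨(orbit m).toAddMonoidHom.comp (InnerEnv.equiv ℂ (Alg E)).toAddEquiv.toAddMonoidHom,
      fun _ => rfl⟩
  have hφs : ∀ (c : ℂ) x, φ (c • x) = c • φ x := fun c x => by
    rw [hφ, hφ, ← map_smul]
    rfl
  have hmul : ∀ x a b, φ (x * (a ⊗ₜ op b)) = b • op a • φ x := fun x a b => by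
    rw [hφ, hφ, ← orbit_mk (k := ℂ) (orbit m (InnerEnv.equiv ℂ (Alg E) x)) a b, orbit_orbit]
    rfl
  have hu : ∀ i j, sovereign E (u E i j) = ((E⁻¹).val * E.valᵀ) i j := fun i j =>
    congrFun (congrFun (character_u E _ _ _) i) j
  have hu' : ∀ i j, sovereignInv E (u E i j) = ((E⁻¹).valᵀ * E.val) i j := fun i j =>
    congrFun (congrFun (character_u E _ _ _) i) j
  -- The orbit map is $x\otimes y\mapsto y\cdot m\cdot x$, so the first factor acts through
  -- $\Phi^{-1}$ and the second through $\Phi$. Evaluation at $m$ turns the matrices of the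
  -- differential into scalar ones.
  have hφU : ∀ i j x, φ ((envU E)ᵀ i j x) = opScalars M (((E⁻¹).valᵀ * E.val)ᵀ) i j (φ x) :=
    fun i j x => by
      rw [transpose_apply, envU_apply, ← op_one, hmul, one_smul, opScalars_apply_apply,
        transpose_apply, ← hu']
      rfl
  have hφL : ∀ i j x, φ ((envL E)ᵀ i j x) = opScalars M (((E⁻¹).val * E.valᵀ)ᵀ) i j (φ x) :=
    fun i j x => by
      rw [transpose_apply, envL_apply, hmul, op_one, one_smul, opScalars_apply_apply,
        transpose_apply, ← hu]
      rfl
  have key := map_diff₃ φ hφs E.valᵀᵀ (E⁻¹).valᵀᵀ (map_scalars_mul φ hφs hφU (E⁻¹).valᵀ)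
    (map_scalars_mul φ hφs hφL (E⁻¹).valᵀᵀ) 1
  have hE : (E⁻¹).valᵀ * E.valᵀ = 1 := by rw [← transpose_mul, E.mul_inv, transpose_one]
  have hE' : (E⁻¹).val * E.val = 1 := E.inv_mul
  have hs : ∀ (K : Matrix (Fin n) (Fin n) ℂ) (w : M),
      (spread (S := ℂ) K w)ᵀ = spread (S := ℂ) Kᵀ w := fun _ _ => rfl
  -- With these scalars $Q$ becomes $E^{-1}$ and $T$ becomes $(E^{-1})^t$. Then $Q(TE^t)^t=E^{-1}$
  -- cancels the first term of $d_3$, and this singles out the sovereign twist.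
  have hQ : (E⁻¹).valᵀ * ((E⁻¹).valᵀ * E.val)ᵀ = (E⁻¹).val := by
    rw [transpose_mul, transpose_transpose, ← Matrix.mul_assoc, hE, Matrix.one_mul]
  have hT : (E⁻¹).val * ((E⁻¹).val * E.valᵀ)ᵀ = (E⁻¹).valᵀ := by
    rw [transpose_mul, transpose_transpose, ← Matrix.mul_assoc, hE', Matrix.one_mul]
  have h0 : φ (env₃ E 1 i j) = 0 := by
    refine (congrFun (congrFun key i) j).trans ?_
    rw [diff₃_apply, convert_apply]
    simp only [← opScalars.eq_1, transpose_transpose, opScalars_mul, hQ, hT, hs,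
      act_opScalars_spread, hE, transpose_one, Matrix.mul_one]
    rw [sub_self]
    rfl
  exact (hφ _).symm.trans h0

end Resolution

end BilinearForm

theorem theorem6p1 {n : ℕ} (hn : 2 ≤ n) (E : GL (Fin n) ℂ) :
    IsSmoothOfDim ℂ (BilinearForm.Alg E) 3 ∧
    (∀ (M : Type*) [AddCommGroup M] [Module ℂ M]
        [Module (BilinearForm.Alg E) M] [Module (BilinearForm.Alg E)ᵐᵒᵖ M]
        [IsScalarTower ℂ (BilinearForm.Alg E) M] [IsScalarTower ℂ (BilinearForm.Alg E)ᵐᵒᵖ M]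
        [SMulCommClass (BilinearForm.Alg E) (BilinearForm.Alg E)ᵐᵒᵖ M] (k : ℕ), 4 ≤ k →
      Subsingleton (Hochschild.homology ℂ (BilinearForm.Alg E) M k) ∧
      Subsingleton (Hochschild.cohomology ℂ (BilinearForm.Alg E) M k)) ∧
    Nonempty (Hochschild.homology ℂ (BilinearForm.Alg E)
      (Hochschild.CharBimodule (BilinearForm.sovereign E) (BilinearForm.sovereignInv E)) 3
        ≃ₗ[ℂ] ℂ) := by
  obtain ⟨P, hfin, hzero, e, y, hd⟩ := BilinearForm.exists_koszul_resolution E hn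
  have htop : Nonempty (Hochschild.homology ℂ (BilinearForm.Alg E)
      (Hochschild.CharBimodule (BilinearForm.sovereign E) (BilinearForm.sovereignInv E)) 3
        ≃ₗ[ℂ] ℂ) :=
    Hochschild.nonempty_homology_equiv _ P (hzero 4 (by omega)) e _ y hd
      fun p m => BilinearForm.orbit_env₃ E m p.1 p.2
  refine ⟨⟨⟨P, hfin, hzero⟩, ?_⟩, ?_, htop⟩
  -- A resolution of length less than three would make the twisted $H_3$ vanish, but it is
  -- one-dimensional.
  · rintro m ⟨Q, -, hQ⟩
    by_contra! hm
    have := Hochschild.subsingleton_homology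
      (Hochschild.CharBimodule (BilinearForm.sovereign E) (BilinearForm.sovereignInv E)) Q
      (hQ 3 hm)
    obtain ⟨f⟩ := htop
    exact one_ne_zero (f.symm.injective (Subsingleton.elim (f.symm 1) (f.symm 0)))
  · intro M _ _ _ _ _ _ _ k hk
    obtain ⟨k, rfl⟩ := Nat.exists_eq_succ_of_ne_zero (by omega : k ≠ 0)
    exact ⟨Hochschild.subsingleton_homology M P (hzero _ hk),
      Hochschild.subsingleton_cohomology M P (hzero _ hk)⟩
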